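/- Let $n\ge 2$ and let $H_n=\mathbb R^{2n+1}$, with points $(x,y,t)=(z,t)$, be the Heisenberg group with product $(x,y,t)\circ(\tilde x,\tilde y,\tilde t)=\bigl(x+\tilde x,\,y+\tilde y,\,t+\tilde t+\sum_j(y_j\tilde x_j-x_j\tilde y_j)\bigr)$, contact form $\Theta=dt+\sum_j(x_jdy_j-y_jdx_j)$, contact bundle $\xi=\ker\Theta$, left invariant frame $\mathring e_j=\partial_{x_j}+y_j\partial_t$, $\mathring e_{n+j}=\partial_{y_j}-x_j\partial_t$ of $\xi$, $T=\partial_t$, CR structure $J\mathring e_j=\mathring e_{n+j}$, $J\mathring e_{n+j}=-\mathring e_j$, Levi metric (for which the frame $\mathring e_1,\dots,\mathring e_{2n}$ is orthonormal), and pseudohermitian connection $\nabla$ (for which this frame is parallel). Let $\Sigma$ be an immersed $C^2$ hypersurface (without boundary) of $H_n$. A point $p\in\Sigma$ is singular if $\xi=T\Sigma$ at $p$, and regular otherwise; assume that the regular part of $\Sigma$ is $C^\infty$. At regular points put $\xi'=(\xi\cap T\Sigma)\cap J(\xi\cap T\Sigma)$, let $e_n$ be a (locally chosen, continuously differentiable)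 unit vector field in $(\xi\cap T\Sigma)\cap(\xi')^{\perp}$, which is unique up to sign, and put $e_{2n}=Je_n$. Let $\alpha$ be the function with $\alpha e_{2n}+T\in T\Sigma$, let $J'=J$ on $\xi'$ and $J'e_n=0$, and let $l$ be the function with $-\nabla_{e_n}e_{2n}=l\,e_n$ modulo $\xi'$. A regular point is umbilic if the operator $-\nabla e_{2n}+\alpha J'$ maps $\xi'$ into itself and, on an orthonormal basis of $\xi'$ consisting of eigenvectors, all its eigenvalues are equal; their common value is denoted by $k$. (Replacing $e_n$ by $-e_n$ changes the signs of both $k$ and $l$.) $\Sigma$ is umbilic if all its regular points are umbilic. **Theorem 1.4.** Suppose that $\Sigma$ is umbilic and $l=2k$ on its regular part. Then $k$ and $l$ are constant on the regular part of each connected component $\Sigma_0$ of $\Sigma$ (so on the whole regular part if $\Sigma$ is connected). That is, there is $\lambda\ge 0$ such that $|k|=\lambda$ and $|l|=2\lambda$ at every regular point of $\Sigma_0$, for every local choice of $e_n$; and $k$ and $l=2k$ are constant for every choice of $e_n$ as a $C^1$ field on the whole regular part of $\Sigma_0$. Moreover, if $\Sigma$ is connected and contains a singular point, then there is a Heisenberg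 (left) translation that maps $\Sigma$ either into a Pansu sphere $S_\lambda$ for some $\lambda>0$, or into a hyperplane $\{t=c\}$ orthogonal to the $t$-axis. Here $S_\lambda$ is the union of the graphs of $f$ and $-f$ with $$f(z)=\frac1{2\lambda^2}\Bigl(\lambda|z|\sqrt{1-\lambda^2|z|^2}+\cos^{-1}(\lambda|z|)\Bigr),\qquad |z|\le\frac1\lambda .$$ -/

import Mathlib

open scoped Manifold ContDiff

noncomputable section

namespace Heisenberg

/-- The plane `ℝ^{2n}` of pairs `z = (x, y)`: the coordinate `Sum.inl j` is `x_j` and the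
coordinate `Sum.inr j` is `y_j`.  It is also used for horizontal vectors, a vector `v` standing for
`∑ v (inl j) e̊_j + ∑ v (inr j) e̊_{n+j}` in the left invariant frame; the frame being orthonormal,
the Levi metric is then the Euclidean inner product. -/
abbrev Plane (n : ℕ) : Type := EuclideanSpace ℝ (Fin n ⊕ Fin n)

/-- The underlying space `ℝ^{2n+1}` of the Heisenberg group, with points `(z, t)`. Its product norm
only serves as a norm of a finite dimensional space (for topology and differentiation). -/
abbrev Heis (n : ℕ) : Type := Plane n × ℝ

variable {n : ℕ}

/-- The Heisenberg product. -/
def mul (p q : Heis n) : Heis n :=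
  (p.1 + q.1, p.2 + q.2 +
    ∑ j : Fin n, (p.1 (Sum.inr j) * q.1 (Sum.inl j) - p.1 (Sum.inl j) * q.1 (Sum.inr j)))

/-- The complex structure: `J e̊_j = e̊_{n+j}`, `J e̊_{n+j} = - e̊_j`. -/
def J : Plane n →ₗ[ℝ] Plane n where
  toFun v := WithLp.toLp 2 (Sum.elim (fun j => - v (Sum.inr j)) (fun j => v (Sum.inl j)))
  map_add' v w := by
    ext i
    rcases i with j | j
    · simp [add_comm]
    · simp
  map_smul' c v := by
    ext i
    rcases i with j | j <;> simp

/-- The contact form `Θ = dt + ∑ (x_j dy_j - y_j dx_j)` at the point `p`. -/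
def contactForm (p : Heis n) : Heis n →ₗ[ℝ] ℝ where
  toFun w := w.2 +
    ∑ j : Fin n, (p.1 (Sum.inl j) * w.1 (Sum.inr j) - p.1 (Sum.inr j) * w.1 (Sum.inl j))
  map_add' v w := by
    simp only [Prod.snd_add, Prod.fst_add, PiLp.add_apply]
    rw [add_add_add_comm, ← Finset.sum_add_distrib]
    congr 1
    exact Finset.sum_congr rfl fun j _ => by ring
  map_smul' c v := by
    simp only [Prod.smul_snd, Prod.smul_fst, PiLp.smul_apply, smul_eq_mul, RingHom.id_apply]
    rw [mul_add, Finset.mul_sum]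
    congr 1
    exact Finset.sum_congr rfl fun j _ => by ring

/-- The contact hyperplane `ξ_p = ker Θ_p`. -/
def contactPlane (p : Heis n) : Submodule ℝ (Heis n) := LinearMap.ker (contactForm p)

/-- The vector `∑ v_j e̊_j + ∑ v_{n+j} e̊_{n+j}` at the point `p`, where
`e̊_j = ∂/∂x_j + y_j ∂/∂t` and `e̊_{n+j} = ∂/∂y_j - x_j ∂/∂t`. -/
def horizontalVector (p : Heis n) : Plane n →ₗ[ℝ] Heis n where
  toFun v := (v,
    ∑ j : Fin n, (p.1 (Sum.inr j) * v (Sum.inl j) - p.1 (Sum.inl j) * v (Sum.inr j)))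
  map_add' v w := by
    refine Prod.ext rfl ?_
    simp only [Prod.snd_add, PiLp.add_apply]
    rw [← Finset.sum_add_distrib]
    exact Finset.sum_congr rfl fun j _ => by ring
  map_smul' c v := by
    refine Prod.ext rfl ?_
    simp only [Prod.smul_snd, PiLp.smul_apply, smul_eq_mul, RingHom.id_apply]
    rw [Finset.mul_sum]
    exact Finset.sum_congr rfl fun j _ => by ring

/-- The Reeb field `T = ∂/∂t`. -/
def reeb : Heis n := (0, 1)

/-- The Pansu sphere `S_lam`: the union of the graphs of `f` and `-f` over `|z| ≤ 1 / lam`. -/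
def pansuSphere (n : ℕ) (lam : ℝ) : Set (Heis n) :=
  {p | ‖p.1‖ ≤ 1 / lam ∧
    (p.2 = 1 / (2 * lam ^ 2) *
        (lam * ‖p.1‖ * Real.sqrt (1 - lam ^ 2 * ‖p.1‖ ^ 2) + Real.arccos (lam * ‖p.1‖)) ∨
     p.2 = -(1 / (2 * lam ^ 2) *
        (lam * ‖p.1‖ * Real.sqrt (1 - lam ^ 2 * ‖p.1‖ ^ 2) + Real.arccos (lam * ‖p.1‖))))}

section Hypersurface

variable {M : Type*} [TopologicalSpace M] [ChartedSpace (EuclideanSpace ℝ (Fin (2 * n))) M]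

/-- The differential of `F : M → H_n` at `p`. -/
def differential (F : M → Heis n) (p : M) : TangentSpace (𝓡 (2 * n)) p →L[ℝ] Heis n :=
  mfderiv (𝓡 (2 * n)) 𝓘(ℝ, Heis n) F p

/-- The tangent hyperplane `TΣ` at `p`, as a subspace of `ℝ^{2n+1}`. -/
def tangentPlane (F : M → Heis n) (p : M) : Submodule ℝ (Heis n) :=
  LinearMap.range (differential F p).toLinearMap

/-- A point is singular if `TΣ = ξ` there. -/
def IsSingular (F : M → Heis n) (p : M) : Prop :=
  tangentPlane F p = contactPlane (F p)

/-- The regular part of the hypersurface. -/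
def regularPart (F : M → Heis n) : Set M := {p | ¬ IsSingular F p}

/-- `F : M → H_n` is an immersed hypersurface of class `C^2` whose regular part is of class
`C^∞`: around each regular point there is a chart of the `C^2` structure of `M` in which `F` is
`C^∞`. -/
structure IsImmersedHypersurface (F : M → Heis n) : Prop where
  contMDiff : ContMDiff (𝓡 (2 * n)) 𝓘(ℝ, Heis n) 2 F
  injective_differential : ∀ p, Function.Injective (differential F p)
  smooth_regularPart : ∀ p ∈ regularPart F,
    ∃ φ ∈ IsManifold.maximalAtlas (𝓡 (2 * n)) 2 M,
      p ∈ φ.source ∧ ContDiffOn ℝ ∞ (F ∘ φ.symm) φ.target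

/-- `ξ ∩ TΣ` at `p`, in components with respect to the left invariant frame. -/
def horizontalTangent (F : M → Heis n) (p : M) : Submodule ℝ (Plane n) :=
  (tangentPlane F p).comap (horizontalVector (F p))

/-- `ξ' = (ξ ∩ TΣ) ∩ J (ξ ∩ TΣ)` at `p`. -/
def xiPrime (F : M → Heis n) (p : M) : Submodule ℝ (Plane n) :=
  horizontalTangent F p ⊓ (horizontalTangent F p).map J

/-- `e` is a choice of the characteristic field `e_n` on the open set `U` of regular points: a `C^1`
field of unit vectors in `(ξ ∩ TΣ) ∩ (ξ')^⊥`.  Such fields exist near every regular point, and on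
a connected `U` they are unique up to sign. -/
structure IsCharacteristicField (F : M → Heis n) (U : Set M) (e : M → Plane n) : Prop where
  isOpen : IsOpen U
  subset_regularPart : U ⊆ regularPart F
  contMDiffOn : ContMDiffOn (𝓡 (2 * n)) 𝓘(ℝ, Plane n) 1 e U
  mem_horizontalTangent : ∀ p ∈ U, e p ∈ horizontalTangent F p
  mem_orthogonal : ∀ p ∈ U, e p ∈ (xiPrime F p)ᗮ
  norm_eq_one : ∀ p ∈ U, ‖e p‖ = 1

/-- The horizontal normal `e_{2n} = J e_n`. -/
def horizontalNormal (e : M → Plane n) (p : M) : Plane n := J (e p)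

/-- The pseudohermitian covariant derivative `∇_v u` at `p` of a horizontal field `u` along the
hypersurface, in the direction `v ∈ ξ ∩ TΣ`.  The left invariant frame is parallel, so it is the
derivative of the components of `u` along the tangent vector of `M` that the differential of `F`
sends to `v` (it is unique for an immersion). -/
def covDeriv (F : M → Heis n) (u : M → Plane n) (p : M) (v : Plane n) : Plane n :=
  mfderiv (𝓡 (2 * n)) 𝓘(ℝ, Plane n) u p
    (Function.invFun (differential F p) (horizontalVector (F p) v))

/-- The function `α`, determined at a regular point by `α e_{2n} + T ∈ TΣ`. -/
def alpha (F : M → Heis n) (e : M → Plane n) (p : M) : ℝ :=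
  Classical.epsilon fun a : ℝ =>
    horizontalVector (F p) (a • horizontalNormal e p) + reeb ∈ tangentPlane F p

/-- `J'` on `ξ ∩ TΣ = ξ' ⊕ ℝ e_n`: it is `J` on `ξ'`, and `J' e_n = 0`. -/
def JPrime (e : M → Plane n) (p : M) (v : Plane n) : Plane n :=
  J (v - inner ℝ (e p) v • e p)

/-- The operator `v ↦ -∇_v e_{2n} + α J' v` on `ξ ∩ TΣ`. -/
def shapeOperator (F : M → Heis n) (e : M → Plane n) (p : M) (v : Plane n) : Plane n :=
  -covDeriv F (horizontalNormal e) p v + alpha F e p • JPrime e p v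

/-- A regular point `p` is umbilic if, for a choice of `e_n` near `p`, the operator
`-∇ e_{2n} + α J'` maps `ξ'` to `ξ'` and all its eigenvalues on an orthonormal eigenbasis of `ξ'`
coincide.  (Replacing `e_n` by `-e_n` replaces the operator by its negative.) -/
def IsUmbilicPoint (F : M → Heis n) (p : M) : Prop :=
  p ∈ regularPart F ∧ ∃ (U : Set M) (e : M → Plane n),
    IsCharacteristicField F U e ∧ p ∈ U ∧
    (∀ v ∈ xiPrime F p, shapeOperator F e p v ∈ xiPrime F p) ∧
    ∃ (b : OrthonormalBasis (Fin (2 * n - 2)) ℝ (xiPrime F p)) (lam : Fin (2 * n - 2) → ℝ),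
      (∀ j, shapeOperator F e p (b j) = lam j • (b j : Plane n)) ∧ ∀ i j, lam i = lam j

/-- All regular points are umbilic. -/
def IsUmbilic (F : M → Heis n) : Prop := ∀ p ∈ regularPart F, IsUmbilicPoint F p

/-- The function `k`: the common eigenvalue of `-∇ e_{2n} + α J'` on `ξ'` at an umbilic point. -/
def kCurv (F : M → Heis n) (e : M → Plane n) (p : M) : ℝ :=
  Classical.epsilon fun k : ℝ => ∀ v ∈ xiPrime F p, shapeOperator F e p v = k • v

/-- The function `l`: `-∇_{e_n} e_{2n} = l e_n` modulo `ξ'`, which is orthogonal to the unit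
vector `e_n`. -/
def lCurv (F : M → Heis n) (e : M → Plane n) (p : M) : ℝ :=
  inner ℝ (-covDeriv F (horizontalNormal e) p (e p)) (e p)

/-- The condition `l = 2k` at all regular points, for every local choice of `e_n`. -/
def LEqTwoK (F : M → Heis n) : Prop :=
  ∀ (U : Set M) (e : M → Plane n), IsCharacteristicField F U e →
    ∀ p ∈ U, lCurv F e p = 2 * kCurv F e p

end Hypersurface

end Heisenberg

end

open scoped Manifold ContDiff

noncomputable section

namespace Heisenberg

/-! ### Parametrized umbilic hypersurfaces: forms, components and basic calculus -/

section LocalModel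

variable {E V : Type*} [NormedAddCommGroup E] [NormedSpace ℝ E]
  [NormedAddCommGroup V] [InnerProductSpace ℝ V]

/-! Write N = e_{2n}, let θ be the contact form pulled back to Σ, ω the component of dz along e_n =
-JN and P the component in ξ', so that dz = P - ω JN + αθ N, while TΣ is the hyperplane ⟨N, dz⟩ =
αθ. Umbilicity and l = 2k prescribe dN on ξ ∩ TΣ. Two integrability conditions determine the rest:
the exterior derivative of ⟨N, dz⟩ = αθ (`first_structure`) and the symmetry of the second
derivative of N (`second_structure`), where dθ = 2⟨J dz, dz⟩. Tested on vectors of ξ', which is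
nonzero because n ≥ 2, they yield the closed system of `structure_equations`: dk = 0, dα = (k² +
α²)(kθ - ω), dN = -kP + αJP + (2kω + (α² - k²)θ) JN. In particular k is locally constant.

The system has explicit first integrals. If k ≠ 0, they are the center C = z + (kN + αJN)/(k² + α²)
and a height (`fderiv_sphereCenter`, `fderiv_sphereHeight`), and fixing both is the equation of a
translated Pansu sphere (`mem_pansuSphere`). If k = 0, the Euclidean conormal (N - αJz, -α) changes
only by a factor (`fderiv_conormal_ratio`), so the tangent hyperplane is locally constant.

To globalize, singular points must be isolated (`eventually_regular_of_isSingular`). Near one of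
them Σ is a graph over the z-plane, and the vector field μ with ⟨μ, dz⟩ = θ is C¹ and vanishes
exactly at the singular points. At regular points N = αμ, and the structure equations give |dz a| ≤
9 |dμ a| whatever k and α are (`norm_fderiv_le`). Regular points are dense because dθ is
nondegenerate, so the bound passes to the singular point; there dμ is injective and the zero of μ is
isolated. Removing a point does not disconnect small balls, so locally constant quantities on the
regular part are constant on each component (`eq_of_locally_constant_off_isolated`).

If |k| = λ > 0, the regular part lies in one translated Pansu sphere, and so does its closure, which
is Σ. If k = 0, all tangent hyperplanes equal the contact plane at the given singular point p₀; Σ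
then lies in a hyperplane, which the translation moving p₀ to the t-axis makes horizontal. -/

/-- An orthogonal complex structure on a real inner product space. -/
structure IsOrthogonalComplexStructure (J : V →L[ℝ] V) : Prop where
  sq : ∀ v, J (J v) = -v
  skew : ∀ u v, inner ℝ (J u) v = -inner ℝ u (J v)

/-- The pullback of the contact form `dt + ⟪J z, dz⟫` by the map `(z, t)`. -/
def pullbackContact (J : V →L[ℝ] V) (z : E → V) (t : E → ℝ) (x a : E) : ℝ :=
  fderiv ℝ t x a + inner ℝ (J (z x)) (fderiv ℝ z x a)

variable (J : V →L[ℝ] V) (z N : E → V) in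
/-- The component of `dz` along the characteristic vector `-J N`. -/
def charComponent (x a : E) : ℝ := -inner ℝ (J (N x)) (fderiv ℝ z x a)

variable (J : V →L[ℝ] V) (z : E → V) (t : E → ℝ) (N : E → V) (α : E → ℝ) in
/-- The component of `dz` in the complex subspace orthogonal to `N`. -/
def complexPart (x a : E) : V :=
  fderiv ℝ z x a + charComponent J z N x a • J (N x) -
    (α x * pullbackContact J z t x a) • N x

/-- A parametrized umbilic hypersurface with `l = 2 k`, with horizontal normal `N`. -/
structure IsUmbilicModel (J : V →L[ℝ] V) (Ω : Set E) (z : E → V) (t : E → ℝ) (N : E → V)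
    (α k : E → ℝ) : Prop where
  isOpen : IsOpen Ω
  contDiffOn_z : ContDiffOn ℝ ∞ z Ω
  contDiffOn_t : ContDiffOn ℝ ∞ t Ω
  contDiffOn_N : ContDiffOn ℝ ∞ N Ω
  norm_eq_one : ∀ x ∈ Ω, ‖N x‖ = 1
  tangent_iff : ∀ x ∈ Ω, ∀ v s,
    (∃ a, fderiv ℝ z x a = v ∧ pullbackContact J z t x a = s) ↔ inner ℝ (N x) v = α x * s
  umbilic : ∀ x ∈ Ω, ∀ a, pullbackContact J z t x a = 0 → inner ℝ (J (N x)) (fderiv ℝ z x a) = 0 →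
    fderiv ℝ N x a = -k x • fderiv ℝ z x a + α x • J (fderiv ℝ z x a)
  l_eq : ∀ x ∈ Ω, ∀ a, pullbackContact J z t x a = 0 → fderiv ℝ z x a = -J (N x) →
    inner ℝ (fderiv ℝ N x a) (J (N x)) = 2 * k x
  exists_ne_zero : ∀ x ∈ Ω, ∃ v : V, v ≠ 0 ∧ inner ℝ (N x) v = 0 ∧ inner ℝ (J (N x)) v = 0

theorem fderiv_clm_comp_apply {V W : Type*} [NormedAddCommGroup V] [NormedSpace ℝ V]
    [NormedAddCommGroup W] [NormedSpace ℝ W] (J : V →L[ℝ] W) {f : E → V} {x : E} (hf : DifferentiableAt ℝ f x) (b : E) :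
    fderiv ℝ (fun y => J (f y)) x b = J (fderiv ℝ f x b) := by
  have := (J.hasFDerivAt.comp x hf.hasFDerivAt).fderiv
  simp only [Function.comp_def] at this
  rw [this]; rfl

theorem fderiv_smul_apply' {c : E → ℝ} {f : E → V} {x : E} (hc : DifferentiableAt ℝ c x)
    (hf : DifferentiableAt ℝ f x) (b : E) :
    fderiv ℝ (fun y => c y • f y) x b = c x • fderiv ℝ f x b + fderiv ℝ c x b • f x := by
  rw [fderiv_fun_smul hc hf]; simp

theorem fderiv_mul_apply' {c f : E → ℝ} {x : E} (hc : DifferentiableAt ℝ c x)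
    (hf : DifferentiableAt ℝ f x) (b : E) :
    fderiv ℝ (fun y => c y * f y) x b = c x * fderiv ℝ f x b + fderiv ℝ c x b * f x := by
  rw [fderiv_fun_mul hc hf]; simp; ring

namespace IsOrthogonalComplexStructure

variable {J : V →L[ℝ] V} (hJ : IsOrthogonalComplexStructure J)
include hJ

theorem inner_self (v : V) : inner ℝ (J v) v = 0 := by
  have := hJ.skew v v
  have h2 := real_inner_comm v (J v)
  linarith

theorem inner_self' (v : V) : inner ℝ v (J v) = 0 := by
  rw [real_inner_comm, hJ.inner_self]

theorem inner_map (u v : V) : inner ℝ (J u) (J v) = inner ℝ u v := by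
  rw [hJ.skew, hJ.sq, inner_neg_right, neg_neg]

end IsOrthogonalComplexStructure

theorem differentiableAt_fderiv_apply {W : Type*} [NormedAddCommGroup W] [NormedSpace ℝ W]
    {f : E → W} {x : E} (hc : ContDiffAt ℝ 2 f x) (a : E) :
    DifferentiableAt ℝ (fun y => fderiv ℝ f y a) x ∧
      ∀ b, fderiv ℝ (fun y => fderiv ℝ f y a) x b = fderiv ℝ (fun y => fderiv ℝ f y b) x a := by
  have hd : DifferentiableAt ℝ (fderiv ℝ f) x :=
    (hc.fderiv_right (m := 1) (by norm_num)).differentiableAt (by simp)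
  have key : ∀ a b, fderiv ℝ (fun y => fderiv ℝ f y a) x b = fderiv ℝ (fderiv ℝ f) x b a := by
    intro a b
    exact fderiv_clm_comp_apply (ContinuousLinearMap.apply ℝ W a) hd b
  refine ⟨?_, fun b => ?_⟩
  · exact (ContinuousLinearMap.apply ℝ W a).differentiableAt.comp x hd
  · rw [key, key]
    exact hc.isSymmSndFDerivAt (by rw [minSmoothness_of_isRCLikeNormedField]) b a

theorem fderiv_pullbackContact {J : V →L[ℝ] V} {z : E → V} {t : E → ℝ} {x : E}
    (hz : ContDiffAt ℝ 2 z x) (ht : ContDiffAt ℝ 2 t x) (a : E) :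
    DifferentiableAt ℝ (fun y => pullbackContact J z t y a) x ∧
    ∀ b, fderiv ℝ (fun y => pullbackContact J z t y a) x b =
      fderiv ℝ (fun y => fderiv ℝ t y a) x b +
      (inner ℝ (J (z x)) (fderiv ℝ (fun y => fderiv ℝ z y a) x b) +
        inner ℝ (J (fderiv ℝ z x b)) (fderiv ℝ z x a)) := by
  have hz1 : DifferentiableAt ℝ z x := hz.differentiableAt (by simp)
  have hz2 := (differentiableAt_fderiv_apply hz a).1
  have ht2 := (differentiableAt_fderiv_apply ht a).1
  have hJz : DifferentiableAt ℝ (fun y => J (z y)) x := J.differentiableAt.comp x hz1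
  have hi : DifferentiableAt ℝ (fun y => inner ℝ (J (z y)) (fderiv ℝ z y a)) x := hJz.inner ℝ hz2
  refine ⟨ht2.add hi, fun b => ?_⟩
  unfold pullbackContact
  rw [fderiv_fun_add ht2 hi, add_apply, fderiv_inner_apply ℝ hJz hz2,
    fderiv_clm_comp_apply J hz1]

/-- In the exterior derivative of θ the second derivatives of z and t cancel, and the two first
order terms add up because J is skew. Only C² regularity is needed, so this is available at singular
points too. -/
theorem pullbackContact_antisymm {J : V →L[ℝ] V} (hJ : IsOrthogonalComplexStructure J)
    {z : E → V} {t : E → ℝ} {x : E}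
    (hz : ContDiffAt ℝ 2 z x) (ht : ContDiffAt ℝ 2 t x) (a b : E) :
    fderiv ℝ (fun y => pullbackContact J z t y a) x b -
      fderiv ℝ (fun y => pullbackContact J z t y b) x a =
    2 * inner ℝ (J (fderiv ℝ z x b)) (fderiv ℝ z x a) := by
  rw [(fderiv_pullbackContact hz ht a).2, (fderiv_pullbackContact hz ht b).2,
    (differentiableAt_fderiv_apply hz a).2 b, (differentiableAt_fderiv_apply ht a).2 b,
    hJ.skew (fderiv ℝ z x a), real_inner_comm (J (fderiv ℝ z x b))]
  ring

/-! ### Integrability conditions and the closed system for N, α, k -/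

namespace IsUmbilicModel

variable {J : V →L[ℝ] V} {Ω : Set E} {z : E → V} {t : E → ℝ} {N : E → V} {α k : E → ℝ}
  (h : IsUmbilicModel J Ω z t N α k) (hJ : IsOrthogonalComplexStructure J)
  {x : E} (hx : x ∈ Ω)

theorem contDiffAt_two_of_contDiffOn {W : Type*} [NormedAddCommGroup W] [NormedSpace ℝ W]
    {f : E → W} (hΩ : IsOpen Ω) (hf : ContDiffOn ℝ ∞ f Ω) (hx : x ∈ Ω) : ContDiffAt ℝ 2 f x :=
  (hf.contDiffAt (hΩ.mem_nhds hx)).of_le ENat.LEInfty.out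

theorem contDiffAt_fderiv_apply {W : Type*} [NormedAddCommGroup W] [NormedSpace ℝ W] {f : E → W}
    (hΩ : IsOpen Ω) (hf : ContDiffOn ℝ ∞ f Ω) (hx : x ∈ Ω) (a : E) :
    DifferentiableAt ℝ (fun y => fderiv ℝ f y a) x ∧
      ∀ b, fderiv ℝ (fun y => fderiv ℝ f y a) x b = fderiv ℝ (fun y => fderiv ℝ f y b) x a :=
  differentiableAt_fderiv_apply (contDiffAt_two_of_contDiffOn hΩ hf hx) a

theorem differentiableAt_of_contDiffOn {W : Type*} [NormedAddCommGroup W] [NormedSpace ℝ W]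
    {f : E → W} (hΩ : IsOpen Ω) (hf : ContDiffOn ℝ ∞ f Ω) (hx : x ∈ Ω) :
    DifferentiableAt ℝ f x :=
  (hf.contDiffAt (hΩ.mem_nhds hx)).differentiableAt (by simp)

include h hx

theorem inner_N_z (a : E) :
    inner ℝ (N x) (fderiv ℝ z x a) = α x * pullbackContact J z t x a :=
  (h.tangent_iff x hx _ _).1 ⟨a, rfl, rfl⟩

theorem inner_N_self : inner ℝ (N x) (N x) = 1 := by
  rw [real_inner_self_eq_norm_sq, h.norm_eq_one x hx]; norm_num

theorem dN (a : E) : inner ℝ (N x) (fderiv ℝ N x a) = 0 := by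
  have hN := differentiableAt_of_contDiffOn h.isOpen h.contDiffOn_N hx
  have h1 : (fun y => inner ℝ (N y) (N y)) =ᶠ[nhds x] fun _ => (1 : ℝ) := by
    filter_upwards [h.isOpen.mem_nhds hx] with y hy using h.inner_N_self hy
  have h2 := congrArg (fun L : E →L[ℝ] ℝ => L a) h1.fderiv_eq
  simp only [fderiv_inner_apply ℝ hN hN] at h2
  rw [real_inner_comm (N x) (fderiv ℝ N x a)] at h2
  simp at h2
  linarith

theorem theta_diff (a : E) : DifferentiableAt ℝ (fun y => pullbackContact J z t y a) x :=
  (fderiv_pullbackContact (contDiffAt_two_of_contDiffOn h.isOpen h.contDiffOn_z hx)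
    (contDiffAt_two_of_contDiffOn h.isOpen h.contDiffOn_t hx) a).1

include hJ

theorem theta_antisymm (a b : E) : fderiv ℝ (fun y => pullbackContact J z t y a) x b -
      fderiv ℝ (fun y => pullbackContact J z t y b) x a =
    2 * inner ℝ (J (fderiv ℝ z x b)) (fderiv ℝ z x a) :=
  pullbackContact_antisymm hJ (contDiffAt_two_of_contDiffOn h.isOpen h.contDiffOn_z hx)
    (contDiffAt_two_of_contDiffOn h.isOpen h.contDiffOn_t hx) a b

omit hJ in
-- Such an a is mapped to the tangent vector αN + T; it exists because `tangent_iff` also says that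
-- the whole hyperplane is attained.
theorem exists_vert : ∃ a, fderiv ℝ z x a = α x • N x ∧ pullbackContact J z t x a = 1 := by
  rw [h.tangent_iff x hx, inner_smul_right, h.inner_N_self hx]

omit hJ in
theorem exists_horiz {v : V} (hv : inner ℝ (N x) v = 0) :
    ∃ a, fderiv ℝ z x a = v ∧ pullbackContact J z t x a = 0 := by
  rw [h.tangent_iff x hx, hv]; simp

theorem exists_char : ∃ a, fderiv ℝ z x a = -J (N x) ∧ pullbackContact J z t x a = 0 :=
  h.exists_horiz hx (by rw [inner_neg_right, hJ.inner_self', neg_zero])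

omit hJ in
-- The function α is given only pointwise; near x it is the quotient ⟨N, dz a⟩ / θ(a) for a fixed a
-- with θ(a) = 1 at x.
theorem alpha_diff : DifferentiableAt ℝ α x := by
  obtain ⟨a, -, ha⟩ := h.exists_vert hx
  have hN := differentiableAt_of_contDiffOn h.isOpen h.contDiffOn_N hx
  have hz2 := (contDiffAt_fderiv_apply h.isOpen h.contDiffOn_z hx a).1
  have hθ := (h.theta_diff hx a)
  have hne : pullbackContact J z t x a ≠ 0 := by rw [ha]; exact one_ne_zero
  have hev := hθ.continuousAt.eventually_ne hne
  have hd : DifferentiableAt ℝ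
      (fun y => inner ℝ (N y) (fderiv ℝ z y a) * (pullbackContact J z t y a)⁻¹) x :=
    (hN.inner ℝ hz2).mul (hθ.inv hne)
  refine hd.congr_of_eventuallyEq ?_
  filter_upwards [hev, h.isOpen.mem_nhds hx] with y hy hyΩ
  rw [h.inner_N_z hyΩ, mul_inv_cancel_right₀ hy]

/-- Exterior derivative of ⟨N, dz⟩ = αθ: the second derivatives of z cancel after
antisymmetrization, and dθ supplies the last term. -/
theorem first_structure (a b : E) :
    inner ℝ (fderiv ℝ N x b) (fderiv ℝ z x a) - inner ℝ (fderiv ℝ N x a) (fderiv ℝ z x b) =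
    fderiv ℝ α x b * pullbackContact J z t x a - fderiv ℝ α x a * pullbackContact J z t x b +
      2 * α x * inner ℝ (J (fderiv ℝ z x b)) (fderiv ℝ z x a) := by
  have hN := differentiableAt_of_contDiffOn h.isOpen h.contDiffOn_N hx
  have key : ∀ a b, inner ℝ (N x) (fderiv ℝ (fun y => fderiv ℝ z y a) x b) +
      inner ℝ (fderiv ℝ N x b) (fderiv ℝ z x a) =
      α x * fderiv ℝ (fun y => pullbackContact J z t y a) x b +
        fderiv ℝ α x b * pullbackContact J z t x a := by
    intro a b
    have h1 : (fun y => inner ℝ (N y) (fderiv ℝ z y a)) =ᶠ[nhds x]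
        fun y => α y * pullbackContact J z t y a := by
      filter_upwards [h.isOpen.mem_nhds hx] with y hy using h.inner_N_z hy a
    have h2 := congrArg (fun L : E →L[ℝ] ℝ => L b) h1.fderiv_eq
    rwa [fderiv_inner_apply ℝ hN (contDiffAt_fderiv_apply h.isOpen h.contDiffOn_z hx a).1,
      fderiv_mul_apply' (h.alpha_diff hx) (h.theta_diff hx a)] at h2
  have k1 := key a b
  have k2 := key b a
  rw [(contDiffAt_fderiv_apply h.isOpen h.contDiffOn_z hx b).2 a] at k2
  have k3 := h.theta_antisymm hJ hx a b
  linear_combination k1 - k2 + α x * k3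

/-- A vector orthogonal to `N`, to `J N` and to their common orthogonal complement is zero. -/
theorem ext_inner {u w : V} (h1 : inner ℝ u (N x) = inner ℝ w (N x))
    (h2 : inner ℝ u (J (N x)) = inner ℝ w (J (N x)))
    (h3 : ∀ v, inner ℝ (N x) v = 0 → inner ℝ (J (N x)) v = 0 → inner ℝ u v = inner ℝ w v) :
    u = w := by
  have hN := h.inner_N_self hx
  have hJN : inner ℝ (J (N x)) (J (N x)) = 1 := by rw [hJ.inner_map, hN]
  rw [← sub_eq_zero, ← inner_self_eq_zero (𝕜 := ℝ)]
  set d := u - w with hd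
  have d1 : inner ℝ d (N x) = 0 := by rw [hd, inner_sub_left, h1, sub_self]
  have d2 : inner ℝ d (J (N x)) = 0 := by rw [hd, inner_sub_left, h2, sub_self]
  have := h3 d (by rw [real_inner_comm, d1]) (by rw [real_inner_comm, d2])
  conv_lhs => rw [hd, inner_sub_left, this, sub_self]

/-- The condition l = 2k gives only the JN component. `first_structure` on e_n and a vector of ξ'
shows that the ξ' component vanishes, and |N| = 1 removes the N component. -/
theorem dN_char {a : E} (ha : fderiv ℝ z x a = -J (N x)) (hθ : pullbackContact J z t x a = 0) :
    fderiv ℝ N x a = (2 * k x) • J (N x) := by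
  have hN := h.inner_N_self hx
  refine h.ext_inner hJ hx ?_ ?_ ?_
  · rw [real_inner_comm, h.dN hx, inner_smul_left, hJ.inner_self, mul_zero]
  · rw [h.l_eq x hx a hθ ha, inner_smul_left, hJ.inner_map, hN]; simp
  · intro v hv1 hv2
    obtain ⟨b, hb, hbθ⟩ := h.exists_horiz hx hv1
    have := h.first_structure hJ hx a b
    have h4 : inner ℝ v (J (N x)) = 0 := by rw [real_inner_comm, hv2]
    have h5 : inner ℝ v (N x) = 0 := by rw [real_inner_comm, hv1]
    rw [h.umbilic x hx b hbθ (by rw [hb, hv2]), hθ, hbθ, hb, ha] at this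
    simp only [inner_add_left, inner_smul_left, inner_neg_right, hJ.inner_map, h4, h5] at this
    simpa [inner_smul_left, hv2] using this


theorem inner_complexPart_JN (a : E) : inner ℝ (J (N x)) (complexPart J z t N α x a) = 0 := by
  unfold complexPart charComponent
  rw [inner_sub_right, inner_add_right, inner_smul_right, inner_smul_right, hJ.inner_self,
    hJ.inner_map, h.inner_N_self hx]
  ring

/-- The direction a is split into parts in ξ', along e_n and along αN + T. The derivative of N along
the first two is known; along the last it is still an unknown at this stage. -/
theorem dN_eq {w : E} (hw : fderiv ℝ z x w = α x • N x) (hwθ : pullbackContact J z t x w = 1)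
    (a : E) :
    fderiv ℝ N x a = -k x • complexPart J z t N α x a + α x • J (complexPart J z t N α x a) +
      (2 * k x * charComponent J z N x a) • J (N x) +
      pullbackContact J z t x a • fderiv ℝ N x w := by
  obtain ⟨c, hc, hcθ⟩ := h.exists_char hJ hx
  set b := a - charComponent J z N x a • c - pullbackContact J z t x a • w with hb
  have hlin : ∀ u v : E, ∀ r : ℝ, pullbackContact J z t x (u - r • v) =
      pullbackContact J z t x u - r * pullbackContact J z t x v := by
    intro u v r
    unfold pullbackContact
    simp only [map_sub, map_smul, inner_sub_right, inner_smul_right, smul_eq_mul]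
    ring
  have hbz : fderiv ℝ z x b = complexPart J z t N α x a := by
    rw [hb, map_sub, map_sub, map_smul, map_smul, hc, hw]
    unfold complexPart
    module
  have hbθ : pullbackContact J z t x b = 0 := by
    rw [hb, hlin, hlin, hcθ, hwθ]; ring
  have h1 := h.umbilic x hx b hbθ (by rw [hbz, h.inner_complexPart_JN hJ hx])
  have h2 : fderiv ℝ N x b = fderiv ℝ N x a - charComponent J z N x a • (2 * k x) • J (N x) -
      pullbackContact J z t x a • fderiv ℝ N x w := by
    rw [hb, map_sub, map_sub, map_smul, map_smul, h.dN_char hJ hx hc hcθ]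
  rw [hbz, h2] at h1
  rw [← sub_eq_iff_eq_add, eq_comm, ← sub_eq_zero]
  rw [← sub_eq_zero] at h1
  rw [← neg_eq_zero, ← h1]
  module

omit hJ in
theorem differentiableAt_charComponent (a : E) :
    DifferentiableAt ℝ (fun y => charComponent J z N y a) x :=
  ((J.differentiableAt.comp x (differentiableAt_of_contDiffOn h.isOpen h.contDiffOn_N hx)).inner ℝ
    (contDiffAt_fderiv_apply h.isOpen h.contDiffOn_z hx a).1).neg

omit hJ in
theorem differentiableAt_complexPart (a : E) :
    DifferentiableAt ℝ (fun y => complexPart J z t N α y a) x := by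
  have hN := differentiableAt_of_contDiffOn h.isOpen h.contDiffOn_N hx
  exact (((contDiffAt_fderiv_apply h.isOpen h.contDiffOn_z hx a).1.add
    ((h.differentiableAt_charComponent hx a).smul (J.differentiableAt.comp x hN))).sub
    (((h.alpha_diff hx).mul (h.theta_diff hx a)).smul hN))

/-- Like α, k is given only pointwise. In the combinations `Y` of P and `U` of dN the θ-parts cancel
at every nearby point, so the unknown dN(αN + T) drops out; since JY and JN are orthogonal to Y, k =
-⟨U, Y⟩ / ⟨Y, Y⟩. -/
theorem k_diff : DifferentiableAt ℝ k x := by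
  obtain ⟨v, hv0, hv1, hv2⟩ := h.exists_ne_zero x hx
  obtain ⟨a, ha, haθ⟩ := h.exists_horiz hx hv1
  obtain ⟨b, hb, hbθ⟩ := h.exists_vert hx
  set Y : E → V := fun y => pullbackContact J z t y b • complexPart J z t N α y a -
    pullbackContact J z t y a • complexPart J z t N α y b with hY
  set U : E → V := fun y => pullbackContact J z t y b • fderiv ℝ N y a -
    pullbackContact J z t y a • fderiv ℝ N y b with hU
  have hYd : DifferentiableAt ℝ Y x :=
    ((h.theta_diff hx b).smul (h.differentiableAt_complexPart hx a)).sub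
      ((h.theta_diff hx a).smul (h.differentiableAt_complexPart hx b))
  have hUd : DifferentiableAt ℝ U x :=
    ((h.theta_diff hx b).smul (contDiffAt_fderiv_apply h.isOpen h.contDiffOn_N hx a).1).sub
      ((h.theta_diff hx a).smul (contDiffAt_fderiv_apply h.isOpen h.contDiffOn_N hx b).1)
  have hYx : inner ℝ (Y x) (Y x) ≠ 0 := by
    have : Y x = v := by
      simp [hY, hbθ, haθ, complexPart, charComponent, ha, hv2]
    rw [this]
    exact inner_self_ne_zero.2 hv0
  have hYY : DifferentiableAt ℝ (fun y => inner ℝ (Y y) (Y y)) x := hYd.inner ℝ hYd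
  have hd : DifferentiableAt ℝ (fun y => -(inner ℝ (U y) (Y y) * (inner ℝ (Y y) (Y y))⁻¹)) x :=
    ((hUd.inner ℝ hYd).mul (hYY.inv hYx)).neg
  refine hd.congr_of_eventuallyEq ?_
  filter_upwards [hYY.continuousAt.eventually_ne hYx, h.isOpen.mem_nhds hx] with y hy hyΩ
  obtain ⟨w, hw, hwθ⟩ := h.exists_vert hyΩ
  have hUy : U y = -k y • Y y + α y • J (Y y) + (2 * k y * (pullbackContact J z t y b *
      charComponent J z N y a - pullbackContact J z t y a * charComponent J z N y b)) • J (N y) := by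
    simp only [hU, hY]
    rw [h.dN_eq hJ hyΩ hw hwθ a, h.dN_eq hJ hyΩ hw hwθ b]
    simp only [map_sub, map_smul]
    module
  have hJNY : inner ℝ (J (N y)) (Y y) = 0 := by
    simp only [hY, inner_sub_right, inner_smul_right, h.inner_complexPart_JN hJ hyΩ]; ring
  have : inner ℝ (U y) (Y y) = -k y * inner ℝ (Y y) (Y y) := by
    rw [hUy, inner_add_left, inner_add_left, inner_smul_left, inner_smul_left, inner_smul_left,
      hJ.inner_self, hJNY]
    simp
  rw [this, mul_assoc, mul_inv_cancel₀ hy]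
  ring

/-- The vectors `w` are chosen point by point without continuity. Solving `dN_eq` for its last term,
with a fixed direction where θ ≠ 0, shows that the resulting X is differentiable all the same. -/
theorem exists_dN_vert : ∃ X : E → V, (∀ y ∈ Ω, ∀ a,
      fderiv ℝ N y a = -k y • complexPart J z t N α y a + α y • J (complexPart J z t N α y a) +
      (2 * k y * charComponent J z N y a) • J (N y) + pullbackContact J z t y a • X y) ∧
    (∀ y ∈ Ω, ∀ w, fderiv ℝ z y w = α y • N y → pullbackContact J z t y w = 1 →
      fderiv ℝ N y w = X y) ∧ DifferentiableAt ℝ X x := by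
  have hex : ∀ y, ∃ w, y ∈ Ω → fderiv ℝ z y w = α y • N y ∧ pullbackContact J z t y w = 1 := by
    intro y
    by_cases hy : y ∈ Ω
    · obtain ⟨w, hw⟩ := h.exists_vert hy
      exact ⟨w, fun _ => hw⟩
    · exact ⟨0, fun h' => absurd h' hy⟩
  choose w hw using hex
  have hX : ∀ y ∈ Ω, ∀ a,
      fderiv ℝ N y a = -k y • complexPart J z t N α y a + α y • J (complexPart J z t N α y a) +
      (2 * k y * charComponent J z N y a) • J (N y) +
        pullbackContact J z t y a • fderiv ℝ N y (w y) :=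
    fun y hy a => h.dN_eq hJ hy (hw y hy).1 (hw y hy).2 a
  refine ⟨fun y => fderiv ℝ N y (w y), hX, ?_, ?_⟩
  · intro y hy u hu hu1
    rw [h.dN_eq hJ hy (hw y hy).1 (hw y hy).2 u]
    have h1 : charComponent J z N y u = 0 := by
      unfold charComponent
      rw [hu, inner_smul_right, hJ.inner_self]; simp
    have h2 : complexPart J z t N α y u = 0 := by
      unfold complexPart
      rw [h1, hu1, hu]; simp
    rw [h1, h2, hu1]; simp
  · obtain ⟨a, -, ha⟩ := h.exists_vert hx
    have hne : pullbackContact J z t x a ≠ 0 := by rw [ha]; exact one_ne_zero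
    have hθ := (h.theta_diff hx a)
    have hN := differentiableAt_of_contDiffOn h.isOpen h.contDiffOn_N hx
    have hP := h.differentiableAt_complexPart hx a
    have hd : DifferentiableAt ℝ (fun y => (pullbackContact J z t y a)⁻¹ • (fderiv ℝ N y a -
        (-k y • complexPart J z t N α y a + α y • J (complexPart J z t N α y a) +
        (2 * k y * charComponent J z N y a) • J (N y)))) x :=
      (hθ.inv hne).smul ((contDiffAt_fderiv_apply h.isOpen h.contDiffOn_N hx a).1.sub
        ((((h.k_diff hJ hx).neg.smul hP).add
          ((h.alpha_diff hx).smul (J.differentiableAt.comp x hP))).add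
          ((((h.k_diff hJ hx).const_mul 2).mul (h.differentiableAt_charComponent hx a)).smul
            (J.differentiableAt.comp x hN))))
    refine hd.congr_of_eventuallyEq ?_
    filter_upwards [hθ.continuousAt.eventually_ne hne, h.isOpen.mem_nhds hx] with y hy hyΩ
    have h1 : fderiv ℝ N y a - (-k y • complexPart J z t N α y a +
        α y • J (complexPart J z t N α y a) + (2 * k y * charComponent J z N y a) • J (N y)) =
        pullbackContact J z t y a • fderiv ℝ N y (w y) := by
      rw [hX y hyΩ a]; abel
    rw [h1, smul_smul, inv_mul_cancel₀ hy, one_smul]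

omit hJ in
theorem fderiv_charComponent (a b : E) : fderiv ℝ (fun y => charComponent J z N y a) x b =
    -(inner ℝ (J (N x)) (fderiv ℝ (fun y => fderiv ℝ z y a) x b) +
      inner ℝ (J (fderiv ℝ N x b)) (fderiv ℝ z x a)) := by
  have hN := differentiableAt_of_contDiffOn h.isOpen h.contDiffOn_N hx
  have hJN : DifferentiableAt ℝ (fun y => J (N y)) x := J.differentiableAt.comp x hN
  have hz2 := (contDiffAt_fderiv_apply h.isOpen h.contDiffOn_z hx a).1
  unfold charComponent
  rw [fderiv_fun_neg, neg_apply, fderiv_inner_apply ℝ hJN hz2,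
    fderiv_clm_comp_apply J hN]

omit hJ in
theorem fderiv_complexPart (a b : E) : fderiv ℝ (fun y => complexPart J z t N α y a) x b =
    fderiv ℝ (fun y => fderiv ℝ z y a) x b +
    (charComponent J z N x a • J (fderiv ℝ N x b) +
      fderiv ℝ (fun y => charComponent J z N y a) x b • J (N x)) -
    ((α x * pullbackContact J z t x a) • fderiv ℝ N x b +
      (α x * fderiv ℝ (fun y => pullbackContact J z t y a) x b +
        fderiv ℝ α x b * pullbackContact J z t x a) • N x) := by
  have hN := differentiableAt_of_contDiffOn h.isOpen h.contDiffOn_N hx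
  have hJN : DifferentiableAt ℝ (fun y => J (N y)) x := J.differentiableAt.comp x hN
  have hz2 := (contDiffAt_fderiv_apply h.isOpen h.contDiffOn_z hx a).1
  have hc := h.differentiableAt_charComponent hx a
  have hα := h.alpha_diff hx
  have hθ := (h.theta_diff hx a)
  have h1 : DifferentiableAt ℝ (fun y => charComponent J z N y a • J (N y)) x := hc.smul hJN
  have h2 : DifferentiableAt ℝ (fun y => α y * pullbackContact J z t y a) x := hα.mul hθ
  have h3 : DifferentiableAt ℝ (fun y => (α y * pullbackContact J z t y a) • N y) x := h2.smul hN
  have h4 : DifferentiableAt ℝ (fun y => fderiv ℝ z y a + charComponent J z N y a • J (N y)) x :=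
    hz2.add h1
  unfold complexPart
  rw [fderiv_fun_sub h4 h3, sub_apply,
    fderiv_fun_add hz2 h1, add_apply, fderiv_smul_apply' hc hJN,
    fderiv_smul_apply' h2 hN, fderiv_mul_apply' hα hθ, fderiv_clm_comp_apply J hN]


theorem fderiv_fderiv_N {X : E → V} (hX : ∀ y ∈ Ω, ∀ a,
      fderiv ℝ N y a = -k y • complexPart J z t N α y a + α y • J (complexPart J z t N α y a) +
      (2 * k y * charComponent J z N y a) • J (N y) + pullbackContact J z t y a • X y)
    (hXd : DifferentiableAt ℝ X x) (a b : E) :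
    fderiv ℝ (fun y => fderiv ℝ N y a) x b =
      (-k x • fderiv ℝ (fun y => complexPart J z t N α y a) x b -
        fderiv ℝ k x b • complexPart J z t N α x a) +
      (α x • J (fderiv ℝ (fun y => complexPart J z t N α y a) x b) +
        fderiv ℝ α x b • J (complexPart J z t N α x a)) +
      ((2 * k x * charComponent J z N x a) • J (fderiv ℝ N x b) +
        (2 * k x * fderiv ℝ (fun y => charComponent J z N y a) x b +
          2 * fderiv ℝ k x b * charComponent J z N x a) • J (N x)) +
      (pullbackContact J z t x a • fderiv ℝ X x b +
        fderiv ℝ (fun y => pullbackContact J z t y a) x b • X x) := by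
  have hN := differentiableAt_of_contDiffOn h.isOpen h.contDiffOn_N hx
  have hJN : DifferentiableAt ℝ (fun y => J (N y)) x := J.differentiableAt.comp x hN
  have hc := h.differentiableAt_charComponent hx a
  have hP := h.differentiableAt_complexPart hx a
  have hJP : DifferentiableAt ℝ (fun y => J (complexPart J z t N α y a)) x :=
    J.differentiableAt.comp x hP
  have hα := h.alpha_diff hx
  have hk := h.k_diff hJ hx
  have hk' : DifferentiableAt ℝ (fun y => -k y) x := hk.neg
  have hk2 : DifferentiableAt ℝ (fun y => 2 * k y) x := hk.const_mul 2
  have hθ := (h.theta_diff hx a)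
  have h1 : DifferentiableAt ℝ (fun y => -k y • complexPart J z t N α y a) x := hk'.smul hP
  have h2 : DifferentiableAt ℝ (fun y => α y • J (complexPart J z t N α y a)) x := hα.smul hJP
  have h3 : DifferentiableAt ℝ (fun y => 2 * k y * charComponent J z N y a) x := hk2.mul hc
  have h4 : DifferentiableAt ℝ (fun y => (2 * k y * charComponent J z N y a) • J (N y)) x :=
    h3.smul hJN
  have h5 : DifferentiableAt ℝ (fun y => pullbackContact J z t y a • X y) x := hθ.smul hXd
  have hev : (fun y => fderiv ℝ N y a) =ᶠ[nhds x] fun y =>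
      -k y • complexPart J z t N α y a + α y • J (complexPart J z t N α y a) +
      (2 * k y * charComponent J z N y a) • J (N y) + pullbackContact J z t y a • X y := by
    filter_upwards [h.isOpen.mem_nhds hx] with y hy using hX y hy a
  have h12 : DifferentiableAt ℝ (fun y => -k y • complexPart J z t N α y a +
    α y • J (complexPart J z t N α y a)) x := h1.add h2
  have h124 : DifferentiableAt ℝ (fun y => -k y • complexPart J z t N α y a +
    α y • J (complexPart J z t N α y a) + (2 * k y * charComponent J z N y a) • J (N y)) x :=
    h12.add h4
  rw [hev.fderiv_eq, fderiv_fun_add h124 h5, add_apply, fderiv_fun_add h12 h4, add_apply,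
    fderiv_fun_add h1 h2, add_apply, fderiv_smul_apply' hk' hP, fderiv_smul_apply' hα hJP,
    fderiv_smul_apply' h3 hJN, fderiv_smul_apply' hθ hXd, fderiv_mul_apply' hk2 hc,
    fderiv_clm_comp_apply J hP, fderiv_clm_comp_apply J hN, fderiv_fun_neg, neg_apply,
    fderiv_const_mul hk, smul_apply, smul_eq_mul]
  module

/-- The symmetry of the second derivative of N, applied to the formula `hX`. The parameters `θd`,
`ωd`, `Pd` are the exterior derivatives of θ, ω, P on the pair; each application inserts its own
computed values. -/
theorem second_structure {X : E → V} (hX : ∀ y ∈ Ω, ∀ a,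
      fderiv ℝ N y a = -k y • complexPart J z t N α y a + α y • J (complexPart J z t N α y a) +
      (2 * k y * charComponent J z N y a) • J (N y) + pullbackContact J z t y a • X y)
    (hXd : DifferentiableAt ℝ X x) (a b : E) {θa θb ωa ωb θd ωd : ℝ} {Pa Pb Pd : V}
    (hθa : pullbackContact J z t x a = θa) (hθb : pullbackContact J z t x b = θb)
    (hωa : charComponent J z N x a = ωa) (hωb : charComponent J z N x b = ωb)
    (hPa : complexPart J z t N α x a = Pa) (hPb : complexPart J z t N α x b = Pb)
    (hθd : 2 * inner ℝ (J (fderiv ℝ z x b)) (fderiv ℝ z x a) = θd)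
    (hωd : -inner ℝ (J (fderiv ℝ N x b)) (fderiv ℝ z x a) +
      inner ℝ (J (fderiv ℝ N x a)) (fderiv ℝ z x b) = ωd)
    (hPd : ωd • J (N x) + ωa • J (fderiv ℝ N x b) - ωb • J (fderiv ℝ N x a) -
      (fderiv ℝ α x b * θa - fderiv ℝ α x a * θb + α x * θd) • N x -
      α x • (θa • fderiv ℝ N x b - θb • fderiv ℝ N x a) = Pd) :
    -k x • Pd + α x • J Pd - fderiv ℝ k x b • Pa + fderiv ℝ k x a • Pb +
      fderiv ℝ α x b • J Pa - fderiv ℝ α x a • J Pb +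
      (2 * (fderiv ℝ k x b * ωa - fderiv ℝ k x a * ωb) + 2 * k x * ωd) • J (N x) +
      (2 * k x) • (ωa • J (fderiv ℝ N x b) - ωb • J (fderiv ℝ N x a)) +
      θd • X x + θa • fderiv ℝ X x b - θb • fderiv ℝ X x a = 0 := by
  have e1 := h.fderiv_fderiv_N hJ hx hX hXd a b
  have e2 := h.fderiv_fderiv_N hJ hx hX hXd b a
  rw [(contDiffAt_fderiv_apply h.isOpen h.contDiffOn_N hx a).2 b, e2, ← sub_eq_zero] at e1
  have hθ := h.theta_antisymm hJ hx a b
  rw [hθd, sub_eq_iff_eq_add] at hθ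
  have hω : fderiv ℝ (fun y => charComponent J z N y a) x b =
      ωd + fderiv ℝ (fun y => charComponent J z N y b) x a := by
    rw [h.fderiv_charComponent hx a b, h.fderiv_charComponent hx b a, ← hωd,
      (contDiffAt_fderiv_apply h.isOpen h.contDiffOn_z hx a).2 b]
    ring
  have hP : fderiv ℝ (fun y => complexPart J z t N α y a) x b =
      Pd + fderiv ℝ (fun y => complexPart J z t N α y b) x a := by
    rw [h.fderiv_complexPart hx a b, h.fderiv_complexPart hx b a, ← hPd,
      (contDiffAt_fderiv_apply h.isOpen h.contDiffOn_z hx a).2 b, hθ, hω, hθa, hθb, hωa, hωb]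
    module
  rw [hP, hω, hθ, hPa, hPb, hθa, hθb, hωa, hωb, map_add] at e1
  rw [← neg_eq_zero, ← e1]
  module


omit hJ h hx in
theorem complexPart_of_inner_eq_zero {b : E} (hbθ : pullbackContact J z t x b = 0)
    (hb : inner ℝ (J (N x)) (fderiv ℝ z x b) = 0) :
    charComponent J z N x b = 0 ∧ complexPart J z t N α x b = fderiv ℝ z x b := by
  have h1 : charComponent J z N x b = 0 := by unfold charComponent; rw [hb, neg_zero]
  refine ⟨h1, ?_⟩
  unfold complexPart
  rw [h1, hbθ]; simp

theorem complexPart_of_char {a : E} (haθ : pullbackContact J z t x a = 0)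
    (ha : fderiv ℝ z x a = -J (N x)) :
    charComponent J z N x a = 1 ∧ complexPart J z t N α x a = 0 := by
  have h1 : charComponent J z N x a = 1 := by
    unfold charComponent
    rw [ha, inner_neg_right, hJ.inner_map, h.inner_N_self hx, neg_neg]
  refine ⟨h1, ?_⟩
  unfold complexPart
  rw [h1, haθ, ha]; simp

omit h hx in
theorem complexPart_of_vert {a : E} (haθ : pullbackContact J z t x a = 1)
    (ha : fderiv ℝ z x a = α x • N x) :
    charComponent J z N x a = 0 ∧ complexPart J z t N α x a = 0 := by
  have h1 : charComponent J z N x a = 0 := by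
    unfold charComponent
    rw [ha, inner_smul_right, hJ.inner_self]; simp
  refine ⟨h1, ?_⟩
  unfold complexPart
  rw [h1, haθ, ha]; simp

/-- `second_structure` on e_n and v ∈ ξ'. There dθ and dω vanish, so X does not appear, and the
equation splits along the orthogonal vectors JN, v, Jv with one unknown derivative on each. -/
theorem deriv_char {a b : E} (haθ : pullbackContact J z t x a = 0)
    (ha : fderiv ℝ z x a = -J (N x)) (hbθ : pullbackContact J z t x b = 0)
    (hb : inner ℝ (J (N x)) (fderiv ℝ z x b) = 0) (hb0 : fderiv ℝ z x b ≠ 0) :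
    fderiv ℝ k x b = 0 ∧ fderiv ℝ k x a = 0 ∧ fderiv ℝ α x a = -(k x ^ 2 + α x ^ 2) := by
  obtain ⟨X, hX, -, hXd⟩ := h.exists_dN_vert hJ hx
  have hbN : inner ℝ (N x) (fderiv ℝ z x b) = 0 := by rw [h.inner_N_z hx, hbθ, mul_zero]
  obtain ⟨hωa, hPa⟩ := h.complexPart_of_char hJ hx haθ ha
  obtain ⟨hωb, hPb⟩ := complexPart_of_inner_eq_zero (α := α) (N := N) hbθ hb
  have hNb := h.umbilic x hx b hbθ hb
  have hNa := h.dN_char hJ hx ha haθ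
  set v := fderiv ℝ z x b with hv
  have hvN : inner ℝ v (N x) = 0 := by rw [real_inner_comm, hbN]
  have hvJ : inner ℝ v (J (N x)) = 0 := by rw [real_inner_comm, hb]
  have hJvN : inner ℝ (J v) (N x) = 0 := by rw [hJ.skew, hvJ, neg_zero]
  have hJvJ : inner ℝ (J v) (J (N x)) = 0 := by rw [hJ.inner_map, hvN]
  have hNN := h.inner_N_self hx
  have key := h.second_structure hJ hx hX hXd a b haθ hbθ hωa hωb hPa hPb (θd := 0) (ωd := 0)
    (Pd := J (fderiv ℝ N x b))
    (by rw [ha, inner_neg_right, ← hv, hJvJ]; simp)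
    (by rw [ha, hNb, hNa, ← hv]
        simp only [map_add, map_smul, hJ.sq, inner_add_left, inner_smul_left, inner_neg_left,
          inner_neg_right, hJvJ, hvJ, hbN]
        simp)
    (by simp)
  have key2 : (2 * fderiv ℝ k x b) • J (N x) + fderiv ℝ k x a • v -
      (fderiv ℝ α x a + (k x ^ 2 + α x ^ 2)) • J v = 0 := by
    rw [← key, hNb]
    simp only [map_add, map_smul, hJ.sq, map_neg, map_zero]
    module
  have e1 := congrArg (fun u => inner ℝ u (J (N x))) key2
  have e2 := congrArg (fun u => inner ℝ u v) key2
  have e3 := congrArg (fun u => inner ℝ u (J v)) key2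
  simp only [inner_sub_left, inner_add_left, inner_smul_left, inner_zero_left, hJ.inner_map, hNN,
    hJ.inner_self, hJ.inner_self', hb, hvJ, hvN, hbN] at e1 e2 e3
  have hvv : inner ℝ v v ≠ 0 := inner_self_ne_zero.2 hb0
  simp at e1 e2 e3
  refine ⟨e1, e2.resolve_right hb0, ?_⟩
  linarith [e3.resolve_right hb0]

theorem deriv_alpha_vert {X : V} {a b : E} (haθ : pullbackContact J z t x a = 1)
    (ha : fderiv ℝ z x a = α x • N x) (hXa : fderiv ℝ N x a = X)
    (hbθ : pullbackContact J z t x b = 0)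
    (hb : inner ℝ (J (N x)) (fderiv ℝ z x b) = 0) :
    inner ℝ X (fderiv ℝ z x b) = -fderiv ℝ α x b := by
  have hbN : inner ℝ (N x) (fderiv ℝ z x b) = 0 := by rw [h.inner_N_z hx, hbθ, mul_zero]
  have := h.first_structure hJ hx a b
  rw [haθ, hbθ, ha, hXa, h.umbilic x hx b hbθ hb] at this
  have hvN : inner ℝ (fderiv ℝ z x b) (N x) = 0 := by rw [real_inner_comm, hbN]
  have hvJ : inner ℝ (fderiv ℝ z x b) (J (N x)) = 0 := by rw [real_inner_comm, hb]
  simp only [inner_smul_right, inner_add_left, inner_smul_left, hJ.skew (fderiv ℝ z x b),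
    hvN, hvJ, map_smul] at this
  simp at this
  linarith

/-- On the pair v, Jv in ξ' one has dθ = 2|v|², so X enters `second_structure`. By
`deriv_alpha_vert` its v-component is again -dα(b), and the v-component of the whole equation
becomes -3 dα(b)|v|² = 0. -/
theorem deriv_horiz {b : E} (hbθ : pullbackContact J z t x b = 0)
    (hb : inner ℝ (J (N x)) (fderiv ℝ z x b) = 0) :
    fderiv ℝ k x b = 0 ∧ fderiv ℝ α x b = 0 := by
  obtain ⟨X, hX, hXw, hXd⟩ := h.exists_dN_vert hJ hx
  have hbN : inner ℝ (N x) (fderiv ℝ z x b) = 0 := by rw [h.inner_N_z hx, hbθ, mul_zero]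
  obtain ⟨w, hw, hwθ⟩ := h.exists_vert hx
  -- The model does not require an injective differential, so dz b = 0 is treated separately:
  -- `deriv_char` applies to both c and b + c, and the difference gives dk(b) = 0.
  by_cases hb0 : fderiv ℝ z x b = 0
  · have hNb := h.umbilic x hx b hbθ hb
    have h1 := h.deriv_alpha_vert hJ hx hwθ hw (hXw x hx w hw hwθ) hbθ hb
    rw [hb0, inner_zero_right] at h1
    obtain ⟨a, ha, haθ⟩ := h.exists_char hJ hx
    obtain ⟨v, hv0, hv1, hv2⟩ := h.exists_ne_zero x hx
    obtain ⟨c, hc, hcθ⟩ := h.exists_horiz hx hv1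
    have h2 := (h.deriv_char hJ hx haθ ha hcθ (by rw [hc, hv2]) (by rw [hc]; exact hv0)).1
    have h3 := (h.deriv_char hJ hx (b := b + c) haθ ha
      (by unfold pullbackContact at *
          rw [map_add, map_add, inner_add_right]
          linarith)
      (by rw [map_add, inner_add_right, hb, hc, hv2, add_zero])
      (by rw [map_add, hb0, hc, zero_add]; exact hv0)).1
    rw [map_add, h2, add_zero] at h3
    exact ⟨h3, by linarith⟩
  obtain ⟨a₀, ha₀, ha₀θ⟩ := h.exists_char hJ hx
  have hkb := (h.deriv_char hJ hx ha₀θ ha₀ hbθ hb hb0).1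
  refine ⟨hkb, ?_⟩
  obtain ⟨a, ha, haθ⟩ := h.exists_horiz hx (v := J (fderiv ℝ z x b))
    (by rw [← neg_eq_zero, ← hJ.skew, hb])
  have haJ : inner ℝ (J (N x)) (fderiv ℝ z x a) = 0 := by rw [ha, hJ.inner_map, hbN]
  have hka := (h.deriv_char hJ hx ha₀θ ha₀ haθ haJ (by
    rw [ha]; intro h0; apply hb0; rw [← neg_eq_zero, ← hJ.sq, h0, map_zero])).1
  obtain ⟨hωa, hPa⟩ := complexPart_of_inner_eq_zero (α := α) (N := N) haθ haJ
  obtain ⟨hωb, hPb⟩ := complexPart_of_inner_eq_zero (α := α) (N := N) hbθ hb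
  have h1 := h.deriv_alpha_vert hJ hx hwθ hw (hXw x hx w hw hwθ) hbθ hb
  rw [ha] at hPa
  set v := fderiv ℝ z x b with hv
  have key := h.second_structure hJ hx hX hXd a b haθ hbθ hωa hωb hPa hPb rfl rfl rfl
  have e2 := congrArg (fun u => inner ℝ u v) key
  have hJN : inner ℝ (J (N x)) v = 0 := hb
  simp only [hkb, hka, ha, ← hv, zero_smul, smul_zero, mul_zero, add_zero, sub_zero,
    map_sub, map_add, map_smul, hJ.sq, inner_sub_left, inner_add_left, inner_smul_left,
    inner_neg_left, inner_zero_left, hb, hbN, hJ.inner_self, hJ.inner_map, h1] at e2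
  have hvv : inner ℝ v v ≠ 0 := inner_self_ne_zero.2 hb0
  simp at e2
  rcases mul_eq_zero.1 (show fderiv ℝ α x b * inner ℝ v v = 0 by
    rw [← real_inner_self_eq_norm_sq] at e2; linarith) with h' | h'
  · exact h'
  · exact absurd h' hvv

/-- The JN component follows from `first_structure` on e_n and αN + T, where e_n α is already known;
the ξ' component is -dα on ξ', which vanishes by `deriv_horiz`. -/
theorem dN_vert {a : E} (haθ : pullbackContact J z t x a = 1)
    (ha : fderiv ℝ z x a = α x • N x) :
    fderiv ℝ N x a = (α x ^ 2 - k x ^ 2) • J (N x) := by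
  have hNN := h.inner_N_self hx
  refine h.ext_inner hJ hx ?_ ?_ ?_
  · rw [real_inner_comm, h.dN hx, inner_smul_left, hJ.inner_self, mul_zero]
  · obtain ⟨c, hc, hcθ⟩ := h.exists_char hJ hx
    obtain ⟨v, hv0, hv1, hv2⟩ := h.exists_ne_zero x hx
    obtain ⟨b, hb, hbθ⟩ := h.exists_horiz hx hv1
    have hα := (h.deriv_char hJ hx hcθ hc hbθ (by rw [hb, hv2]) (by rw [hb]; exact hv0)).2.2
    have := h.first_structure hJ hx a c
    rw [haθ, hcθ, ha, hc, h.dN_char hJ hx hc hcθ, hα] at this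
    simp only [inner_smul_right, inner_smul_left, inner_neg_right, hJ.inner_self, map_neg, hJ.sq,
      neg_neg, hNN] at this
    rw [inner_smul_left, hJ.inner_map, hNN]
    simp at this ⊢
    linarith
  · intro v hv1 hv2
    obtain ⟨b, hb, hbθ⟩ := h.exists_horiz hx hv1
    have hb' : inner ℝ (J (N x)) (fderiv ℝ z x b) = 0 := by rw [hb, hv2]
    have h1 := h.deriv_alpha_vert hJ hx haθ ha rfl hbθ hb'
    rw [hb, (h.deriv_horiz hJ hx hbθ hb').2] at h1
    rw [h1, inner_smul_left, hv2]; simp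

/-- Now that X = (α² - k²) JN is known on all of Ω, `second_structure` on αN + T and v ∈ ξ' leaves
only multiples of v and Jv. -/
theorem deriv_vert {a : E} (haθ : pullbackContact J z t x a = 1)
    (ha : fderiv ℝ z x a = α x • N x) :
    fderiv ℝ k x a = 0 ∧ fderiv ℝ α x a = k x * (k x ^ 2 + α x ^ 2) := by
  obtain ⟨v, hv0, hv1, hv2⟩ := h.exists_ne_zero x hx
  obtain ⟨b, hb, hbθ⟩ := h.exists_horiz hx hv1
  have hb' : inner ℝ (J (N x)) (fderiv ℝ z x b) = 0 := by rw [hb, hv2]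
  obtain ⟨hkb, hαb⟩ := h.deriv_horiz hJ hx hbθ hb'
  have hNb := h.umbilic x hx b hbθ hb'
  have hNa := h.dN_vert hJ hx haθ ha
  have hN := differentiableAt_of_contDiffOn h.isOpen h.contDiffOn_N hx
  have hJN : DifferentiableAt ℝ (fun y => J (N y)) x := J.differentiableAt.comp x hN
  have hα2 : DifferentiableAt ℝ (fun y => α y * α y) x :=
    (h.alpha_diff hx).mul (h.alpha_diff hx)
  have hk2 : DifferentiableAt ℝ (fun y => k y * k y) x :=
    (h.k_diff hJ hx).mul (h.k_diff hJ hx)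
  have hc : DifferentiableAt ℝ (fun y => α y * α y - k y * k y) x := hα2.sub hk2
  have hX : ∀ y ∈ Ω, ∀ a,
      fderiv ℝ N y a = -k y • complexPart J z t N α y a + α y • J (complexPart J z t N α y a) +
      (2 * k y * charComponent J z N y a) • J (N y) +
        pullbackContact J z t y a • ((α y * α y - k y * k y) • J (N y)) := by
    intro y hy a
    obtain ⟨w, hw, hwθ⟩ := h.exists_vert hy
    rw [h.dN_eq hJ hy hw hwθ a, h.dN_vert hJ hy hwθ hw]
    module
  have hXd : DifferentiableAt ℝ (fun y => (α y * α y - k y * k y) • J (N y)) x := hc.smul hJN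
  have hXb : fderiv ℝ (fun y => (α y * α y - k y * k y) • J (N y)) x b =
      (α x ^ 2 - k x ^ 2) • J (fderiv ℝ N x b) := by
    rw [fderiv_smul_apply' hc hJN, fderiv_clm_comp_apply J hN, fderiv_fun_sub hα2 hk2, sub_apply,
      fderiv_mul_apply' (h.alpha_diff hx) (h.alpha_diff hx),
      fderiv_mul_apply' (h.k_diff hJ hx) (h.k_diff hJ hx), hαb, hkb]
    simp [sq]
  obtain ⟨hωa, hPa⟩ := complexPart_of_vert hJ haθ ha
  obtain ⟨hωb, hPb⟩ := complexPart_of_inner_eq_zero (α := α) (N := N) hbθ hb'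
  rw [hb] at hPb hNb
  have hvN : inner ℝ v (N x) = 0 := by rw [real_inner_comm, hv1]
  have hvJ : inner ℝ v (J (N x)) = 0 := by rw [real_inner_comm, hv2]
  have hJvN : inner ℝ (J v) (N x) = 0 := by rw [hJ.skew, hvJ, neg_zero]
  have key := h.second_structure hJ hx hX hXd a b haθ hbθ hωa hωb hPa hPb (θd := 0) (ωd := 0)
    (Pd := -α x • fderiv ℝ N x b)
    (by rw [ha, hb, inner_smul_right, hJvN]; simp)
    (by rw [ha, hb, hNb, hNa]
        simp only [map_add, map_smul, hJ.sq, inner_add_left, inner_smul_left, inner_neg_left,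
          inner_smul_right, hJvN, hvN, hv1]
        simp)
    (by rw [hαb]; simp)
  have key2 : fderiv ℝ k x a • v -
      (fderiv ℝ α x a - k x * (k x ^ 2 + α x ^ 2)) • J v = 0 := by
    rw [← key, hXb, hNb, hkb, hαb]
    simp only [map_add, map_smul, hJ.sq, map_zero]
    module
  have e2 := congrArg (fun u => inner ℝ u v) key2
  have e3 := congrArg (fun u => inner ℝ u (J v)) key2
  simp only [inner_sub_left, inner_smul_left, inner_zero_left, hJ.inner_map,
    hJ.inner_self, hJ.inner_self'] at e2 e3
  simp at e2 e3
  refine ⟨e2.resolve_right hv0, ?_⟩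
  linarith [e3.resolve_right hv0]

/-- The functions `k`, `α` and the horizontal normal `N` satisfy a closed first order system. -/
theorem structure_equations (a : E) :
    DifferentiableAt ℝ α x ∧ DifferentiableAt ℝ k x ∧ fderiv ℝ k x a = 0 ∧
    fderiv ℝ α x a = (k x ^ 2 + α x ^ 2) *
      (k x * pullbackContact J z t x a - charComponent J z N x a) ∧
    fderiv ℝ N x a = -k x • complexPart J z t N α x a + α x • J (complexPart J z t N α x a) +
      (2 * k x * charComponent J z N x a + (α x ^ 2 - k x ^ 2) * pullbackContact J z t x a) •
        J (N x) := by
  refine ⟨h.alpha_diff hx, h.k_diff hJ hx, ?_⟩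
  obtain ⟨w, hw, hwθ⟩ := h.exists_vert hx
  obtain ⟨c, hc, hcθ⟩ := h.exists_char hJ hx
  obtain ⟨v, hv0, hv1, hv2⟩ := h.exists_ne_zero x hx
  obtain ⟨b₀, hb₀, hb₀θ⟩ := h.exists_horiz hx hv1
  obtain ⟨-, hkc, hαc⟩ := h.deriv_char hJ hx hcθ hc hb₀θ (by rw [hb₀, hv2])
    (by rw [hb₀]; exact hv0)
  obtain ⟨hkw, hαw⟩ := h.deriv_vert hJ hx hwθ hw
  set b := a - charComponent J z N x a • c - pullbackContact J z t x a • w with hb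
  have hlin : ∀ u v : E, ∀ r : ℝ, pullbackContact J z t x (u - r • v) =
      pullbackContact J z t x u - r * pullbackContact J z t x v := by
    intro u v r
    unfold pullbackContact
    simp only [map_sub, map_smul, inner_sub_right, inner_smul_right, smul_eq_mul]
    ring
  have hbz : fderiv ℝ z x b = complexPart J z t N α x a := by
    rw [hb, map_sub, map_sub, map_smul, map_smul, hc, hw]
    unfold complexPart
    module
  have hbθ : pullbackContact J z t x b = 0 := by
    rw [hb, hlin, hlin, hcθ, hwθ]; ring
  obtain ⟨hkb, hαb⟩ := h.deriv_horiz hJ hx hbθ (by rw [hbz, h.inner_complexPart_JN hJ hx])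
  rw [hb, map_sub, map_sub, map_smul, map_smul, hkc, hkw] at hkb
  rw [hb, map_sub, map_sub, map_smul, map_smul, hαc, hαw] at hαb
  simp at hkb hαb
  refine ⟨hkb, by linear_combination hαb, ?_⟩
  rw [h.dN_eq hJ hx hw hwθ a, h.dN_vert hJ hx hwθ hw]
  module

end IsUmbilicModel
end LocalModel

/-! ### Complex structure, contact form and tangent hyperplanes at a point -/

section PointwiseAlgebra

variable {n : ℕ}

theorem J_apply_inl (v : Plane n) (j : Fin n) : J v (Sum.inl j) = -v (Sum.inr j) := rfl

theorem J_apply_inr (v : Plane n) (j : Fin n) : J v (Sum.inr j) = v (Sum.inl j) := rfl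

variable (n) in
/-- The complex structure as a continuous linear map. -/
def JL : Plane n →L[ℝ] Plane n := LinearMap.toContinuousLinearMap J

theorem JL_apply (v : Plane n) : JL n v = J v := rfl

theorem isOrthogonalComplexStructure_JL : IsOrthogonalComplexStructure (JL n) where
  sq v := by
    ext i
    rcases i with j | j <;> simp [JL_apply, J_apply_inl, J_apply_inr]
  skew u v := by
    simp only [JL_apply, PiLp.inner_apply, Fintype.sum_sum_type, J_apply_inl, J_apply_inr]
    simp only [RCLike.inner_apply, conj_trivial]
    rw [add_comm, ← Finset.sum_add_distrib, ← Finset.sum_add_distrib, ← Finset.sum_neg_distrib]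
    exact Finset.sum_congr rfl fun j _ => by ring

theorem J_sq (v : Plane n) : J (J v) = -v := isOrthogonalComplexStructure_JL.sq v

theorem inner_J_left (u v : Plane n) : inner ℝ (J u) v = -inner ℝ u (J v) :=
  isOrthogonalComplexStructure_JL.skew u v

theorem inner_J_J (u v : Plane n) : inner ℝ (J u) (J v) = inner ℝ u v :=
  isOrthogonalComplexStructure_JL.inner_map u v

theorem inner_J_self (v : Plane n) : inner ℝ (J v) v = 0 :=
  isOrthogonalComplexStructure_JL.inner_self v

theorem inner_self_J (v : Plane n) : inner ℝ v (J v) = 0 :=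
  isOrthogonalComplexStructure_JL.inner_self' v

theorem norm_J (v : Plane n) : ‖J v‖ = ‖v‖ := by
  rw [← sq_eq_sq₀ (norm_nonneg _) (norm_nonneg _), ← real_inner_self_eq_norm_sq,
    ← real_inner_self_eq_norm_sq, inner_J_J]

theorem sum_eq_inner_J (u v : Plane n) :
    ∑ j : Fin n, (u (Sum.inl j) * v (Sum.inr j) - u (Sum.inr j) * v (Sum.inl j)) =
      inner ℝ (J u) v := by
  simp only [PiLp.inner_apply, Fintype.sum_sum_type, J_apply_inl, J_apply_inr]
  simp only [RCLike.inner_apply, conj_trivial]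
  rw [add_comm, ← Finset.sum_add_distrib]
  exact Finset.sum_congr rfl fun j _ => by ring

theorem contactForm_apply (p w : Heis n) : contactForm p w = w.2 + inner ℝ (J p.1) w.1 := by
  rw [← sum_eq_inner_J]; rfl

theorem sum_eq_neg_inner_J (u v : Plane n) :
    ∑ j : Fin n, (u (Sum.inr j) * v (Sum.inl j) - u (Sum.inl j) * v (Sum.inr j)) =
      -inner ℝ (J u) v := by
  rw [← sum_eq_inner_J, ← Finset.sum_neg_distrib]
  exact Finset.sum_congr rfl fun j _ => by ring

theorem horizontalVector_apply (p : Heis n) (v : Plane n) :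
    horizontalVector p v = (v, -inner ℝ (J p.1) v) := by
  rw [← sum_eq_neg_inner_J]; rfl

theorem mul_eq (p q : Heis n) : mul p q = (p.1 + q.1, p.2 + q.2 - inner ℝ (J p.1) q.1) := by
  rw [sub_eq_add_neg, ← sum_eq_neg_inner_J]; rfl

theorem contactForm_horizontalVector (p : Heis n) (v : Plane n) :
    contactForm p (horizontalVector p v) = 0 := by
  rw [horizontalVector_apply, contactForm_apply]; simp

theorem contactForm_reeb (p : Heis n) : contactForm p reeb = 1 := by
  rw [contactForm_apply]; simp [reeb]

theorem horizontalVector_fst (p : Heis n) (v : Plane n) : (horizontalVector p v).1 = v := rfl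

theorem eq_horizontalVector_add (p w : Heis n) :
    w = horizontalVector p w.1 + contactForm p w • reeb := by
  rw [horizontalVector_apply, contactForm_apply]
  ext <;> simp [reeb]

theorem finrank_heis : Module.finrank ℝ (Heis n) = 2 * n + 1 := by
  rw [Module.finrank_prod, finrank_euclideanSpace, Module.finrank_self]
  simp; ring

theorem exists_ker_eq_of_finrank {S : Submodule ℝ (Heis n)} (hS : Module.finrank ℝ S = 2 * n) :
    ∃ η : Heis n →ₗ[ℝ] ℝ, η ≠ 0 ∧ LinearMap.ker η = S := by
  have hlt : S < ⊤ := by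
    refine lt_top_iff_ne_top.2 fun h => ?_
    rw [h, finrank_top, finrank_heis] at hS
    omega
  obtain ⟨η, hη, hle⟩ := Submodule.exists_le_ker_of_lt_top S hlt
  refine ⟨η, hη, (Submodule.eq_of_le_of_finrank_eq hle ?_).symm⟩
  have h1 := LinearMap.finrank_range_add_finrank_ker η
  rw [LinearMap.range_eq_top.2 (LinearMap.surjective hη), finrank_top, Module.finrank_self,
    finrank_heis] at h1
  omega

/-- S is the kernel of a functional η whose restriction to ξ is represented by some m, nonzero
because S ≠ ξ. The conditions on e force e to be parallel to Jm, so Je is parallel to m and η can be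
rescaled to the stated equation. -/
theorem mem_iff_of_characteristic {S : Submodule ℝ (Heis n)} {p : Heis n}
    (hS : Module.finrank ℝ S = 2 * n) (hne : S ≠ contactPlane p) {e : Plane n}
    (heH : e ∈ S.comap (horizontalVector p))
    (heo : e ∈ (S.comap (horizontalVector p) ⊓ (S.comap (horizontalVector p)).map J)ᗮ)
    (he1 : ‖e‖ = 1) :
    ∃ a : ℝ, ∀ w, w ∈ S ↔ inner ℝ (J e) w.1 = a * contactForm p w := by
  obtain ⟨η, hη, rfl⟩ := exists_ker_eq_of_finrank hS
  obtain ⟨m, hm⟩ : ∃ m : Plane n, ∀ v, η (horizontalVector p v) = inner ℝ m v := by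
    refine ⟨(InnerProductSpace.toDual ℝ (Plane n)).symm
      (LinearMap.toContinuousLinearMap (η ∘ₗ horizontalVector p)), fun v => ?_⟩
    rw [InnerProductSpace.toDual_symm_apply]; rfl
  have hη_eq : ∀ w, η w = inner ℝ m w.1 + contactForm p w * η reeb := by
    intro w
    conv_lhs => rw [eq_horizontalVector_add p w]
    rw [map_add, hm, map_smul, smul_eq_mul]
  have hm0 : m ≠ 0 := by
    rintro rfl
    apply hne
    have hr : η reeb ≠ 0 := by
      intro hr
      apply hη
      refine LinearMap.ext fun w => ?_
      rw [hη_eq, hr, inner_zero_left, mul_zero, add_zero, LinearMap.zero_apply]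
    ext w
    rw [LinearMap.mem_ker, hη_eq, contactPlane, LinearMap.mem_ker]
    simp [hr]
  have hH : ∀ v, v ∈ (LinearMap.ker η).comap (horizontalVector p) ↔ inner ℝ m v = 0 := by
    intro v
    rw [Submodule.mem_comap, LinearMap.mem_ker, hm]
  have hmm : inner ℝ m m ≠ 0 := inner_self_ne_zero.2 hm0
  -- With this c, r is orthogonal to both m and Jm, hence lies in ξ'. As e is orthogonal to ξ', r =
  -- 0.
  set c := inner ℝ (J m) e / inner ℝ m m with hc
  set r := e - c • J m with hr
  have hr1 : inner ℝ m r = 0 := by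
    rw [hr, inner_sub_right, inner_smul_right, inner_self_J, (hH e).1 heH]; ring
  have hr2 : inner ℝ (J m) r = 0 := by
    rw [hr, inner_sub_right, inner_smul_right, inner_J_J, hc]
    field_simp; ring
  have hrmem : r ∈ (LinearMap.ker η).comap (horizontalVector p) ⊓
      ((LinearMap.ker η).comap (horizontalVector p)).map J := by
    refine ⟨(hH r).2 hr1, ⟨-J r, (hH _).2 ?_, ?_⟩⟩
    · rw [inner_neg_right, ← inner_J_left, hr2]
    · rw [map_neg, J_sq, neg_neg]
  have her : inner ℝ e r = 0 := by
    rw [real_inner_comm]; exact (Submodule.mem_orthogonal _ _).1 heo r hrmem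
  have hr0 : r = 0 := by
    rw [← inner_self_eq_zero (𝕜 := ℝ)]
    conv_lhs => rw [hr, inner_sub_left]
    rw [← hr, her, inner_smul_left, hr2]; simp
  have hec : e = c • J m := by rw [← sub_eq_zero, ← hr, hr0]
  have hc0 : c ≠ 0 := by
    intro h0
    rw [h0, zero_smul] at hec
    rw [hec] at he1; simp at he1
  have hJe : J e = -(c • m) := by rw [hec, map_smul, J_sq, smul_neg]
  refine ⟨c * η reeb, fun w => ?_⟩
  rw [LinearMap.mem_ker, hη_eq, hJe, inner_neg_left, inner_smul_left]
  simp only [conj_trivial]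
  constructor
  · intro h; linear_combination (-c) * h
  · intro h
    have : c * (inner ℝ m w.1 + contactForm p w * η reeb) = 0 := by linear_combination -h
    exact (mul_eq_zero.1 this).resolve_left hc0

end PointwiseAlgebra

/-! ### Characteristic fields and their sign ambiguity -/

section Hypersurface

variable {n : ℕ} {M : Type*} [TopologicalSpace M]
  [ChartedSpace (EuclideanSpace ℝ (Fin (2 * n))) M] {F : M → Heis n} {U U' : Set M}
  {e e' : M → Plane n}

theorem finrank_tangentPlane (hF : IsImmersedHypersurface F) (p : M) :
    Module.finrank ℝ (tangentPlane F p) = 2 * n := by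
  have h := LinearMap.finrank_range_of_inj (f := (differential F p).toLinearMap)
    (hF.injective_differential p)
  have h2 : Module.finrank ℝ (TangentSpace (𝓡 (2 * n)) p) = 2 * n := by
    change Module.finrank ℝ (EuclideanSpace ℝ (Fin (2 * n))) = 2 * n
    simp
  exact h.trans h2

namespace IsCharacteristicField

/-- The constant a of `mem_iff_of_characteristic` is the only number meeting the condition that
defines `alpha`, so the choice operator must return it. -/
theorem mem_tangentPlane_iff (hF : IsImmersedHypersurface F) (he : IsCharacteristicField F U e)
    {p : M} (hp : p ∈ U) (w : Heis n) :
    w ∈ tangentPlane F p ↔ inner ℝ (J (e p)) w.1 = alpha F e p * contactForm (F p) w := by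
  obtain ⟨a, ha⟩ := mem_iff_of_characteristic (finrank_tangentPlane hF p)
    (he.subset_regularPart hp) (he.mem_horizontalTangent p hp) (he.mem_orthogonal p hp)
    (he.norm_eq_one p hp)
  have key : ∀ b : ℝ, horizontalVector (F p) (b • horizontalNormal e p) + reeb ∈
      tangentPlane F p ↔ b = a := by
    intro b
    rw [ha, map_add, contactForm_horizontalVector, contactForm_reeb, Prod.fst_add,
      horizontalVector_fst, horizontalNormal]
    simp only [reeb, add_zero, inner_smul_right, real_inner_self_eq_norm_sq,
      norm_J, he.norm_eq_one p hp]
    simp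
  have h2 : alpha F e p = a := (key _).1 (Classical.epsilon_spec (p := fun b : ℝ =>
    horizontalVector (F p) (b • horizontalNormal e p) + reeb ∈ tangentPlane F p) ⟨a, (key a).2 rfl⟩)
  rw [h2, ha]

theorem mem_horizontalTangent_iff (hF : IsImmersedHypersurface F)
    (he : IsCharacteristicField F U e) {p : M} (hp : p ∈ U) (v : Plane n) :
    v ∈ horizontalTangent F p ↔ inner ℝ (J (e p)) v = 0 := by
  rw [horizontalTangent, Submodule.mem_comap, he.mem_tangentPlane_iff hF hp,
    contactForm_horizontalVector, horizontalVector_fst, mul_zero]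

theorem mem_xiPrime_iff (hF : IsImmersedHypersurface F)
    (he : IsCharacteristicField F U e) {p : M} (hp : p ∈ U) (v : Plane n) :
    v ∈ xiPrime F p ↔ inner ℝ (J (e p)) v = 0 ∧ inner ℝ (e p) v = 0 := by
  rw [xiPrime, Submodule.mem_inf, he.mem_horizontalTangent_iff hF hp]
  refine and_congr_right fun _ => ?_
  constructor
  · rintro ⟨u, hu, rfl⟩
    have := (he.mem_horizontalTangent_iff hF hp u).1 hu
    rw [inner_J_left] at this
    linarith
  · intro h
    refine ⟨-J v, (he.mem_horizontalTangent_iff hF hp _).2 ?_, by rw [map_neg, J_sq, neg_neg]⟩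
    rw [inner_neg_right, inner_J_J, h, neg_zero]

/-- Je and Je' are both unit normals of the same hyperplane ξ ∩ TΣ of ξ. -/
theorem eq_smul (hF : IsImmersedHypersurface F)
    (he : IsCharacteristicField F U e) (he' : IsCharacteristicField F U' e') {p : M} (hp : p ∈ U)
    (hp' : p ∈ U') : e' p = (inner ℝ (e p) (e' p) : ℝ) • e p ∧
      (inner ℝ (e p) (e' p) : ℝ) * inner ℝ (e p) (e' p) = 1 := by
  set c : ℝ := inner ℝ (e p) (e' p) with hc
  have h11 : inner ℝ (e p) (e p) = (1 : ℝ) := by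
    rw [real_inner_self_eq_norm_sq, he.norm_eq_one p hp]; norm_num
  have h11' : inner ℝ (e' p) (e' p) = (1 : ℝ) := by
    rw [real_inner_self_eq_norm_sq, he'.norm_eq_one p hp']; norm_num
  set r := e' p - c • e p with hr
  have h1 : inner ℝ (e p) r = 0 := by
    rw [hr, inner_sub_right, inner_smul_right, h11, ← hc]; ring
  have h2 : J r ∈ horizontalTangent F p := by
    rw [he.mem_horizontalTangent_iff hF hp, inner_J_J, h1]
  rw [he'.mem_horizontalTangent_iff hF hp', inner_J_J] at h2
  have hr0 : r = 0 := by
    rw [← inner_self_eq_zero (𝕜 := ℝ)]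
    conv_lhs => rw [hr, inner_sub_left]
    rw [← hr, h2, inner_smul_left, h1]; simp
  have h3 : e' p = c • e p := by rw [← sub_eq_zero, ← hr, hr0]
  refine ⟨h3, ?_⟩
  rw [h3, inner_smul_left, inner_smul_right, h11] at h11'
  simpa using h11'

theorem alpha_smul (hF : IsImmersedHypersurface F)
    (he : IsCharacteristicField F U e) (he' : IsCharacteristicField F U' e') {p : M} (hp : p ∈ U)
    (hp' : p ∈ U') {c : ℝ} (hc : e' p = c • e p) : alpha F e' p = c * alpha F e p := by
  have h11' : inner ℝ (e' p) (e' p) = (1 : ℝ) := by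
    rw [real_inner_self_eq_norm_sq, he'.norm_eq_one p hp']; norm_num
  set w := horizontalVector (F p) (alpha F e' p • J (e' p)) + reeb with hw
  have h1 : w ∈ tangentPlane F p := by
    rw [he'.mem_tangentPlane_iff hF hp', hw, map_add, contactForm_horizontalVector,
      contactForm_reeb, Prod.fst_add, horizontalVector_fst]
    simp only [reeb, add_zero, inner_smul_right, inner_J_J, h11']; ring
  rw [he.mem_tangentPlane_iff hF hp, hw, map_add, contactForm_horizontalVector,
      contactForm_reeb, Prod.fst_add, horizontalVector_fst] at h1
  simp only [reeb, add_zero, inner_smul_right, inner_J_J, zero_add, mul_one] at h1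
  have h2 : c * inner ℝ (e p) (e' p) = (1 : ℝ) := by
    have h5 : inner ℝ (c • e p) (e' p) = (1 : ℝ) := by rw [← hc, h11']
    rw [inner_smul_left] at h5
    simpa using h5
  rw [← h1]
  linear_combination -alpha F e' p * h2

/-- The function ⟨e, e'⟩ is continuous with values ±1, hence locally constant. -/
theorem eventually_eq_smul (hF : IsImmersedHypersurface F)
    (he : IsCharacteristicField F U e) (he' : IsCharacteristicField F U' e') {p : M} (hp : p ∈ U)
    (hp' : p ∈ U') : ∃ c : ℝ, c * c = 1 ∧ ∀ᶠ q in nhds p, e' q = c • e q := by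
  obtain ⟨-, h2⟩ := he.eq_smul hF he' hp hp'
  set c : ℝ := inner ℝ (e p) (e' p) with hc
  refine ⟨c, h2, ?_⟩
  have hce : ContinuousAt e p :=
    (he.contMDiffOn.continuousOn).continuousAt (he.isOpen.mem_nhds hp)
  have hce' : ContinuousAt e' p :=
    (he'.contMDiffOn.continuousOn).continuousAt (he'.isOpen.mem_nhds hp')
  have hcont : ContinuousAt (fun q => c * inner ℝ (e q) (e' q)) p :=
    continuousAt_const.mul (hce.inner hce')
  have hpos : ∀ᶠ q in nhds p, 0 < c * inner ℝ (e q) (e' q) :=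
    hcont.eventually_const_lt (by change 0 < c * c; rw [h2]; exact one_pos)
  filter_upwards [hpos, he.isOpen.mem_nhds hp, he'.isOpen.mem_nhds hp'] with q hq hqU hqU'
  obtain ⟨h3, h4⟩ := he.eq_smul hF he' hqU hqU'
  have : inner ℝ (e q) (e' q) = c := by
    rcases mul_self_eq_one_iff.1 h2 with hc1 | hc1 <;>
      rcases mul_self_eq_one_iff.1 h4 with h5 | h5 <;> rw [hc1, h5] at hq ⊢ <;> norm_num at hq
  rw [h3, this]

end IsCharacteristicField

end Hypersurface

/-! ### Derivatives in charts, and the shape operator up to sign -/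

section Hypersurface

variable {n : ℕ} {M : Type*} [TopologicalSpace M]
  [ChartedSpace (EuclideanSpace ℝ (Fin (2 * n))) M] {F : M → Heis n} {U U' : Set M}
  {e e' : M → Plane n}

theorem isManifold_one [IsManifold (𝓡 (2 * n)) 2 M] : IsManifold (𝓡 (2 * n)) 1 M :=
  IsManifold.of_le (n := 2) (by norm_num)

section Chart

variable {φ : OpenPartialHomeomorph M (EuclideanSpace ℝ (Fin (2 * n)))}
  (hφ : φ ∈ IsManifold.maximalAtlas (𝓡 (2 * n)) 2 M)
include hφ

theorem mdifferentiable_of_mem_maximalAtlas : φ.MDifferentiable (𝓡 (2 * n)) (𝓡 (2 * n)) :=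
  ⟨(contMDiffOn_of_mem_maximalAtlas hφ).mdifferentiableOn (by norm_num),
    (contMDiffOn_symm_of_mem_maximalAtlas hφ).mdifferentiableOn (by norm_num)⟩

theorem mfderiv_symm_bijective [IsManifold (𝓡 (2 * n)) 2 M] {x : EuclideanSpace ℝ (Fin (2 * n))} (hx : x ∈ φ.target) :
    Function.Bijective (mfderiv (𝓡 (2 * n)) (𝓡 (2 * n)) φ.symm x) :=
  have := isManifold_one (n := n) (M := M)
  (mdifferentiable_of_mem_maximalAtlas hφ).symm.mfderiv_bijective hx

theorem differentiableAt_comp_symm {W : Type*} [NormedAddCommGroup W] [NormedSpace ℝ W]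
    {f : M → W} {x : EuclideanSpace ℝ (Fin (2 * n))} (hx : x ∈ φ.target)
    (hf : MDifferentiableAt (𝓡 (2 * n)) 𝓘(ℝ, W) f (φ.symm x)) :
    DifferentiableAt ℝ (f ∘ φ.symm) x ∧ ∀ a : EuclideanSpace ℝ (Fin (2 * n)),
      fderiv ℝ (f ∘ φ.symm) x a = mfderiv (𝓡 (2 * n)) 𝓘(ℝ, W) f (φ.symm x)
        (mfderiv (𝓡 (2 * n)) (𝓡 (2 * n)) φ.symm x a) := by
  have h1 : MDifferentiableAt (𝓡 (2 * n)) (𝓡 (2 * n)) φ.symm x :=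
    (mdifferentiable_of_mem_maximalAtlas hφ).mdifferentiableAt_symm hx
  refine ⟨mdifferentiableAt_iff_differentiableAt.1 (hf.comp x h1), fun a => ?_⟩
  rw [← mfderiv_eq_fderiv, mfderiv_comp x hf h1]
  rfl

end Chart

/-- F is smooth only in special charts around regular points, while a chart around a singular point
is merely one of the C² structure. This chain rule carries derivatives from the former to the
latter. -/
theorem differentiableAt_comp_symm_of_chart
    {φ ψ : OpenPartialHomeomorph M (EuclideanSpace ℝ (Fin (2 * n)))}
    (hφ : φ ∈ IsManifold.maximalAtlas (𝓡 (2 * n)) 2 M)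
    (hψ : ψ ∈ IsManifold.maximalAtlas (𝓡 (2 * n)) 2 M)
    {W : Type*} [NormedAddCommGroup W] [NormedSpace ℝ W]
    {f : M → W} {x : EuclideanSpace ℝ (Fin (2 * n))} (hx : x ∈ φ.target)
    (hxψ : φ.symm x ∈ ψ.source)
    (hf : DifferentiableAt ℝ (f ∘ ψ.symm) (ψ (φ.symm x))) :
    DifferentiableAt ℝ (f ∘ φ.symm) x ∧ ∀ a : EuclideanSpace ℝ (Fin (2 * n)),
      fderiv ℝ (f ∘ φ.symm) x a = fderiv ℝ (f ∘ ψ.symm) (ψ (φ.symm x))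
        (fderiv ℝ (ψ ∘ φ.symm) x a) := by
  have h1 : MDifferentiableAt (𝓡 (2 * n)) (𝓡 (2 * n)) φ.symm x :=
    (mdifferentiable_of_mem_maximalAtlas hφ).mdifferentiableAt_symm hx
  have h2 : MDifferentiableAt (𝓡 (2 * n)) (𝓡 (2 * n)) ψ (φ.symm x) :=
    (mdifferentiable_of_mem_maximalAtlas hψ).mdifferentiableAt hxψ
  have h3 : DifferentiableAt ℝ (ψ ∘ φ.symm) x :=
    mdifferentiableAt_iff_differentiableAt.1 (h2.comp x h1)
  have hev : f ∘ φ.symm =ᶠ[nhds x] (f ∘ ψ.symm) ∘ (ψ ∘ φ.symm) := by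
    have hc : ContinuousAt φ.symm x := φ.symm.continuousAt hx
    filter_upwards [hc.eventually_mem (ψ.open_source.mem_nhds hxψ)] with y hy
    simp [ψ.left_inv hy]
  refine ⟨(hf.comp x h3).congr_of_eventuallyEq hev, fun a => ?_⟩
  rw [hev.fderiv_eq, fderiv_comp x hf h3]
  rfl

theorem IsImmersedHypersurface.mdifferentiableAt (hF : IsImmersedHypersurface F) (p : M) :
    MDifferentiableAt (𝓡 (2 * n)) 𝓘(ℝ, Heis n) F p :=
  (hF.contMDiff p).mdifferentiableAt (by norm_num)

theorem IsCharacteristicField.mdifferentiableAt (he : IsCharacteristicField F U e) {p : M}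
    (hp : p ∈ U) : MDifferentiableAt (𝓡 (2 * n)) 𝓘(ℝ, Plane n) e p :=
  (he.contMDiffOn.contMDiffAt (he.isOpen.mem_nhds hp)).mdifferentiableAt (by norm_num)

theorem hasMFDerivAt_horizontalNormal (he : IsCharacteristicField F U e) {p : M}
    (hp : p ∈ U) : HasMFDerivAt (𝓡 (2 * n)) 𝓘(ℝ, Plane n) (horizontalNormal e) p
      ((JL n).comp (mfderiv (𝓡 (2 * n)) 𝓘(ℝ, Plane n) e p : _ →L[ℝ] Plane n)) := by
  have h1 : HasMFDerivAt 𝓘(ℝ, Plane n) 𝓘(ℝ, Plane n) (JL n) (e p) (JL n) :=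
    (JL n).hasFDerivAt.hasMFDerivAt
  exact h1.comp p (he.mdifferentiableAt hp).hasMFDerivAt

theorem covDeriv_eq (hF : IsImmersedHypersurface F) {u : M → Plane n} {p : M} {v : Plane n}
    {a : TangentSpace (𝓡 (2 * n)) p} (ha : differential F p a = horizontalVector (F p) v) :
    covDeriv F u p v = mfderiv (𝓡 (2 * n)) 𝓘(ℝ, Plane n) u p a := by
  have h1 : Function.invFun (differential F p) (horizontalVector (F p) v) = a := by
    rw [← ha]
    exact Function.leftInverse_invFun (hF.injective_differential p) a
  rw [covDeriv, h1]

/-- `Function.invFun` is not linear off the range of the differential; a linear left inverse agrees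
with it on ξ ∩ TΣ. Linearity is what extends the eigenvalue equation from a basis to all of ξ'. -/
theorem exists_linear_covDeriv (hF : IsImmersedHypersurface F) (u : M → Plane n) (p : M) :
    ∃ S : Plane n →ₗ[ℝ] Plane n, ∀ v ∈ horizontalTangent F p, covDeriv F u p v = S v := by
  obtain ⟨g, hg⟩ := LinearMap.exists_leftInverse_of_injective (differential F p).toLinearMap
    (LinearMap.ker_eq_bot.2 (hF.injective_differential p))
  refine ⟨(mfderiv (𝓡 (2 * n)) 𝓘(ℝ, Plane n) u p).toLinearMap ∘ₗ g ∘ₗ horizontalVector (F p),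
    fun v hv => ?_⟩
  obtain ⟨a, ha⟩ := hv
  have ha' : differential F p a = horizontalVector (F p) v := ha
  rw [covDeriv_eq hF ha']
  have : g (horizontalVector (F p) v) = a := by
    rw [← ha']; exact LinearMap.congr_fun hg a
  exact (congrArg (mfderiv (𝓡 (2 * n)) 𝓘(ℝ, Plane n) u p) this).symm

theorem exists_linear_shapeOperator (hF : IsImmersedHypersurface F) (e : M → Plane n) (p : M) :
    ∃ S : Plane n →ₗ[ℝ] Plane n, ∀ v ∈ horizontalTangent F p, shapeOperator F e p v = S v := by
  obtain ⟨S, hS⟩ := exists_linear_covDeriv hF (horizontalNormal e) p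
  refine ⟨-S + alpha F e p • (J ∘ₗ (LinearMap.id -
    ((innerSL ℝ (e p)).toLinearMap.smulRight (e p)))), fun v hv => ?_⟩
  rw [shapeOperator, hS v hv]
  rfl

theorem IsUmbilicPoint.exists_eq_smul (hn : 2 ≤ n) (hF : IsImmersedHypersurface F) {p : M}
    (hp : IsUmbilicPoint F p) : ∃ (U : Set M) (e : M → Plane n), IsCharacteristicField F U e ∧
      p ∈ U ∧ ∃ k : ℝ, ∀ v ∈ xiPrime F p, shapeOperator F e p v = k • v := by
  obtain ⟨-, U, e, he, hpU, -, b, lam, hb, hlam⟩ := hp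
  -- The index 0 exists because 2n - 2 > 0.
  refine ⟨U, e, he, hpU, lam ⟨0, by omega⟩, fun v hv => ?_⟩
  obtain ⟨S, hS⟩ := exists_linear_shapeOperator hF e p
  have hle : ∀ v ∈ xiPrime F p, v ∈ horizontalTangent F p := fun v hv => hv.1
  have : S ∘ₗ (xiPrime F p).subtype = lam ⟨0, by omega⟩ • (xiPrime F p).subtype := by
    refine b.toBasis.ext fun j => ?_
    have h1 := hb j
    rw [hS _ (hle _ (b j).2), hlam j ⟨0, by omega⟩] at h1
    simpa using h1
  rw [hS v (hle v hv)]
  exact LinearMap.congr_fun this ⟨v, hv⟩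

namespace IsCharacteristicField

theorem covDeriv_smul (hF : IsImmersedHypersurface F)
    (he : IsCharacteristicField F U e) {p : M} (hp : p ∈ U)
    {c : ℝ} (hc : ∀ᶠ q in nhds p, e' q = c • e q) {v : Plane n}
    (hv : v ∈ horizontalTangent F p) :
    covDeriv F (horizontalNormal e') p v = c • covDeriv F (horizontalNormal e) p v := by
  obtain ⟨a, ha⟩ := hv
  have ha' : differential F p a = horizontalVector (F p) v := ha
  have h1 := hasMFDerivAt_horizontalNormal he hp
  have h3 : horizontalNormal e' =ᶠ[nhds p] c • horizontalNormal e := by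
    filter_upwards [hc] with q hq
    simp [horizontalNormal, hq]
  rw [covDeriv_eq hF ha', covDeriv_eq hF ha', h3.mfderiv_eq, (h1.const_smul c).mfderiv, h1.mfderiv]
  rfl

theorem shapeOperator_smul (hF : IsImmersedHypersurface F)
    (he : IsCharacteristicField F U e) (he' : IsCharacteristicField F U' e') {p : M} (hp : p ∈ U)
    (hp' : p ∈ U') {c : ℝ} (hcc : c * c = 1) (hc : ∀ᶠ q in nhds p, e' q = c • e q) {v : Plane n}
    (hv : v ∈ horizontalTangent F p) :
    shapeOperator F e' p v = c • shapeOperator F e p v := by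
  have h4 := he.alpha_smul hF he' hp hp' hc.self_of_nhds
  rw [shapeOperator, shapeOperator, he.covDeriv_smul hF hp hc hv, h4, JPrime, JPrime,
    hc.self_of_nhds, inner_smul_left, smul_smul]
  have : ((starRingEnd ℝ) c * inner ℝ (e p) v * c) = inner ℝ (e p) v := by
    simp only [conj_trivial]; linear_combination inner ℝ (e p) v * hcc
  rw [this, smul_add, smul_neg, smul_smul]

/-- Umbilicity provides an eigenvalue for some characteristic field near p. Since e agrees with that
field up to a locally constant sign, an eigenvalue exists for e as well, and the choice operator in
`kCurv` returns one. -/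
theorem shapeOperator_eq (hn : 2 ≤ n) (hF : IsImmersedHypersurface F) (humb : IsUmbilic F)
    (he : IsCharacteristicField F U e) {p : M} (hp : p ∈ U) {v : Plane n}
    (hv : v ∈ xiPrime F p) : shapeOperator F e p v = kCurv F e p • v := by
  have hex : ∃ k : ℝ, ∀ v ∈ xiPrime F p, shapeOperator F e p v = k • v := by
    obtain ⟨U', e', he', hp', k, hk⟩ :=
      (humb p (he.subset_regularPart hp)).exists_eq_smul hn hF
    obtain ⟨c, hcc, hc⟩ := he'.eventually_eq_smul hF he hp' hp
    refine ⟨c * k, fun v hv => ?_⟩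
    rw [he'.shapeOperator_smul hF he hp' hp hcc hc hv.1, hk v hv, smul_smul]
  exact Classical.epsilon_spec (p := fun k : ℝ => ∀ v ∈ xiPrime F p,
    shapeOperator F e p v = k • v) hex v hv

/-- ξ' is cut out by two linear equations in dimension 2n ≥ 4. A nonzero vector in it makes k unique
and gives the structure equations their content. -/
theorem exists_mem_xiPrime (hn : 2 ≤ n) (hF : IsImmersedHypersurface F)
    (he : IsCharacteristicField F U e) {p : M} (hp : p ∈ U) :
    ∃ v ∈ xiPrime F p, v ≠ 0 := by
  set L : Plane n →ₗ[ℝ] ℝ × ℝ :=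
    (innerSL ℝ (J (e p))).toLinearMap.prod (innerSL ℝ (e p)).toLinearMap with hL
  have h1 := LinearMap.finrank_range_add_finrank_ker L
  have h2 : Module.finrank ℝ (LinearMap.range L) ≤ 2 := by
    refine (Submodule.finrank_le _).trans ?_
    simp
  have h3 : Module.finrank ℝ (Plane n) = 2 * n := by
    rw [finrank_euclideanSpace]; simp; ring
  have h4 : LinearMap.ker L ≠ ⊥ := by
    intro h4
    rw [h4, finrank_bot] at h1
    omega
  obtain ⟨v, hv, hv0⟩ := (Submodule.ne_bot_iff _).1 h4
  refine ⟨v, (he.mem_xiPrime_iff hF hp v).2 ?_, hv0⟩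
  rw [LinearMap.mem_ker, hL] at hv
  exact ⟨congrArg Prod.fst hv, congrArg Prod.snd hv⟩

theorem kCurv_smul (hn : 2 ≤ n) (hF : IsImmersedHypersurface F) (humb : IsUmbilic F)
    (he : IsCharacteristicField F U e) (he' : IsCharacteristicField F U' e') {p : M} (hp : p ∈ U)
    (hp' : p ∈ U') {c : ℝ} (hcc : c * c = 1) (hc : ∀ᶠ q in nhds p, e' q = c • e q) :
    kCurv F e' p = c * kCurv F e p := by
  obtain ⟨v, hv, hv0⟩ := he.exists_mem_xiPrime hn hF hp
  have h1 := he.shapeOperator_smul hF he' hp hp' hcc hc hv.1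
  rw [he.shapeOperator_eq hn hF humb hp hv, he'.shapeOperator_eq hn hF humb hp' hv,
    smul_smul] at h1
  exact smul_left_injective ℝ hv0 h1

end IsCharacteristicField

end Hypersurface

/-! ### Representing vectors and smooth conormals -/

section Riesz

variable (n : ℕ)

/-- The vector representing a linear functional on the plane. -/
def rieszVector : (Plane n →L[ℝ] ℝ) →L[ℝ] Plane n :=
  ∑ i, (ContinuousLinearMap.apply ℝ ℝ (EuclideanSpace.basisFun (Fin n ⊕ Fin n) ℝ i)).smulRight
    (EuclideanSpace.basisFun (Fin n ⊕ Fin n) ℝ i)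

variable {n}

theorem inner_rieszVector (L : Plane n →L[ℝ] ℝ) (v : Plane n) :
    inner ℝ (rieszVector n L) v = L v := by
  conv_rhs => rw [← (EuclideanSpace.basisFun (Fin n ⊕ Fin n) ℝ).sum_repr' v]
  simp only [rieszVector, sum_apply, ContinuousLinearMap.smulRight_apply,
    ContinuousLinearMap.apply_apply, sum_inner, inner_smul_left, map_sum, map_smul, conj_trivial,
    smul_eq_mul]
  exact Finset.sum_congr rfl fun i _ => mul_comm _ _

end Riesz

section Smoothness

/-- A continuous unit field parallel to a smooth field is smooth. -/
theorem contDiffAt_of_eq_smul {E V : Type*} [NormedAddCommGroup E] [NormedSpace ℝ E]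
    [NormedAddCommGroup V] [InnerProductSpace ℝ V] {N m : E → V} {κ : E → ℝ} {x : E}
    (hN : ContinuousAt N x) (hm : ContDiffAt ℝ ∞ m x)
    (h1 : ∀ᶠ y in nhds x, ‖N y‖ = 1) (hκ : ∀ᶠ y in nhds x, N y = κ y • m y) :
    ContDiffAt ℝ ∞ N x := by
  set g : E → ℝ := fun y => inner ℝ (N y) (m y) with hg
  have hgc : ContinuousAt g x := hN.inner hm.continuousAt
  have hm0 : m x ≠ 0 := by
    intro h0
    have h2 := h1.self_of_nhds
    rw [hκ.self_of_nhds, h0] at h2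
    simp at h2
  -- σ is the sign of ⟨N, m⟩ at x, which persists nearby by continuity. Hence N = σ m/|m| near x,
  -- although κ itself is not assumed continuous.
  have key : ∀ σ : ℝ, σ * σ = 1 → 0 < σ * g x → ContDiffAt ℝ ∞ N x := by
    intro σ hσ hpos
    have hsm : ContDiffAt ℝ ∞ (fun y => (σ * ‖m y‖⁻¹) • m y) x :=
      (contDiffAt_const.mul ((hm.norm ℝ hm0).inv (norm_ne_zero_iff.2 hm0))).smul hm
    refine hsm.congr_of_eventuallyEq ?_
    have hpos' : ∀ᶠ y in nhds x, 0 < σ * g y :=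
      (continuousAt_const.mul hgc).eventually_const_lt hpos
    filter_upwards [hpos', h1, hκ] with y hy hy1 hyκ
    have hy2 : σ * g y = σ * κ y * ‖m y‖ ^ 2 := by
      simp only [hg, hyκ, inner_smul_left, real_inner_self_eq_norm_sq, conj_trivial]; ring
    rw [hy2] at hy
    have hmy : ‖m y‖ ≠ 0 := by
      intro h0; rw [h0] at hy; simp at hy
    have hσκ : 0 < σ * κ y := by
      by_contra hcon
      have := mul_nonneg (neg_nonneg.2 (not_lt.1 hcon)) (sq_nonneg ‖m y‖)
      linarith
    have habs : |σ * κ y| * ‖m y‖ = 1 := by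
      have hσ1 : |σ| = 1 := by
        rcases mul_self_eq_one_iff.1 hσ with h | h <;> rw [h] <;> simp
      rw [abs_mul, hσ1, one_mul, ← Real.norm_eq_abs, ← norm_smul, ← hyκ, hy1]
    rw [abs_of_pos hσκ] at habs
    have : κ y = σ * ‖m y‖⁻¹ := by
      field_simp
      linear_combination σ * habs - κ y * ‖m y‖ * hσ
    rw [hyκ, this]
  have hg0 : g x ≠ 0 := by
    intro h0
    have hx := hκ.self_of_nhds
    have h2 : N x = 0 := by
      rw [← inner_self_eq_zero (𝕜 := ℝ)]
      nth_rewrite 2 [hx]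
      rw [inner_smul_right]
      simp only [hg] at h0
      rw [h0, mul_zero]
    have h3 := h1.self_of_nhds
    rw [h2] at h3; simp at h3
  rcases lt_or_gt_of_ne hg0 with hneg | hpos
  · exact key (-1) (by norm_num) (by linarith)
  · exact key 1 (by norm_num) (by linarith)

/-- A smooth family of conormals of an immersed hypersurface. -/
theorem exists_contDiffAt_conormal {E W : Type*} [NormedAddCommGroup E] [NormedSpace ℝ E]
    [NormedAddCommGroup W] [NormedSpace ℝ W] [FiniteDimensional ℝ E] [FiniteDimensional ℝ W]
    (hdim : Module.finrank ℝ W = Module.finrank ℝ E + 1) {G : E → W} {x : E}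
    (hG : ContDiffAt ℝ ∞ G x) (hinj : Function.Injective (fderiv ℝ G x)) {ν : W}
    (hν : ν ∉ LinearMap.range (fderiv ℝ G x).toLinearMap) :
    ∃ η : E → W →L[ℝ] ℝ, ContDiffAt ℝ ∞ η x ∧ ∀ᶠ y in nhds x, ∀ w, ∃ a,
      w = fderiv ℝ G y a + η y w • ν := by
  -- The map (a, s) ↦ dG_y a + sν is invertible at x because ν is transverse, hence nearby, with
  -- smooth inverse; η is the last component of that inverse.
  set A : E → (E × ℝ →L[ℝ] W) := fun y =>
    (fderiv ℝ G y).comp (ContinuousLinearMap.fst ℝ E ℝ) +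
      (ContinuousLinearMap.snd ℝ E ℝ).smulRight ν with hA
  have hAapp : ∀ y a, A y a = fderiv ℝ G y a.1 + a.2 • ν := fun y a => rfl
  have hAs : ContDiffAt ℝ ∞ A x :=
    ((hG.fderiv_right (m := ∞) (by simp)).clm_comp contDiffAt_const).add contDiffAt_const
  have hAinj : Function.Injective (A x) := by
    rw [injective_iff_map_eq_zero]
    rintro ⟨a, s⟩ h
    rw [hAapp] at h
    have hs : s = 0 := by
      by_contra hs
      apply hν
      refine ⟨-(s⁻¹ • a), ?_⟩
      change fderiv ℝ G x (-(s⁻¹ • a)) = ν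
      rw [map_neg, map_smul, eq_neg_of_add_eq_zero_left h, smul_neg, neg_neg, smul_smul,
        inv_mul_cancel₀ hs, one_smul]
    subst hs
    have ha : fderiv ℝ G x a = 0 := by simpa using h
    rw [(injective_iff_map_eq_zero _).1 hinj a ha]; rfl
  have hfr : Module.finrank ℝ (E × ℝ) = Module.finrank ℝ W := by
    rw [Module.finrank_prod, Module.finrank_self, hdim]
  let L : (E × ℝ) ≃L[ℝ] W :=
    (LinearEquiv.ofInjectiveOfFinrankEq (A x).toLinearMap hAinj hfr).toContinuousLinearEquiv
  have hL : (L : E × ℝ →L[ℝ] W) = A x := by ext <;> rfl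
  have hinv : ContDiffAt ℝ ∞ (fun y => (A y).inverse) x := by
    have h1 := contDiffAt_map_inverse (𝕜 := ℝ) (n := ∞) L
    rw [hL] at h1
    exact h1.comp x hAs
  refine ⟨fun y => (ContinuousLinearMap.snd ℝ E ℝ).comp (A y).inverse,
    contDiffAt_const.clm_comp hinv, ?_⟩
  have hnhds := ContinuousLinearEquiv.nhds L
  rw [hL] at hnhds
  filter_upwards [hAs.continuousAt.eventually_mem hnhds] with y hy w
  obtain ⟨L', hL'⟩ := hy
  refine ⟨((A y).inverse w).1, ?_⟩
  have h2 := hAapp y ((A y).inverse w)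
  rw [← hL', ContinuousLinearMap.inverse_equiv] at h2 ⊢
  exact (L'.apply_symm_apply w).symm.trans h2

end Smoothness

/-! ### The regular part in a smooth chart as an umbilic model -/

section Hypersurface

variable {n : ℕ} {M : Type*} [TopologicalSpace M]
  [ChartedSpace (EuclideanSpace ℝ (Fin (2 * n))) M] [IsManifold (𝓡 (2 * n)) 2 M]
  {F : M → Heis n} {U U' : Set M} {e e' : M → Plane n}
  {φ : OpenPartialHomeomorph M (EuclideanSpace ℝ (Fin (2 * n)))}
  (hφ : φ ∈ IsManifold.maximalAtlas (𝓡 (2 * n)) 2 M)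
  {x : EuclideanSpace ℝ (Fin (2 * n))} (hx : x ∈ φ.target)

include hφ hx

theorem mem_tangentPlane_iff_fderiv (hF : IsImmersedHypersurface F) (w : Heis n) :
    w ∈ tangentPlane F (φ.symm x) ↔ ∃ a, fderiv ℝ (F ∘ φ.symm) x a = w := by
  have h := (differentiableAt_comp_symm hφ hx (hF.mdifferentiableAt _)).2
  constructor
  · rintro ⟨b, rfl⟩
    obtain ⟨a, rfl⟩ := (mfderiv_symm_bijective hφ hx).2 b
    exact ⟨a, h a⟩
  · rintro ⟨a, rfl⟩
    exact ⟨_, (h a).symm⟩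

theorem fderiv_comp_symm_injective (hF : IsImmersedHypersurface F) :
    Function.Injective (fderiv ℝ (F ∘ φ.symm) x) := by
  have h := (differentiableAt_comp_symm hφ hx (hF.mdifferentiableAt _)).2
  intro a b hab
  rw [h, h] at hab
  exact (mfderiv_symm_bijective hφ hx).1 (hF.injective_differential _ hab)

omit [IsManifold (𝓡 (2 * n)) 2 M] in
theorem fderiv_fst_snd (hF : IsImmersedHypersurface F) (a : EuclideanSpace ℝ (Fin (2 * n))) :
    fderiv ℝ (fun y => (F (φ.symm y)).1) x a = (fderiv ℝ (F ∘ φ.symm) x a).1 ∧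
    fderiv ℝ (fun y => (F (φ.symm y)).2) x a = (fderiv ℝ (F ∘ φ.symm) x a).2 := by
  have h := (differentiableAt_comp_symm hφ hx (hF.mdifferentiableAt _)).1
  refine ⟨?_, ?_⟩
  · exact congrArg (fun L : _ →L[ℝ] Plane n => L a) h.hasFDerivAt.fst.fderiv
  · exact congrArg (fun L : _ →L[ℝ] ℝ => L a) h.hasFDerivAt.snd.fderiv

omit [IsManifold (𝓡 (2 * n)) 2 M] in
theorem pullbackContact_eq (hF : IsImmersedHypersurface F)
    (a : EuclideanSpace ℝ (Fin (2 * n))) :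
    pullbackContact (JL n) (fun y => (F (φ.symm y)).1) (fun y => (F (φ.symm y)).2) x a =
      contactForm (F (φ.symm x)) (fderiv ℝ (F ∘ φ.symm) x a) := by
  rw [contactForm_apply, pullbackContact, (fderiv_fst_snd hφ hx hF a).1,
    (fderiv_fst_snd hφ hx hF a).2]
  rfl

theorem exists_pullbackContact_iff (hF : IsImmersedHypersurface F) (v : Plane n) (s : ℝ) :
    (∃ a, fderiv ℝ (fun y => (F (φ.symm y)).1) x a = v ∧
      pullbackContact (JL n) (fun y => (F (φ.symm y)).1) (fun y => (F (φ.symm y)).2) x a = s) ↔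
    horizontalVector (F (φ.symm x)) v + s • reeb ∈ tangentPlane F (φ.symm x) := by
  rw [mem_tangentPlane_iff_fderiv hφ hx hF]
  refine exists_congr fun a => ?_
  rw [pullbackContact_eq hφ hx hF, (fderiv_fst_snd hφ hx hF a).1]
  constructor
  · rintro ⟨h1, h2⟩
    conv_lhs => rw [eq_horizontalVector_add (F (φ.symm x)) (fderiv ℝ (F ∘ φ.symm) x a)]
    rw [h1, h2]
  · intro h
    rw [h]
    refine ⟨by simp [horizontalVector_fst, reeb], ?_⟩
    rw [map_add, map_smul, contactForm_horizontalVector, contactForm_reeb]; simp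

namespace IsCharacteristicField

/-- The field e is only assumed C¹. But Je is a continuous unit field parallel to the horizontal
part of a smooth conormal of F, so it is smooth in a smooth chart. -/
theorem contDiffAt_comp_symm (hF : IsImmersedHypersurface F)
    (he : IsCharacteristicField F U e) (hs : ContDiffOn ℝ ∞ (F ∘ φ.symm) φ.target)
    (hxU : φ.symm x ∈ U) : ContDiffAt ℝ ∞ (fun y => JL n (e (φ.symm y))) x := by
  have hG : ContDiffAt ℝ ∞ (F ∘ φ.symm) x := hs.contDiffAt (φ.open_target.mem_nhds hx)
  have hc : ContinuousAt φ.symm x := φ.symm.continuousAt hx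
  have hUev : ∀ᶠ y in nhds x, φ.symm y ∈ U := hc.eventually_mem (he.isOpen.mem_nhds hxU)
  have htev : ∀ᶠ y in nhds x, y ∈ φ.target := φ.open_target.mem_nhds hx
  set ν := horizontalVector (F (φ.symm x)) (J (e (φ.symm x))) with hν
  have hνmem : ν ∉ LinearMap.range (fderiv ℝ (F ∘ φ.symm) x).toLinearMap := by
    rintro ⟨a, ha⟩
    have h1 := (mem_tangentPlane_iff_fderiv hφ hx hF ν).2 ⟨a, ha⟩
    rw [he.mem_tangentPlane_iff hF hxU, hν, contactForm_horizontalVector, horizontalVector_fst,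
      inner_J_J, real_inner_self_eq_norm_sq, he.norm_eq_one _ hxU] at h1
    simp at h1
  obtain ⟨η, hη, hηev⟩ := exists_contDiffAt_conormal (by rw [finrank_heis]; simp) hG
    (fderiv_comp_symm_injective hφ hx hF) hνmem
  -- m represents the conormal η restricted to ξ in the left invariant frame.
  set m : EuclideanSpace ℝ (Fin (2 * n)) → Plane n := fun y =>
    rieszVector n ((η y).comp (ContinuousLinearMap.inl ℝ (Plane n) ℝ)) -
      (η y (0, 1)) • JL n (F (φ.symm y)).1 with hm
  have hms : ContDiffAt ℝ ∞ m x := by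
    refine ContDiffAt.sub ?_ ?_
    · exact (rieszVector n).contDiff.contDiffAt.comp x (hη.clm_comp contDiffAt_const)
    · exact (hη.clm_apply contDiffAt_const).smul
        ((JL n).contDiff.contDiffAt.comp x (contDiff_fst.contDiffAt.comp x hG))
  have hmv : ∀ y v, inner ℝ (m y) v = η y (horizontalVector (F (φ.symm y)) v) := by
    intro y v
    have h1 : horizontalVector (F (φ.symm y)) v = (v, (0 : ℝ)) +
        (-inner ℝ (J (F (φ.symm y)).1) v : ℝ) • ((0 : Plane n), (1 : ℝ)) := by
      rw [horizontalVector_apply]; ext <;> simp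
    rw [h1, map_add, map_smul]
    simp only [hm, inner_sub_left, inner_rieszVector, inner_smul_left, JL_apply, conj_trivial,
      smul_eq_mul]
    rw [ContinuousLinearMap.comp_apply, ContinuousLinearMap.inl_apply]
    ring
  -- Decomposing a horizontal vector as dF a + η(·)ν, the equation of TΣ reduces to η(·) times its
  -- value κ on the transverse vector ν.
  refine contDiffAt_of_eq_smul (m := m) (κ := fun y => inner ℝ (J (e (φ.symm y))) ν.1 -
    alpha F e (φ.symm y) * contactForm (F (φ.symm y)) ν) ?_ hms ?_ ?_
  · have h1 : ContinuousAt e (φ.symm x) :=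
      (he.contMDiffOn.continuousOn).continuousAt (he.isOpen.mem_nhds hxU)
    have h2 : ContinuousAt (e ∘ φ.symm) x := ContinuousAt.comp h1 hc
    exact (JL n).continuous.continuousAt.comp h2
  · filter_upwards [hUev] with y hy
    rw [JL_apply, norm_J, he.norm_eq_one _ hy]
  · filter_upwards [hUev, hηev, htev] with y hyU hyη hyt
    refine ext_inner_right ℝ fun v => ?_
    rw [inner_smul_left, hmv]
    obtain ⟨a, ha⟩ := hyη (horizontalVector (F (φ.symm y)) v)
    have h1 := (he.mem_tangentPlane_iff hF hyU _).1
      ((mem_tangentPlane_iff_fderiv hφ hyt hF _).2 ⟨a, rfl⟩)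
    rw [eq_sub_of_add_eq ha.symm, Prod.fst_sub, map_sub, contactForm_horizontalVector,
      horizontalVector_fst, inner_sub_right, Prod.smul_fst, inner_smul_right, map_smul] at h1
    simp only [smul_eq_mul, conj_trivial, JL_apply] at h1 ⊢
    linear_combination h1

end IsCharacteristicField

omit hx in
/-- In a smooth chart, the regular part of an umbilic hypersurface with `l = 2 k` is an umbilic
model. -/
theorem IsCharacteristicField.isUmbilicModel (hn : 2 ≤ n) (hF : IsImmersedHypersurface F)
    (humb : IsUmbilic F) (hlk : LEqTwoK F) (he : IsCharacteristicField F U e)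
    (hs : ContDiffOn ℝ ∞ (F ∘ φ.symm) φ.target) :
    IsUmbilicModel (JL n) (φ.target ∩ φ.symm ⁻¹' U) (fun y => (F (φ.symm y)).1)
      (fun y => (F (φ.symm y)).2) (fun y => JL n (e (φ.symm y))) (fun y => alpha F e (φ.symm y))
      (fun y => kCurv F e (φ.symm y)) := by
  have hJ := isOrthogonalComplexStructure_JL (n := n)
  -- The frame being parallel, on directions with θ = 0 the ordinary derivative of N in the chart is
  -- the covariant derivative that enters the umbilicity condition.
  have hcov : ∀ y ∈ φ.target ∩ φ.symm ⁻¹' U, ∀ a,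
      pullbackContact (JL n) (fun y => (F (φ.symm y)).1) (fun y => (F (φ.symm y)).2) y a = 0 →
      fderiv ℝ (fun y => (F (φ.symm y)).1) y a ∈ horizontalTangent F (φ.symm y) ∧
      fderiv ℝ (fun y => JL n (e (φ.symm y))) y a =
        covDeriv F (horizontalNormal e) (φ.symm y)
          (fderiv ℝ (fun y => (F (φ.symm y)).1) y a) := by
    intro y hy a ha
    have h1 := (exists_pullbackContact_iff hφ hy.1 hF _ _).1 ⟨a, rfl, ha⟩
    rw [zero_smul, add_zero] at h1
    refine ⟨h1, ?_⟩
    have h2 := differentiableAt_comp_symm hφ hy.1 (hF.mdifferentiableAt _)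
    have h3 := differentiableAt_comp_symm hφ hy.1
      (hasMFDerivAt_horizontalNormal he hy.2).mdifferentiableAt
    have h4 : fderiv ℝ (F ∘ φ.symm) y a = horizontalVector (F (φ.symm y))
        (fderiv ℝ (fun y => (F (φ.symm y)).1) y a) := by
      rw [pullbackContact_eq hφ hy.1 hF] at ha
      rw [(fderiv_fst_snd hφ hy.1 hF a).1]
      conv_lhs => rw [eq_horizontalVector_add (F (φ.symm y)) (fderiv ℝ (F ∘ φ.symm) y a)]
      rw [ha, zero_smul, add_zero]
    rw [covDeriv_eq hF ((h2.2 a).symm.trans h4), ← h3.2 a]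
    rfl
  refine ⟨φ.symm.isOpen_inter_preimage he.isOpen, contDiff_fst.comp_contDiffOn
    (hs.mono Set.inter_subset_left), contDiff_snd.comp_contDiffOn (hs.mono Set.inter_subset_left),
    fun y hy => (he.contDiffAt_comp_symm hφ hy.1 hF hs hy.2).contDiffWithinAt, ?_, ?_, ?_, ?_, ?_⟩
  · intro y hy
    rw [JL_apply, norm_J, he.norm_eq_one _ hy.2]
  · intro y hy v s
    rw [exists_pullbackContact_iff hφ hy.1 hF, he.mem_tangentPlane_iff hF hy.2, map_add, map_smul,
      contactForm_horizontalVector, contactForm_reeb]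
    simp [horizontalVector_fst, reeb, JL_apply]
  · intro y hy a ha hJa
    obtain ⟨h1, h2⟩ := hcov y hy a ha
    have h3 : inner ℝ (e (φ.symm y)) (fderiv ℝ (fun y => (F (φ.symm y)).1) y a) = 0 := by
      rw [hJ.sq, inner_neg_left] at hJa; linarith
    have h4 := he.shapeOperator_eq hn hF humb hy.2 ((he.mem_xiPrime_iff hF hy.2 _).2
      ⟨(he.mem_horizontalTangent_iff hF hy.2 _).1 h1, h3⟩)
    rw [shapeOperator, ← h2, JPrime, h3, zero_smul, sub_zero] at h4
    rw [neg_smul, ← h4, JL_apply]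
    abel
  · intro y hy a ha hJa
    obtain ⟨h1, h2⟩ := hcov y hy a ha
    have h3 := hlk U e he _ hy.2
    rw [hJ.sq, neg_neg] at hJa
    rw [hJa] at h2
    rw [lCurv, ← h2] at h3
    rw [hJ.sq, ← h3, inner_neg_left, inner_neg_right]
  · intro y hy
    obtain ⟨v, hv, hv0⟩ := he.exists_mem_xiPrime hn hF hy.2
    obtain ⟨h1, h2⟩ := (he.mem_xiPrime_iff hF hy.2 v).1 hv
    refine ⟨v, hv0, h1, ?_⟩
    rw [hJ.sq, inner_neg_left, h2, neg_zero]

end Hypersurface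

/-! ### First integrals and an a priori estimate -/

section StructureEquations

variable {E V : Type*} [NormedAddCommGroup E] [NormedSpace ℝ E]
  [NormedAddCommGroup V] [InnerProductSpace ℝ V]

theorem fderiv_inv_apply' {f : E → ℝ} {x : E} (hf : DifferentiableAt ℝ f x) (h0 : f x ≠ 0)
    (a : E) : fderiv ℝ (fun y => (f y)⁻¹) x a = -fderiv ℝ f x a * ((f x) ^ 2)⁻¹ := by
  have h1 := ((hasDerivAt_inv h0).comp_hasFDerivAt x hf.hasFDerivAt).fderiv
  simp only [Function.comp_def] at h1
  rw [h1, smul_apply, smul_eq_mul]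
  ring

/-- The closed first order system satisfied by `N`, `α`, `k` on an umbilic hypersurface with
`l = 2 k`. -/
structure StructureEquations (J : V →L[ℝ] V) (z : E → V) (t : E → ℝ) (N : E → V) (α k : E → ℝ)
    (x : E) : Prop where
  differentiableAt_z : DifferentiableAt ℝ z x
  differentiableAt_t : DifferentiableAt ℝ t x
  differentiableAt_N : DifferentiableAt ℝ N x
  differentiableAt_alpha : DifferentiableAt ℝ α x
  differentiableAt_k : DifferentiableAt ℝ k x
  norm_eq_one : ‖N x‖ = 1
  inner_z : ∀ a, inner ℝ (N x) (fderiv ℝ z x a) = α x * pullbackContact J z t x a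
  fderiv_k : ∀ a, fderiv ℝ k x a = 0
  fderiv_alpha : ∀ a, fderiv ℝ α x a = (k x ^ 2 + α x ^ 2) *
    (k x * pullbackContact J z t x a - charComponent J z N x a)
  fderiv_N : ∀ a, fderiv ℝ N x a =
    -k x • complexPart J z t N α x a + α x • J (complexPart J z t N α x a) +
      (2 * k x * charComponent J z N x a + (α x ^ 2 - k x ^ 2) * pullbackContact J z t x a) •
        J (N x)

/-- The center of the Pansu sphere tangent to second order to the hypersurface. -/
def sphereCenter {X : Type*} (J : V →L[ℝ] V) (z : X → V) (N : X → V) (α k : X → ℝ) (x : X) : V :=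
  z x + (k x ^ 2 + α x ^ 2)⁻¹ • (k x • N x + α x • J (N x))

/-- The height of a Pansu sphere as a function of `s = α / k`. -/
def profile (s : ℝ) : ℝ := Real.arctan s + s * (1 + s ^ 2)⁻¹

theorem hasDerivAt_profile (s : ℝ) : HasDerivAt profile (2 * ((1 + s ^ 2) ^ 2)⁻¹) s := by
  have hpos : (1 + s ^ 2) ≠ 0 := by positivity
  have h1 := (Real.hasDerivAt_arctan s).add ((hasDerivAt_id s).mul
    (((hasDerivAt_pow 2 s).const_add 1).inv hpos))
  refine h1.congr_deriv ?_
  simp only [id, Nat.cast_ofNat, Pi.inv_apply]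
  field_simp
  ring

/-- The height of the center of the Pansu sphere tangent to second order to the hypersurface. -/
def sphereHeight {X : Type*} (J : V →L[ℝ] V) (z : X → V) (t : X → ℝ) (N : X → V) (α k : X → ℝ)
    (x : X) : ℝ :=
  t x + inner ℝ (J (sphereCenter J z N α k x)) (z x) -
    (2 * k x ^ 2)⁻¹ * profile (α x * (k x)⁻¹)

namespace StructureEquations

variable {J : V →L[ℝ] V} {z : E → V} {t : E → ℝ} {N : E → V} {α k : E → ℝ} {x : E}
  (h : StructureEquations J z t N α k x) (hJ : IsOrthogonalComplexStructure J)
include h hJ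

/-- This is dC = 0 for the center C, with dk = 0 inserted and denominators cleared. In this form it
needs no nonvanishing assumption and also serves the estimate `norm_fderiv_le`. -/
theorem radial_identity (a : E) :
    (k x ^ 2 + α x ^ 2) • ((k x ^ 2 + α x ^ 2) • fderiv ℝ z x a + k x • fderiv ℝ N x a +
      α x • J (fderiv ℝ N x a) + fderiv ℝ α x a • J (N x)) =
    (2 * α x * fderiv ℝ α x a) • (k x • N x + α x • J (N x)) := by
  have hz : fderiv ℝ z x a = complexPart J z t N α x a - charComponent J z N x a • J (N x) +
      (α x * pullbackContact J z t x a) • N x := by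
    unfold complexPart; abel
  rw [h.fderiv_N a, h.fderiv_alpha a, hz]
  simp only [map_add, map_smul, hJ.sq]
  module

theorem fderiv_sphereCenter (h0 : k x ^ 2 + α x ^ 2 ≠ 0) :
    HasFDerivAt (sphereCenter J z N α k) (0 : E →L[ℝ] V) x := by
  have hN := h.differentiableAt_N
  have hJN : DifferentiableAt ℝ (fun y => J (N y)) x := J.differentiableAt.comp x hN
  have hk := h.differentiableAt_k
  have hα := h.differentiableAt_alpha
  have hD : DifferentiableAt ℝ (fun y => k y * k y + α y * α y) x := (hk.mul hk).add (hα.mul hα)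
  have h0' : k x * k x + α x * α x ≠ 0 := by rwa [← sq, ← sq]
  have h1 : DifferentiableAt ℝ (fun y => k y • N y) x := hk.smul hN
  have h2 : DifferentiableAt ℝ (fun y => α y • J (N y)) x := hα.smul hJN
  have h3 : DifferentiableAt ℝ (fun y => k y • N y + α y • J (N y)) x := h1.add h2
  have h4 : DifferentiableAt ℝ (fun y => (k y * k y + α y * α y)⁻¹) x := hD.inv h0'
  have h5 : DifferentiableAt ℝ
    (fun y => (k y * k y + α y * α y)⁻¹ • (k y • N y + α y • J (N y))) x := h4.smul h3
  have heq : sphereCenter J z N α k = fun y => z y +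
      (k y * k y + α y * α y)⁻¹ • (k y • N y + α y • J (N y)) := by
    funext y; simp only [sphereCenter, sq]
  have h6 := (h.differentiableAt_z.add h5).hasFDerivAt
  rw [heq]
  refine h6.congr_fderiv (ContinuousLinearMap.ext fun a => ?_)
  change fderiv ℝ (fun y => z y +
      (k y * k y + α y * α y)⁻¹ • (k y • N y + α y • J (N y))) x a = 0
  have hinv : fderiv ℝ (fun y => (k y * k y + α y * α y)⁻¹) x a =
      -(2 * α x * fderiv ℝ α x a) * ((k x ^ 2 + α x ^ 2) ^ 2)⁻¹ := by
    have hkk : DifferentiableAt ℝ (fun y => k y * k y) x := hk.mul hk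
    have hαα : DifferentiableAt ℝ (fun y => α y * α y) x := hα.mul hα
    rw [fderiv_inv_apply' hD h0', fderiv_fun_add hkk hαα, add_apply, fderiv_mul_apply' hk hk,
      fderiv_mul_apply' hα hα, h.fderiv_k a]
    ring
  rw [fderiv_fun_add h.differentiableAt_z h5, add_apply, fderiv_smul_apply' h4 h3, hinv,
    fderiv_fun_add h1 h2, add_apply, fderiv_smul_apply' hk hN, fderiv_smul_apply' hα hJN,
    fderiv_clm_comp_apply J hN, h.fderiv_k a]
  have key := h.radial_identity hJ a
  have h9 : ((k x ^ 2 + α x ^ 2) ^ 2) • (fderiv ℝ z x a +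
      ((k x * k x + α x * α x)⁻¹ • (k x • fderiv ℝ N x a + (0 : ℝ) • N x +
        (α x • J (fderiv ℝ N x a) + fderiv ℝ α x a • J (N x))) +
        (-(2 * α x * fderiv ℝ α x a) * ((k x ^ 2 + α x ^ 2) ^ 2)⁻¹) •
          (k x • N x + α x • J (N x)))) = 0 := by
    have e1 : (k x ^ 2 + α x ^ 2) ^ 2 * (k x * k x + α x * α x)⁻¹ = k x ^ 2 + α x ^ 2 := by
      rw [← sq, ← sq]; field_simp
    have e2 : (k x ^ 2 + α x ^ 2) ^ 2 * (-(2 * α x * fderiv ℝ α x a) *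
        ((k x ^ 2 + α x ^ 2) ^ 2)⁻¹) = -(2 * α x * fderiv ℝ α x a) := by
      field_simp
    rw [smul_add, smul_add, smul_smul, smul_smul, e1, e2, neg_smul, ← key]
    module
  exact (smul_eq_zero.1 h9).resolve_left (pow_ne_zero 2 h0)

/-- Since C is constant, dt + ⟨JC, dz⟩ = θ + ⟨J(C - z), dz⟩ = k(kθ - ω)/(k² + α²). The profile is
the primitive whose differential along Σ is the same expression. -/
theorem fderiv_sphereHeight (hk0 : k x ≠ 0) :
    HasFDerivAt (sphereHeight J z t N α k) (0 : E →L[ℝ] ℝ) x := by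
  have hD0 : k x ^ 2 + α x ^ 2 ≠ 0 := by positivity
  have hk := h.differentiableAt_k
  have hα := h.differentiableAt_alpha
  have hC := h.fderiv_sphereCenter hJ hD0
  have hJC : HasFDerivAt (fun y => J (sphereCenter J z N α k y)) (0 : E →L[ℝ] V) x := by
    have := J.hasFDerivAt.comp x hC
    rwa [ContinuousLinearMap.comp_zero] at this
  have hin := hJC.differentiableAt.inner ℝ h.differentiableAt_z
  have hk2 : DifferentiableAt ℝ (fun y => (2 * k y ^ 2)⁻¹) x :=
    ((hk.pow 2).const_mul 2).inv (by simp [hk0])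
  have hki : DifferentiableAt ℝ (fun y => (k y)⁻¹) x := hk.inv hk0
  have hs : DifferentiableAt ℝ (fun y => α y * (k y)⁻¹) x := hα.mul hki
  have hp := (hasDerivAt_profile (α x * (k x)⁻¹)).comp_hasFDerivAt x hs.hasFDerivAt
  simp only [Function.comp_def] at hp
  have htot : DifferentiableAt ℝ (sphereHeight J z t N α k) x :=
    (h.differentiableAt_t.add hin).sub (hk2.mul hp.differentiableAt)
  refine htot.hasFDerivAt.congr_fderiv (ContinuousLinearMap.ext fun a => ?_)
  have hk2' : fderiv ℝ (fun y => (2 * k y ^ 2)⁻¹) x a = 0 := by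
    have h1 : DifferentiableAt ℝ (fun y => k y * k y) x := hk.mul hk
    have h2 : (fun y => (2 * k y ^ 2)⁻¹) = fun y => (2 * (k y * k y))⁻¹ := by
      funext y; rw [sq]
    rw [h2, fderiv_inv_apply' (h1.const_mul 2) (by simp [hk0]), fderiv_const_mul h1, smul_apply,
      fderiv_mul_apply' hk hk, h.fderiv_k]
    simp
  have hki' : fderiv ℝ (fun y => (k y)⁻¹) x a = 0 := by
    rw [fderiv_inv_apply' hk hk0, h.fderiv_k]; simp
  have hpa : fderiv ℝ (fun y => profile (α y * (k y)⁻¹)) x a =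
      2 * ((1 + (α x * (k x)⁻¹) ^ 2) ^ 2)⁻¹ * (fderiv ℝ α x a * (k x)⁻¹) := by
    rw [hp.fderiv, smul_apply, fderiv_mul_apply' hα hki, hki', smul_eq_mul]; ring
  have hexp : fderiv ℝ (sphereHeight J z t N α k) x a =
      fderiv ℝ t x a + inner ℝ (J (sphereCenter J z N α k x)) (fderiv ℝ z x a) -
        (2 * k x ^ 2)⁻¹ * fderiv ℝ (fun y => profile (α y * (k y)⁻¹)) x a := by
    have e1 : DifferentiableAt ℝ
        (fun y => t y + inner ℝ (J (sphereCenter J z N α k y)) (z y)) x :=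
      h.differentiableAt_t.add hin
    have e2 : DifferentiableAt ℝ
        (fun y => (2 * k y ^ 2)⁻¹ * profile (α y * (k y)⁻¹)) x := hk2.mul hp.differentiableAt
    unfold sphereHeight
    rw [fderiv_fun_sub e1 e2, sub_apply,
      fderiv_fun_add h.differentiableAt_t hin, add_apply, fderiv_inner_apply ℝ
      hJC.differentiableAt h.differentiableAt_z, fderiv_mul_apply' hk2 hp.differentiableAt, hk2',
      hJC.fderiv, zero_apply, inner_zero_left]
    ring
  have hθ : fderiv ℝ t x a = pullbackContact J z t x a - inner ℝ (J (z x)) (fderiv ℝ z x a) := by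
    unfold pullbackContact; ring
  have hω : inner ℝ (J (N x)) (fderiv ℝ z x a) = -charComponent J z N x a := by
    unfold charComponent; ring
  rw [hexp, hpa, hθ, h.fderiv_alpha a, sphereCenter]
  simp only [map_add, map_smul, hJ.sq, inner_add_left, inner_smul_left, inner_neg_left, hω,
    h.inner_z a, conj_trivial, zero_apply]
  field_simp
  ring

/-- The intended μ satisfies ⟨μ, dz⟩ = θ; it remains C¹ at singular points, where α blows up, so the
constant must not depend on k or α. Differentiating N = αμ with |N| = 1 gives |dα| ≤ α²|dμ| and |dN|
≤ 2|α||dμ|. With D = k² + α², `radial_identity` then bounds D²|dz| by (4 + 5) D²|dμ|, because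
|α|(|k| + |α|) ≤ 2D and α² ≤ D. -/
theorem norm_fderiv_le {μ : E → V} (hμ : DifferentiableAt ℝ μ x)
    (hev : ∀ᶠ y in nhds x, N y = α y • μ y) (h1 : ∀ᶠ y in nhds x, ‖N y‖ = 1) (a : E) :
    ‖fderiv ℝ z x a‖ ≤ 9 * ‖fderiv ℝ μ x a‖ := by
  have hJn : ∀ v, ‖J v‖ = ‖v‖ := fun v => by
    rw [← sq_eq_sq₀ (norm_nonneg _) (norm_nonneg _), ← real_inner_self_eq_norm_sq,
      ← real_inner_self_eq_norm_sq, hJ.inner_map]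
  have hα := h.differentiableAt_alpha
  have hN := h.differentiableAt_N
  have hNx := hev.self_of_nhds
  have hN1 := h.norm_eq_one
  have hα0 : α x ≠ 0 := by
    intro h0; rw [hNx, h0] at hN1; simp at hN1
  set d := ‖fderiv ℝ μ x a‖ with hd
  have hdN : fderiv ℝ N x a = α x • fderiv ℝ μ x a + fderiv ℝ α x a • μ x := by
    have h2 : N =ᶠ[nhds x] fun y => α y • μ y := hev
    rw [h2.fderiv_eq, fderiv_smul_apply' hα hμ]
  have horth : inner ℝ (N x) (fderiv ℝ N x a) = 0 := by
    have h2 : (fun y => inner ℝ (N y) (N y)) =ᶠ[nhds x] fun _ => (1 : ℝ) := by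
      filter_upwards [h1] with y hy
      rw [real_inner_self_eq_norm_sq, hy]; norm_num
    have h3 := congrArg (fun L : E →L[ℝ] ℝ => L a) h2.fderiv_eq
    simp only [fderiv_inner_apply ℝ hN hN] at h3
    rw [real_inner_comm (N x) (fderiv ℝ N x a)] at h3
    simp at h3
    linarith
  have hNN : α x * inner ℝ (N x) (μ x) = 1 := by
    have : inner ℝ (N x) (N x) = (1 : ℝ) := by rw [real_inner_self_eq_norm_sq, hN1]; norm_num
    nth_rewrite 2 [hNx] at this
    rwa [inner_smul_right] at this
  have hαa : fderiv ℝ α x a = -α x ^ 2 * inner ℝ (N x) (fderiv ℝ μ x a) := by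
    rw [hdN, inner_add_right, inner_smul_right, inner_smul_right] at horth
    linear_combination α x * horth - fderiv ℝ α x a * hNN
  have hαa' : |fderiv ℝ α x a| ≤ α x ^ 2 * d := by
    rw [hαa, abs_mul, abs_neg, abs_of_nonneg (sq_nonneg _)]
    refine mul_le_mul_of_nonneg_left ?_ (sq_nonneg _)
    have := abs_real_inner_le_norm (N x) (fderiv ℝ μ x a)
    rwa [hN1, one_mul] at this
  have hμn : |α x| * ‖μ x‖ = 1 := by
    rw [← Real.norm_eq_abs, ← norm_smul, ← hNx, hN1]
  have hA : 0 < |α x| := abs_pos.2 hα0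
  have hsq : α x ^ 2 = |α x| ^ 2 := (sq_abs _).symm
  have hksq : k x ^ 2 = |k x| ^ 2 := (sq_abs _).symm
  have hdn : 0 ≤ d := norm_nonneg _
  have hdN' : ‖fderiv ℝ N x a‖ ≤ 2 * |α x| * d := by
    rw [hdN]
    refine (norm_add_le _ _).trans ?_
    rw [norm_smul, norm_smul, Real.norm_eq_abs, Real.norm_eq_abs, ← hd]
    have : |fderiv ℝ α x a| * ‖μ x‖ ≤ α x ^ 2 * d * ‖μ x‖ :=
      mul_le_mul_of_nonneg_right hαa' (norm_nonneg _)
    have h5 : α x ^ 2 * d * ‖μ x‖ = |α x| * d := by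
      rw [hsq]; linear_combination |α x| * d * hμn
    linarith
  set D := k x ^ 2 + α x ^ 2 with hD
  have hDpos : 0 < D := by positivity
  have key := h.radial_identity hJ a
  have key2 : (D * D) • fderiv ℝ z x a = (2 * α x * fderiv ℝ α x a) • (k x • N x + α x • J (N x)) -
      D • (k x • fderiv ℝ N x a + α x • J (fderiv ℝ N x a) + fderiv ℝ α x a • J (N x)) := by
    rw [← key]; module
  have hn1 : ‖k x • N x + α x • J (N x)‖ ≤ |k x| + |α x| := by
    refine (norm_add_le _ _).trans ?_
    rw [norm_smul, norm_smul, hJn, hN1, Real.norm_eq_abs, Real.norm_eq_abs, mul_one, mul_one]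
  have hn2 : ‖k x • fderiv ℝ N x a + α x • J (fderiv ℝ N x a) + fderiv ℝ α x a • J (N x)‖ ≤
      (|k x| + |α x|) * (2 * |α x| * d) + α x ^ 2 * d := by
    refine (norm_add_le _ _).trans (add_le_add ((norm_add_le _ _).trans ?_) ?_)
    · rw [norm_smul, norm_smul, hJn, Real.norm_eq_abs, Real.norm_eq_abs, ← add_mul]
      exact mul_le_mul_of_nonneg_left hdN' (by positivity)
    · rw [norm_smul, hJn, hN1, mul_one]; exact hαa'
  have hn3 : D * D * ‖fderiv ℝ z x a‖ ≤ 2 * |α x| * (α x ^ 2 * d) * (|k x| + |α x|) +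
      D * ((|k x| + |α x|) * (2 * |α x| * d) + α x ^ 2 * d) := by
    have h6 : D * D * ‖fderiv ℝ z x a‖ = ‖(D * D) • fderiv ℝ z x a‖ := by
      rw [norm_smul, Real.norm_eq_abs, abs_of_pos (mul_pos hDpos hDpos)]
    rw [h6, key2]
    refine (norm_sub_le _ _).trans (add_le_add ?_ ?_)
    · rw [norm_smul, Real.norm_eq_abs, abs_mul, abs_mul, abs_two]
      have := mul_le_mul_of_nonneg_left hαa' (show 0 ≤ 2 * |α x| by positivity)
      exact mul_le_mul this hn1 (norm_nonneg _) (by positivity)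
    · rw [norm_smul, Real.norm_eq_abs, abs_of_pos hDpos]
      exact mul_le_mul_of_nonneg_left hn2 hDpos.le
  have hm1 : |α x| * (|k x| + |α x|) ≤ 2 * D := by
    rw [hD, hsq, hksq]; nlinarith [sq_nonneg (|k x| - |α x|), sq_nonneg |k x|]
  have hm2 : α x ^ 2 ≤ D := by rw [hD]; nlinarith [sq_nonneg (k x)]
  have hn4 : D * D * ‖fderiv ℝ z x a‖ ≤ D * D * (9 * d) := by
    have e1 : 2 * |α x| * (α x ^ 2 * d) * (|k x| + |α x|) ≤ 4 * (D * D) * d := by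
      have := mul_le_mul hm1 hm2 (sq_nonneg _) (by positivity)
      have := mul_le_mul_of_nonneg_right this hdn
      linarith
    have e2 : D * ((|k x| + |α x|) * (2 * |α x| * d) + α x ^ 2 * d) ≤ D * (5 * D * d) := by
      refine mul_le_mul_of_nonneg_left ?_ hDpos.le
      have h7 := mul_le_mul_of_nonneg_right hm1 hdn
      have h8 := mul_le_mul_of_nonneg_right hm2 hdn
      linarith
    linarith
  exact le_of_mul_le_mul_left hn4 (mul_pos hDpos hDpos)

/-- When `k = 0`, the Euclidean conormal only changes by a factor. -/
theorem fderiv_conormal (hk0 : k x = 0) (a : E) :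
    DifferentiableAt ℝ (fun y => N y - α y • J (z y)) x ∧
    fderiv ℝ (fun y => N y - α y • J (z y)) x a =
      -(α x * charComponent J z N x a) • (N x - α x • J (z x)) ∧
    fderiv ℝ α x a = -(α x * charComponent J z N x a) * α x := by
  have hJz : DifferentiableAt ℝ (fun y => J (z y)) x :=
    J.differentiableAt.comp x h.differentiableAt_z
  have hα := h.differentiableAt_alpha
  have h1 : DifferentiableAt ℝ (fun y => α y • J (z y)) x := hα.smul hJz
  have h2 : fderiv ℝ α x a = -(α x * charComponent J z N x a) * α x := by
    rw [h.fderiv_alpha, hk0]; ring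
  refine ⟨h.differentiableAt_N.sub h1, ?_, h2⟩
  rw [fderiv_fun_sub h.differentiableAt_N h1, sub_apply, fderiv_smul_apply' hα hJz,
    fderiv_clm_comp_apply J h.differentiableAt_z, h2, h.fderiv_N, hk0]
  unfold complexPart
  simp only [map_sub, map_add, map_smul, hJ.sq]
  module

/-- The squared pairing of the conormal (N - αJz, -α) with (w, s), divided by the squared length of
the conormal, is insensitive to the factor by which the conormal changes. -/
theorem fderiv_conormal_ratio (hk0 : k x = 0) (w : V) (s : ℝ) :
    0 < ‖N x - α x • J (z x)‖ ^ 2 + α x ^ 2 ∧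
    HasFDerivAt (fun y => (inner ℝ (N y - α y • J (z y)) w - α y * s) ^ 2 *
      (‖N y - α y • J (z y)‖ ^ 2 + α y ^ 2)⁻¹) (0 : E →L[ℝ] ℝ) x := by
  have hα := h.differentiableAt_alpha
  set f : E → V := fun y => N y - α y • J (z y) with hf
  have hfd : DifferentiableAt ℝ f x := (h.fderiv_conormal hJ hk0 0).1
  have hpos : 0 < ‖f x‖ ^ 2 + α x ^ 2 := by
    by_cases hα0 : α x = 0
    · have : f x = N x := by simp [hf, hα0]
      rw [this, h.norm_eq_one, hα0]; norm_num
    · positivity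
  refine ⟨hpos, ?_⟩
  have hw : DifferentiableAt ℝ (fun y => inner ℝ (f y) w) x :=
    hfd.inner ℝ (differentiableAt_const w)
  have hs : DifferentiableAt ℝ (fun y => α y * s) x := hα.mul_const s
  have hg : DifferentiableAt ℝ (fun y => inner ℝ (f y) w - α y * s) x := hw.sub hs
  have hff : DifferentiableAt ℝ (fun y => inner ℝ (f y) (f y)) x := hfd.inner ℝ hfd
  have hρ : DifferentiableAt ℝ (fun y => inner ℝ (f y) (f y) + α y * α y) x :=
    hff.add (hα.mul hα)
  have hpos' : inner ℝ (f x) (f x) + α x * α x ≠ 0 := by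
    rw [real_inner_self_eq_norm_sq, ← sq]; exact hpos.ne'
  have heq : (fun y => (inner ℝ (f y) w - α y * s) ^ 2 * (‖f y‖ ^ 2 + α y ^ 2)⁻¹) =
      fun y => ((inner ℝ (f y) w - α y * s) * (inner ℝ (f y) w - α y * s)) *
        (inner ℝ (f y) (f y) + α y * α y)⁻¹ := by
    funext y
    rw [real_inner_self_eq_norm_sq, sq, sq (α y)]
  have hgg : DifferentiableAt ℝ
      (fun y => (inner ℝ (f y) w - α y * s) * (inner ℝ (f y) w - α y * s)) x := hg.mul hg
  have hρi : DifferentiableAt ℝ (fun y => (inner ℝ (f y) (f y) + α y * α y)⁻¹) x := hρ.inv hpos'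
  change HasFDerivAt (fun y => (inner ℝ (f y) w - α y * s) ^ 2 * (‖f y‖ ^ 2 + α y ^ 2)⁻¹) _ x
  rw [heq]
  refine (hgg.mul hρi).hasFDerivAt.congr_fderiv (ContinuousLinearMap.ext fun a => ?_)
  obtain ⟨-, e1, e2⟩ := h.fderiv_conormal hJ hk0 a
  have hga : fderiv ℝ (fun y => inner ℝ (f y) w - α y * s) x a =
      -(α x * charComponent J z N x a) * (inner ℝ (f x) w - α x * s) := by
    rw [fderiv_fun_sub hw hs, sub_apply, fderiv_inner_apply ℝ hfd (differentiableAt_const w),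
      fderiv_mul_const hα, e1, smul_apply, e2, inner_smul_left]
    simp
    ring
  have hρa : fderiv ℝ (fun y => inner ℝ (f y) (f y) + α y * α y) x a =
      -(2 * (α x * charComponent J z N x a)) * (inner ℝ (f x) (f x) + α x * α x) := by
    have hαα : DifferentiableAt ℝ (fun y => α y * α y) x := hα.mul hα
    rw [fderiv_fun_add hff hαα, add_apply, fderiv_inner_apply ℝ hfd hfd,
      fderiv_mul_apply' hα hα, e1, e2, inner_smul_left, inner_smul_right]
    simp only [conj_trivial]
    ring
  have hinv : fderiv ℝ (fun y => (inner ℝ (f y) (f y) + α y * α y)⁻¹) x a =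
      2 * (α x * charComponent J z N x a) * (inner ℝ (f x) (f x) + α x * α x)⁻¹ := by
    rw [fderiv_inv_apply' hρ hpos', hρa]
    field_simp
  change fderiv ℝ (fun y => ((inner ℝ (f y) w - α y * s) * (inner ℝ (f y) w - α y * s)) *
        (inner ℝ (f y) (f y) + α y * α y)⁻¹) x a = 0
  rw [fderiv_mul_apply' hgg hρi, fderiv_mul_apply' hg hg, hga, hinv]
  ring

end StructureEquations

end StructureEquations

/-! ### Local constancy of the invariants on the regular part -/

section Hypersurface

variable {n : ℕ} {M : Type*} [TopologicalSpace M]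
  [ChartedSpace (EuclideanSpace ℝ (Fin (2 * n))) M] [IsManifold (𝓡 (2 * n)) 2 M]
  {F : M → Heis n} {U U' : Set M} {e e' : M → Plane n}

theorem IsCharacteristicField.structureEquations (hn : 2 ≤ n) (hF : IsImmersedHypersurface F)
    (humb : IsUmbilic F) (hlk : LEqTwoK F) (he : IsCharacteristicField F U e)
    {φ : OpenPartialHomeomorph M (EuclideanSpace ℝ (Fin (2 * n)))}
    (hφ : φ ∈ IsManifold.maximalAtlas (𝓡 (2 * n)) 2 M)
    {x : EuclideanSpace ℝ (Fin (2 * n))} (hx : x ∈ φ.target) (hxU : φ.symm x ∈ U) :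
    StructureEquations (JL n) (fun y => (F (φ.symm y)).1) (fun y => (F (φ.symm y)).2)
      (fun y => JL n (e (φ.symm y))) (fun y => alpha F e (φ.symm y))
      (fun y => kCurv F e (φ.symm y)) x := by
  obtain ⟨ψ, hψ, hxψ, hs⟩ := hF.smooth_regularPart _ (he.subset_regularPart hxU)
  have hm := he.isUmbilicModel hψ hn hF humb hlk hs
  have hinv : ψ.symm (ψ (φ.symm x)) = φ.symm x := ψ.left_inv hxψ
  have hy : ψ (φ.symm x) ∈ ψ.target ∩ ψ.symm ⁻¹' U :=
    ⟨ψ.map_source hxψ, by rw [Set.mem_preimage, hinv]; exact hxU⟩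
  have hJ := isOrthogonalComplexStructure_JL (n := n)
  set D := fderiv ℝ (ψ ∘ φ.symm) x with hD
  have hz := differentiableAt_comp_symm_of_chart (f := fun q => (F q).1) hφ hψ hx hxψ
    (IsUmbilicModel.differentiableAt_of_contDiffOn hm.isOpen hm.contDiffOn_z hy)
  have ht := differentiableAt_comp_symm_of_chart (f := fun q => (F q).2) hφ hψ hx hxψ
    (IsUmbilicModel.differentiableAt_of_contDiffOn hm.isOpen hm.contDiffOn_t hy)
  have hN := differentiableAt_comp_symm_of_chart (f := fun q => JL n (e q)) hφ hψ hx hxψ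
    (IsUmbilicModel.differentiableAt_of_contDiffOn hm.isOpen hm.contDiffOn_N hy)
  have hα := differentiableAt_comp_symm_of_chart (f := fun q => alpha F e q) hφ hψ hx hxψ
    (hm.alpha_diff hy)
  have hk := differentiableAt_comp_symm_of_chart (f := fun q => kCurv F e q) hφ hψ hx hxψ
    (hm.k_diff hJ hy)
  simp only [Function.comp_def] at hz ht hN hα hk
  have hθ : ∀ a, pullbackContact (JL n) (fun y => (F (φ.symm y)).1)
      (fun y => (F (φ.symm y)).2) x a = pullbackContact (JL n) (fun y => (F (ψ.symm y)).1)
      (fun y => (F (ψ.symm y)).2) (ψ (φ.symm x)) (D a) := by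
    intro a
    simp only [pullbackContact, hz.2 a, ht.2 a, hinv]
    rfl
  have hω : ∀ a, charComponent (JL n) (fun y => (F (φ.symm y)).1)
      (fun y => JL n (e (φ.symm y))) x a = charComponent (JL n) (fun y => (F (ψ.symm y)).1)
      (fun y => JL n (e (ψ.symm y))) (ψ (φ.symm x)) (D a) := by
    intro a
    simp only [charComponent, hz.2 a, hinv]
    rfl
  have hP : ∀ a, complexPart (JL n) (fun y => (F (φ.symm y)).1) (fun y => (F (φ.symm y)).2)
      (fun y => JL n (e (φ.symm y))) (fun y => alpha F e (φ.symm y)) x a =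
      complexPart (JL n) (fun y => (F (ψ.symm y)).1) (fun y => (F (ψ.symm y)).2)
      (fun y => JL n (e (ψ.symm y))) (fun y => alpha F e (ψ.symm y)) (ψ (φ.symm x)) (D a) := by
    intro a
    simp only [complexPart, hz.2 a, hω, hθ, hinv]
    rfl
  have hS := fun a => hm.structure_equations hJ hy (D a)
  simp only [hinv] at hS
  refine ⟨hz.1, ht.1, hN.1, hα.1, hk.1, ?_, ?_, ?_, ?_, ?_⟩
  · rw [JL_apply, norm_J, he.norm_eq_one _ hxU]
  · intro a
    have := hm.inner_N_z hy (D a)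
    simp only [hinv] at this
    rw [hθ, ← this, hz.2 a]; rfl
  · intro a
    rw [hk.2 a]; exact (hS a).2.2.1
  · intro a
    rw [hα.2 a, hθ, hω]; exact (hS a).2.2.2.1
  · intro a
    rw [hN.2 a, hP, hω, hθ]; exact (hS a).2.2.2.2

/-- A function with vanishing differential on an open set is constant near each of its points. -/
theorem exists_nhds_forall_eq {O : Set M} (hO : IsOpen O) {p : M} (hp : p ∈ O) (W : Type*)
    [NormedAddCommGroup W] [NormedSpace ℝ W] :
    ∃ V ∈ nhds p, V ⊆ O ∧ ∀ f : M → W,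
      (∀ φ ∈ IsManifold.maximalAtlas (𝓡 (2 * n)) 2 M, ∀ x ∈ φ.target, φ.symm x ∈ O →
        HasFDerivAt (fun y => f (φ.symm y)) (0 : EuclideanSpace ℝ (Fin (2 * n)) →L[ℝ] W) x) →
      ∀ q ∈ V, f q = f p := by
  set φ := chartAt (EuclideanSpace ℝ (Fin (2 * n))) p with hφdef
  have hφ : φ ∈ IsManifold.maximalAtlas (𝓡 (2 * n)) 2 M := IsManifold.chart_mem_maximalAtlas p
  have hps : p ∈ φ.source := mem_chart_source _ p
  have hinv : φ.symm (φ p) = p := φ.left_inv hps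
  have hopen : IsOpen (φ.target ∩ φ.symm ⁻¹' O) := φ.symm.isOpen_inter_preimage hO
  obtain ⟨r, hr, hball⟩ := Metric.isOpen_iff.1 hopen (φ p)
    ⟨φ.map_source hps, by rw [Set.mem_preimage, hinv]; exact hp⟩
  refine ⟨φ.source ∩ φ ⁻¹' Metric.ball (φ p) r,
    (φ.isOpen_inter_preimage Metric.isOpen_ball).mem_nhds ⟨hps, Metric.mem_ball_self hr⟩, ?_, ?_⟩
  · rintro q ⟨hq, hqb⟩
    have := (hball hqb).2
    rwa [Set.mem_preimage, φ.left_inv hq] at this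
  · rintro f hf q ⟨hq, hqb⟩
    have hd : ∀ y ∈ Metric.ball (φ p) r, HasFDerivAt (fun y => f (φ.symm y))
        (0 : EuclideanSpace ℝ (Fin (2 * n)) →L[ℝ] W) y :=
      fun y hy => hf φ hφ y (hball hy).1 (hball hy).2
    have := Metric.isOpen_ball.is_const_of_fderiv_eq_zero (𝕜 := ℝ)
      (convex_ball (φ p) r).isPreconnected
      (fun y hy => (hd y hy).differentiableAt.differentiableWithinAt)
      (fun y hy => (hd y hy).fderiv) hqb (Metric.mem_ball_self hr)
    simpa only [φ.left_inv hq, hinv] using this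

namespace IsCharacteristicField

variable (hn : 2 ≤ n) (hF : IsImmersedHypersurface F) (humb : IsUmbilic F) (hlk : LEqTwoK F)
  (he : IsCharacteristicField F U e)
include hn hF humb hlk he

theorem eventually_kCurv_eq {p : M} (hp : p ∈ U) :
    ∀ᶠ q in nhds p, kCurv F e q = kCurv F e p := by
  obtain ⟨V, hV, -, h⟩ := exists_nhds_forall_eq (n := n) he.isOpen hp ℝ
  filter_upwards [hV] with q hq
  refine h (fun q => kCurv F e q) (fun φ hφ x hx hxU => ?_) q hq
  have hs := he.structureEquations hn hF humb hlk hφ hx hxU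
  exact hs.differentiableAt_k.hasFDerivAt.congr_fderiv (ContinuousLinearMap.ext hs.fderiv_k)

theorem eventually_center_eq (hk : ∀ q ∈ U, kCurv F e q ≠ 0) {p : M} (hp : p ∈ U) :
    ∀ᶠ q in nhds p,
      sphereCenter (JL n) (fun q => (F q).1) (fun q => JL n (e q)) (alpha F e) (kCurv F e) q =
      sphereCenter (JL n) (fun q => (F q).1) (fun q => JL n (e q)) (alpha F e) (kCurv F e) p := by
  obtain ⟨V, hV, -, h⟩ := exists_nhds_forall_eq (n := n) he.isOpen hp (Plane n)
  filter_upwards [hV] with q hq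
  refine h _ (fun φ hφ x hx hxU => ?_) q hq
  have hs := he.structureEquations hn hF humb hlk hφ hx hxU
  have := hk _ hxU
  exact hs.fderiv_sphereCenter isOrthogonalComplexStructure_JL (by positivity)

theorem eventually_height_eq (hk : ∀ q ∈ U, kCurv F e q ≠ 0) {p : M} (hp : p ∈ U) :
    ∀ᶠ q in nhds p,
      sphereHeight (JL n) (fun q => (F q).1) (fun q => (F q).2) (fun q => JL n (e q)) (alpha F e)
        (kCurv F e) q =
      sphereHeight (JL n) (fun q => (F q).1) (fun q => (F q).2) (fun q => JL n (e q)) (alpha F e)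
        (kCurv F e) p := by
  obtain ⟨V, hV, -, h⟩ := exists_nhds_forall_eq (n := n) he.isOpen hp ℝ
  filter_upwards [hV] with q hq
  refine h _ (fun φ hφ x hx hxU => ?_) q hq
  have hs := he.structureEquations hn hF humb hlk hφ hx hxU
  exact hs.fderiv_sphereHeight isOrthogonalComplexStructure_JL (hk _ hxU)

theorem eventually_tangentPlane_eq (hk : ∀ q ∈ U, kCurv F e q = 0) {p : M} (hp : p ∈ U) :
    ∀ᶠ q in nhds p, tangentPlane F q = tangentPlane F p := by
  -- V is fixed before the function, so a single neighbourhood serves every vector w tested for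
  -- tangency.
  obtain ⟨V, hV, hVU, h⟩ := exists_nhds_forall_eq (n := n) he.isOpen hp ℝ
  have hJ := isOrthogonalComplexStructure_JL (n := n)
  set f : M → Plane n := fun q => JL n (e q) - alpha F e q • JL n (F q).1 with hf
  have hpos : ∀ q ∈ U, 0 < ‖f q‖ ^ 2 + alpha F e q ^ 2 := by
    intro q hq
    by_cases hα0 : alpha F e q = 0
    · have : f q = JL n (e q) := by simp [hf, hα0]
      rw [this, JL_apply, norm_J, he.norm_eq_one _ hq, hα0]; norm_num
    · positivity
  have hmem : ∀ q ∈ U, ∀ w, w ∈ tangentPlane F q ↔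
      (inner ℝ (f q) w.1 - alpha F e q * w.2) ^ 2 * (‖f q‖ ^ 2 + alpha F e q ^ 2)⁻¹ = 0 := by
    intro q hq w
    rw [he.mem_tangentPlane_iff hF hq, mul_eq_zero, or_iff_left (inv_ne_zero (hpos q hq).ne'),
      sq_eq_zero_iff, sub_eq_zero, contactForm_apply, hf, inner_sub_left, inner_smul_left,
      JL_apply, JL_apply, conj_trivial, sub_eq_iff_eq_add, mul_add]
  filter_upwards [hV] with q hq
  ext w
  rw [hmem q (hVU hq), hmem p hp]
  have := h (fun q => (inner ℝ (f q) w.1 - alpha F e q * w.2) ^ 2 *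
    (‖f q‖ ^ 2 + alpha F e q ^ 2)⁻¹) (fun φ hφ x hx hxU => ?_) q hq
  · rw [this]
  · have hs := he.structureEquations hn hF humb hlk hφ hx hxU
    exact (hs.fderiv_conormal_ratio hJ (hk _ hxU) w.1 w.2).2

end IsCharacteristicField

section Invariants

variable {Y : Type*}

omit [IsManifold (𝓡 (2 * n)) 2 M] in
/-- A quantity that does not depend on the choice of the characteristic field defines a function
on the hypersurface. -/
theorem exists_eq_of_sign_invariant (Q : (M → Plane n) → M → Y)
    (hQ : ∀ (U U' : Set M) (e e' : M → Plane n), IsCharacteristicField F U e →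
      IsCharacteristicField F U' e' → ∀ p ∈ U, p ∈ U' → Q e p = Q e' p) :
    ∃ g : M → Y, ∀ (U : Set M) (e : M → Plane n), IsCharacteristicField F U e → ∀ p ∈ U,
      Q e p = g p := by
  classical
  refine ⟨fun p => if h : ∃ e U, IsCharacteristicField F U e ∧ p ∈ U then Q h.choose p
    else Q 0 p, fun U e he p hp => ?_⟩
  have h : ∃ e U, IsCharacteristicField F U e ∧ p ∈ U := ⟨e, U, he, hp⟩
  simp only [dif_pos h]
  obtain ⟨U', he', hp'⟩ := h.choose_spec
  exact hQ U U' e _ he he' p hp hp'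

variable (hn : 2 ≤ n) (hF : IsImmersedHypersurface F) (humb : IsUmbilic F)
include hn hF humb

omit [IsManifold (𝓡 (2 * n)) 2 M] in
theorem exists_abs_kCurv : ∃ g : M → ℝ, ∀ (U : Set M) (e : M → Plane n),
    IsCharacteristicField F U e → ∀ p ∈ U, |kCurv F e p| = g p := by
  refine exists_eq_of_sign_invariant (fun e p => |kCurv F e p|)
    fun U U' e e' he he' p hp hp' => ?_
  obtain ⟨c, hcc, hc⟩ := he.eventually_eq_smul hF he' hp hp'
  have h1 : |c| = 1 := by rcases mul_self_eq_one_iff.1 hcc with h | h <;> rw [h] <;> simp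
  rw [he.kCurv_smul hn hF humb he' hp hp' hcc hc, abs_mul, h1, one_mul]

omit [IsManifold (𝓡 (2 * n)) 2 M] in
-- Replacing e by -e flips N, α and k together; only kN, αJN, k², α² and α/k enter the center and
-- the height.
theorem exists_center : ∃ g : M → Plane n × ℝ, ∀ (U : Set M) (e : M → Plane n),
    IsCharacteristicField F U e → ∀ p ∈ U,
    (sphereCenter (JL n) (fun q => (F q).1) (fun q => JL n (e q)) (alpha F e) (kCurv F e) p,
      sphereHeight (JL n) (fun q => (F q).1) (fun q => (F q).2) (fun q => JL n (e q)) (alpha F e)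
        (kCurv F e) p) = g p := by
  refine exists_eq_of_sign_invariant (fun e p =>
    (sphereCenter (JL n) (fun q => (F q).1) (fun q => JL n (e q)) (alpha F e) (kCurv F e) p,
      sphereHeight (JL n) (fun q => (F q).1) (fun q => (F q).2) (fun q => JL n (e q)) (alpha F e)
        (kCurv F e) p)) fun U U' e e' he he' p hp hp' => ?_
  obtain ⟨c, hcc, hc⟩ := he.eventually_eq_smul hF he' hp hp'
  have h1 := he.kCurv_smul hn hF humb he' hp hp' hcc hc
  have h2 := he.alpha_smul hF he' hp hp' hc.self_of_nhds
  simp only [sphereHeight, sphereCenter, h1, h2, hc.self_of_nhds, map_smul]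
  rcases mul_self_eq_one_iff.1 hcc with h | h <;> rw [h] <;> simp

end Invariants

end Hypersurface

/-! ### Locally constant functions in the presence of isolated exceptional points -/

section Topology

/-- A function that is constant on a punctured neighbourhood of each point of a preconnected set is
constant on the part of the set where it is locally constant. -/
theorem exists_forall_eq_of_punctured {X Y : Type*} [TopologicalSpace X] [T1Space X] {f : X → Y}
    {A R : Set X} (hA : IsPreconnected A)
    (hne : ∀ p ∈ A, (nhdsWithin p {p}ᶜ).NeBot)
    (hloc : ∀ p ∈ A, ∃ c, ∀ᶠ q in nhdsWithin p {p}ᶜ, f q = c)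
    (hR : ∀ p ∈ R ∩ A, ∀ᶠ q in nhds p, f q = f p) :
    ∀ p ∈ R ∩ A, ∀ q ∈ R ∩ A, f p = f q := by
  have hloc' : ∀ p : A, ∃ c, ∀ᶠ q in nhdsWithin (p : X) {(p : X)}ᶜ, f q = c :=
    fun p => hloc p p.2
  -- c p is the constant value of f on a punctured neighbourhood of p. It is locally constant on all
  -- of A, exceptional points included, and equals f on R ∩ A.
  choose c hc using hloc'
  have huniq : ∀ p : A, ∀ y, (∀ᶠ q in nhdsWithin (p : X) {(p : X)}ᶜ, f q = y) → c p = y := by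
    intro p y hy
    have := hne p p.2
    obtain ⟨q, h1, h2⟩ := ((hc p).and hy).exists
    rw [← h1, h2]
  have hcont : ∀ p : A, ∀ᶠ q in nhds p, c q = c p := by
    intro p
    have h1 := eventually_nhdsWithin_iff.1 (hc p)
    have h2 := h1.eventually_nhds
    have h3 : ∀ᶠ q : A in nhds p, ∀ᶠ r in nhds (q : X), r ∈ ({(p : X)}ᶜ : Set X) → f r = c p :=
      continuous_subtype_val.continuousAt.eventually h2
    filter_upwards [h3] with q hq
    by_cases hqp : q = p
    · rw [hqp]
    · refine huniq q _ ?_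
      have h4 : ∀ᶠ r in nhds (q : X), r ∈ ({(p : X)}ᶜ : Set X) :=
        isOpen_compl_singleton.mem_nhds (fun h => hqp (Subtype.ext h))
      filter_upwards [(hq.and h4).filter_mono nhdsWithin_le_nhds] with r hr using hr.1 hr.2
  have : PreconnectedSpace A := isPreconnected_iff_preconnectedSpace.1 hA
  have hlc : IsLocallyConstant c := (IsLocallyConstant.iff_eventually_eq c).2 hcont
  have hfc : ∀ p (hp : p ∈ R ∩ A), c ⟨p, hp.2⟩ = f p := fun p hp =>
    huniq ⟨p, hp.2⟩ _ ((hR p hp).filter_mono nhdsWithin_le_nhds)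
  intro p hp q hq
  rw [← hfc p hp, ← hfc q hq]
  exact hlc.apply_eq_of_preconnectedSpace _ _

/-- `univBall` identifies the whole space with the ball, sending 0 to the center, and a space of
dimension greater than one stays connected without a point. -/
theorem isPreconnected_ball_diff_center {E : Type*} [NormedAddCommGroup E] [NormedSpace ℝ E]
    (h : 1 < Module.rank ℝ E) (c : E) {r : ℝ} (hr : 0 < r) :
    IsPreconnected (Metric.ball c r \ {c}) := by
  set u := OpenPartialHomeomorph.univBall c r with hu
  have h1 : Metric.ball c r \ {c} = u '' {0}ᶜ := by
    ext y
    constructor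
    · rintro ⟨hy, hyc⟩
      have hyt : y ∈ u.target := by
        rw [hu, OpenPartialHomeomorph.univBall_target c hr]; exact hy
      refine ⟨u.symm y, fun h0 => hyc ?_, u.right_inv hyt⟩
      rw [← u.right_inv hyt, Set.mem_singleton_iff.1 h0, hu,
        OpenPartialHomeomorph.univBall_apply_zero]
      rfl
    · rintro ⟨x, hx, rfl⟩
      have hxs : x ∈ u.source := by rw [hu, OpenPartialHomeomorph.univBall_source]; trivial
      have h0s : (0 : E) ∈ u.source := by rw [hu, OpenPartialHomeomorph.univBall_source]; trivial
      refine ⟨?_, fun h0 => hx ?_⟩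
      · rw [← OpenPartialHomeomorph.univBall_target c hr]; exact u.map_source hxs
      · refine u.injOn hxs h0s ?_
        rw [Set.mem_singleton_iff.1 h0, hu, OpenPartialHomeomorph.univBall_apply_zero]
  rw [h1]
  refine (isConnected_compl_singleton_of_one_lt_rank h 0).isPreconnected.image _ ?_
  exact (OpenPartialHomeomorph.continuous_univBall c r).continuousOn

variable {E M : Type*} [NormedAddCommGroup E] [NormedSpace ℝ E] [TopologicalSpace M]
  [ChartedSpace E M]

theorem nhdsNE_neBot_of_chartedSpace [Nontrivial E] (p : M) : (nhdsWithin p {p}ᶜ).NeBot := by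
  set φ := chartAt E p
  have hps : p ∈ φ.source := mem_chart_source _ p
  have : (nhdsWithin (φ p) {φ p}ᶜ).NeBot := Module.punctured_nhds_neBot ℝ E (φ p)
  have ht : Filter.Tendsto φ.symm (nhdsWithin (φ p) {φ p}ᶜ) (nhdsWithin p {p}ᶜ) := by
    refine tendsto_nhdsWithin_iff.2 ⟨?_, ?_⟩
    · have h1 := φ.symm.continuousAt (φ.map_source hps)
      rw [ContinuousAt, φ.left_inv hps] at h1
      exact h1.mono_left nhdsWithin_le_nhds
    · filter_upwards [self_mem_nhdsWithin,
        nhdsWithin_le_nhds (φ.open_target.mem_nhds (φ.map_source hps))] with y hy hyt h0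
      apply hy
      rw [Set.mem_singleton_iff, ← Set.mem_singleton_iff.1 h0, φ.right_inv hyt]
  exact ht.neBot

theorem exists_nhds_isPreconnected_diff (h : 1 < Module.rank ℝ E) {p : M} {O : Set M}
    (hO : O ∈ nhds p) : ∃ V ∈ nhds p, V ⊆ O ∧ IsPreconnected (V \ {p}) := by
  set φ := chartAt E p
  have hps : p ∈ φ.source := mem_chart_source _ p
  have hmem : φ.target ∩ φ.symm ⁻¹' O ∈ nhds (φ p) := by
    refine Filter.inter_mem (φ.open_target.mem_nhds (φ.map_source hps)) ?_
    have h1 := φ.symm.continuousAt (φ.map_source hps)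
    rw [ContinuousAt, φ.left_inv hps] at h1
    exact h1 hO
  obtain ⟨r, hr, hball⟩ := Metric.mem_nhds_iff.1 hmem
  have himg : φ.symm '' Metric.ball (φ p) r = φ.source ∩ φ ⁻¹' Metric.ball (φ p) r :=
    φ.symm_image_eq_source_inter_preimage (fun y hy => (hball hy).1)
  refine ⟨φ.symm '' Metric.ball (φ p) r, ?_, ?_, ?_⟩
  · rw [himg]
    exact (φ.isOpen_inter_preimage Metric.isOpen_ball).mem_nhds ⟨hps, Metric.mem_ball_self hr⟩
  · rintro _ ⟨y, hy, rfl⟩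
    exact (hball hy).2
  · have h2 : φ.symm '' Metric.ball (φ p) r \ {p} = φ.symm '' (Metric.ball (φ p) r \ {φ p}) := by
      ext q
      constructor
      · rintro ⟨⟨y, hy, rfl⟩, hq⟩
        refine ⟨y, ⟨hy, fun h0 => hq ?_⟩, rfl⟩
        rw [Set.mem_singleton_iff.1 h0, φ.left_inv hps]; rfl
      · rintro ⟨y, ⟨hy, hyp⟩, rfl⟩
        refine ⟨⟨y, hy, rfl⟩, fun h0 => hyp ?_⟩
        rw [Set.mem_singleton_iff, ← Set.mem_singleton_iff.1 h0, φ.right_inv (hball hy).1]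
    rw [h2]
    exact (isPreconnected_ball_diff_center h _ hr).image _
      (φ.continuousOn_symm.mono fun y hy => (hball hy.1).1)

theorem eq_of_isPreconnected {X Y : Type*} [TopologicalSpace X] {f : X → Y} {S : Set X}
    (hS : IsPreconnected S) (hf : ∀ p ∈ S, ∀ᶠ q in nhds p, f q = f p) {p q : X} (hp : p ∈ S)
    (hq : q ∈ S) : f p = f q := by
  have : PreconnectedSpace S := isPreconnected_iff_preconnectedSpace.1 hS
  have hlc : IsLocallyConstant (fun x : S => f x) :=
    (IsLocallyConstant.iff_eventually_eq _).2 fun x =>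
      continuous_subtype_val.continuousAt.eventually (hf x x.2)
  exact hlc.apply_eq_of_preconnectedSpace ⟨p, hp⟩ ⟨q, hq⟩

/-- If the complement of `R` is discrete, then a function that is locally constant on `R ∩ A` is
constant there, in dimension at least two. -/
theorem eq_of_locally_constant_off_isolated {Y : Type*} [T1Space M]
    (h : 1 < Module.rank ℝ E) {f : M → Y} {A R : Set M} (hA : IsPreconnected A) (hAo : IsOpen A)
    (hiso : ∀ p ∈ A, ∀ᶠ q in nhdsWithin p {p}ᶜ, q ∈ R)
    (hf : ∀ p ∈ R ∩ A, ∀ᶠ q in nhds p, f q = f p) :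
    ∀ p ∈ R ∩ A, ∀ q ∈ R ∩ A, f p = f q := by
  have : Nontrivial E := rank_pos_iff_nontrivial.1 (zero_lt_one.trans h)
  refine exists_forall_eq_of_punctured hA (fun p _ => nhdsNE_neBot_of_chartedSpace (E := E) p)
    (fun p hp => ?_) hf
  have h1 : {q | q ∈ ({p}ᶜ : Set M) → q ∈ R} ∩ A ∈ nhds p :=
    Filter.inter_mem (eventually_nhdsWithin_iff.1 (hiso p hp)) (hAo.mem_nhds hp)
  obtain ⟨V, hV, hVO, hVc⟩ := exists_nhds_isPreconnected_diff (E := E) h h1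
  have := nhdsNE_neBot_of_chartedSpace (E := E) p
  have hVp : V \ {p} ∈ nhdsWithin p {p}ᶜ :=
    Filter.inter_mem (nhdsWithin_le_nhds hV) self_mem_nhdsWithin
  obtain ⟨q₀, hq₀⟩ := Filter.nonempty_of_mem hVp
  refine ⟨f q₀, ?_⟩
  filter_upwards [hVp] with q hq
  exact eq_of_isPreconnected hVc (fun r hr => hf r ⟨(hVO hr.1).1 hr.2, (hVO hr.1).2⟩) hq hq₀

end Topology

/-! ### Singular points are isolated limits of regular points -/

section Singular

variable {n : ℕ} {M : Type*} [TopologicalSpace M]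
  [ChartedSpace (EuclideanSpace ℝ (Fin (2 * n))) M] [IsManifold (𝓡 (2 * n)) 2 M]
  {F : M → Heis n} {U U' : Set M} {e e' : M → Plane n}
  {φ : OpenPartialHomeomorph M (EuclideanSpace ℝ (Fin (2 * n)))}
  (hφ : φ ∈ IsManifold.maximalAtlas (𝓡 (2 * n)) 2 M)
  {x : EuclideanSpace ℝ (Fin (2 * n))} (hx : x ∈ φ.target)

omit [IsManifold (𝓡 (2 * n)) 2 M] in
include hφ hx in
theorem contDiffAt_two_comp_symm (hF : IsImmersedHypersurface F) :
    ContDiffAt ℝ 2 (F ∘ φ.symm) x := by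
  have h1 : ContMDiffOn (𝓡 (2 * n)) 𝓘(ℝ, Heis n) 2 (F ∘ φ.symm) φ.target :=
    hF.contMDiff.comp_contMDiffOn (contMDiffOn_symm_of_mem_maximalAtlas hφ)
  exact (contMDiffOn_iff_contDiffOn.1 h1).contDiffAt (φ.open_target.mem_nhds hx)

/-- The points of a hypersurface that are singular have no interior. -/
theorem frequently_pullbackContact_ne_zero {E V : Type*} [NormedAddCommGroup E] [NormedSpace ℝ E]
    [NormedAddCommGroup V] [InnerProductSpace ℝ V] [Nontrivial V] {J : V →L[ℝ] V}
    (hJ : IsOrthogonalComplexStructure J) {z : E → V} {t : E → ℝ} {x : E}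
    (hz : ContDiffAt ℝ 2 z x) (ht : ContDiffAt ℝ 2 t x)
    (hsurj : Function.Surjective (fderiv ℝ z x)) :
    ∃ᶠ y in nhds x, ∃ a, pullbackContact J z t y a ≠ 0 := by
  intro hcon
  -- If θ vanished near x, so would dθ at x; but dθ = 2⟨J dz, dz⟩ is nonzero on preimages of v and
  -- Jv.
  have hzero : ∀ a b, fderiv ℝ (fun y => pullbackContact J z t y a) x b = 0 := by
    intro a b
    have h1 : (fun y => pullbackContact J z t y a) =ᶠ[nhds x] fun _ => (0 : ℝ) := by
      filter_upwards [hcon] with y hy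
      by_contra h
      exact hy ⟨a, h⟩
    rw [h1.fderiv_eq]; simp
  obtain ⟨v, hv⟩ := exists_ne (0 : V)
  obtain ⟨b, hb⟩ := hsurj v
  obtain ⟨a, ha⟩ := hsurj (J v)
  have h2 := pullbackContact_antisymm hJ hz ht a b
  rw [hzero, hzero, ha, hb, hJ.inner_map] at h2
  have : inner ℝ v v ≠ 0 := inner_self_ne_zero.2 hv
  apply this
  linarith

theorem plane_nontrivial (hn : 2 ≤ n) : Nontrivial (Plane n) := by
  have h3 : Module.finrank ℝ (Plane n) = 2 * n := by
    rw [finrank_euclideanSpace]; simp; ring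
  exact Module.nontrivial_of_finrank_pos (R := ℝ) (by omega)

theorem continuousAt_fderiv {E W : Type*} [NormedAddCommGroup E] [NormedSpace ℝ E]
    [NormedAddCommGroup W] [NormedSpace ℝ W] {f : E → W} {x : E} (hf : ContDiffAt ℝ 1 f x) :
    ContinuousAt (fderiv ℝ f) x :=
  (hf.fderiv_right (m := 0) (by norm_num)).continuousAt

/-- Near p the singular points are zeros of the C¹ field μ representing θ. The estimate of
`norm_fderiv_le` holds at nearby regular points and, by their density and continuity, at p itself,
so dμ is injective there and p is an isolated zero. -/
theorem eventually_regular_of_isSingular (hn : 2 ≤ n) (hF : IsImmersedHypersurface F)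
    (humb : IsUmbilic F) (hlk : LEqTwoK F) {p : M} (hp : IsSingular F p) :
    (∃ᶠ q in nhds p, q ∈ regularPart F) ∧ ∀ᶠ q in nhdsWithin p {p}ᶜ, q ∈ regularPart F := by
  have hJ := isOrthogonalComplexStructure_JL (n := n)
  set φ := chartAt (EuclideanSpace ℝ (Fin (2 * n))) p with hφdef
  have hφ : φ ∈ IsManifold.maximalAtlas (𝓡 (2 * n)) 2 M := IsManifold.chart_mem_maximalAtlas p
  have hps : p ∈ φ.source := mem_chart_source _ p
  have hinv : φ.symm (φ p) = p := φ.left_inv hps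
  set x := φ p with hxdef
  have hx : x ∈ φ.target := φ.map_source hps
  set z : EuclideanSpace ℝ (Fin (2 * n)) → Plane n := fun y => (F (φ.symm y)).1 with hzdef
  set t : EuclideanSpace ℝ (Fin (2 * n)) → ℝ := fun y => (F (φ.symm y)).2 with htdef
  have hG := contDiffAt_two_comp_symm hφ hx hF
  have hz : ContDiffAt ℝ 2 z x := contDiff_fst.contDiffAt.comp x hG
  have ht : ContDiffAt ℝ 2 t x := contDiff_snd.contDiffAt.comp x hG
  have hz1 : ContDiffAt ℝ 1 (fderiv ℝ z) x := hz.fderiv_right (by norm_num)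
  have ht1 : ContDiffAt ℝ 1 (fderiv ℝ t) x := ht.fderiv_right (by norm_num)
  -- At a singular point TΣ = ξ is transverse to T, so z is a local coordinate map.
  have hinj : Function.Injective (fderiv ℝ z x) := by
    rw [injective_iff_map_eq_zero]
    intro a ha
    have h1 := (mem_tangentPlane_iff_fderiv hφ hx hF _).2 ⟨a, rfl⟩
    rw [hinv, hp, contactPlane, LinearMap.mem_ker, contactForm_apply,
      ← (fderiv_fst_snd hφ hx hF a).1, ha, inner_zero_right, add_zero] at h1
    have h2 : fderiv ℝ (F ∘ φ.symm) x a = 0 :=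
      Prod.ext ((fderiv_fst_snd hφ hx hF a).1.symm.trans ha) h1
    exact (injective_iff_map_eq_zero _).1 (fderiv_comp_symm_injective hφ hx hF) a h2
  have hfr : Module.finrank ℝ (EuclideanSpace ℝ (Fin (2 * n))) = Module.finrank ℝ (Plane n) := by
    rw [finrank_euclideanSpace, finrank_euclideanSpace]; simp; ring
  let L : EuclideanSpace ℝ (Fin (2 * n)) ≃L[ℝ] Plane n :=
    (LinearEquiv.ofInjectiveOfFinrankEq (fderiv ℝ z x).toLinearMap hinj hfr).toContinuousLinearEquiv
  have hL : (L : EuclideanSpace ℝ (Fin (2 * n)) →L[ℝ] Plane n) = fderiv ℝ z x := by ext; rfl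
  have hsurj : Function.Surjective (fderiv ℝ z x) := by
    rw [← hL]; exact L.surjective
  have hinvs : ContDiffAt ℝ 1 (fun y => (fderiv ℝ z y).inverse) x := by
    have h1 := contDiffAt_map_inverse (𝕜 := ℝ) (n := 1) L
    rw [hL] at h1
    exact h1.comp x hz1
  set Θ : EuclideanSpace ℝ (Fin (2 * n)) → EuclideanSpace ℝ (Fin (2 * n)) →L[ℝ] ℝ := fun y =>
    fderiv ℝ t y + (innerSL ℝ (JL n (z y))).comp (fderiv ℝ z y) with hΘ
  have hΘapp : ∀ y a, Θ y a = pullbackContact (JL n) z t y a := fun y a => rfl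
  have hΘs : ContDiffAt ℝ 1 Θ x := by
    refine ht1.add (ContDiffAt.clm_comp ?_ hz1)
    exact (innerSL ℝ).contDiff.contDiffAt.comp x
      ((JL n).contDiff.contDiffAt.comp x (hz.of_le (by norm_num)))
  -- Inverting dz turns θ into a functional on the plane, hence into a vector with ⟨μ, dz⟩ = θ; it
  -- is C¹ because z and t are C².
  set μ : EuclideanSpace ℝ (Fin (2 * n)) → Plane n := fun y =>
    rieszVector n ((Θ y).comp (fderiv ℝ z y).inverse) with hμ
  have hμs : ContDiffAt ℝ 1 μ x :=
    (rieszVector n).contDiff.contDiffAt.comp x (hΘs.clm_comp hinvs)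
  have hequiv : ∀ᶠ y in nhds x, fderiv ℝ z y ∈
      Set.range ((↑) : (EuclideanSpace ℝ (Fin (2 * n)) ≃L[ℝ] Plane n) →
        (EuclideanSpace ℝ (Fin (2 * n)) →L[ℝ] Plane n)) := by
    have hnhds := ContinuousLinearEquiv.nhds L
    rw [hL] at hnhds
    exact hz1.continuousAt.eventually_mem hnhds
  have hμz : ∀ᶠ y in nhds x, Function.Surjective (fderiv ℝ z y) ∧
      ∀ a, inner ℝ (μ y) (fderiv ℝ z y a) = pullbackContact (JL n) z t y a := by
    filter_upwards [hequiv] with y hy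
    obtain ⟨L', hL'⟩ := hy
    refine ⟨by rw [← hL']; exact L'.surjective, fun a => ?_⟩
    rw [hμ, inner_rieszVector, ← hΘapp, ← hL', ContinuousLinearMap.inverse_equiv]
    change Θ y (L'.symm (L' a)) = Θ y a
    rw [L'.symm_apply_apply]
  have hcont : ContinuousAt φ.symm x := φ.symm.continuousAt hx
  have htsymm : Filter.Tendsto φ.symm (nhds x) (nhds p) := by
    have h1 := hcont; rwa [ContinuousAt, hinv] at h1
  have htφ : Filter.Tendsto φ (nhds p) (nhds x) := φ.continuousAt hps
  have htarget : ∀ᶠ y in nhds x, y ∈ φ.target := φ.open_target.mem_nhds hx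
  have hsing : ∀ y ∈ φ.target, IsSingular F (φ.symm y) → ∀ a, pullbackContact (JL n) z t y a = 0 := by
    intro y hy hs a
    have h1 := (mem_tangentPlane_iff_fderiv hφ hy hF _).2 ⟨a, rfl⟩
    rw [hs, contactPlane, LinearMap.mem_ker, ← pullbackContact_eq hφ hy hF] at h1
    exact h1
  have hest : ∀ᶠ y in nhds x, φ.symm y ∈ regularPart F → ∀ a,
      ‖fderiv ℝ z y a‖ ≤ 9 * ‖fderiv ℝ μ y a‖ := by
    filter_upwards [htarget, hμz.eventually_nhds, hμs.eventually (by simp)] with y hy hyμ hys hreg a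
    obtain ⟨-, U, e, he, hyU, -⟩ := humb _ hreg
    have hSE := he.structureEquations hn hF humb hlk hφ hy hyU
    have hUev : ∀ᶠ y' in nhds y, φ.symm y' ∈ U :=
      (φ.symm.continuousAt hy).eventually_mem (he.isOpen.mem_nhds hyU)
    refine hSE.norm_fderiv_le hJ (hys.differentiableAt (by simp)) ?_ ?_ a
    -- As dz is onto, ⟨N, dz⟩ = αθ = α⟨μ, dz⟩ forces N = αμ.
    · filter_upwards [hUev, hyμ, φ.open_target.mem_nhds hy] with y' hy'U hy'μ hy't
      refine ext_inner_right ℝ fun v => ?_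
      obtain ⟨b, rfl⟩ := hy'μ.1 v
      have hSE' := he.structureEquations hn hF humb hlk hφ hy't hy'U
      rw [inner_smul_left, hy'μ.2 b]
      exact hSE'.inner_z b
    · filter_upwards [hUev] with y' hy'
      rw [JL_apply, norm_J, he.norm_eq_one _ hy']
  have := plane_nontrivial hn
  have hfreq : ∃ᶠ y in nhds x, φ.symm y ∈ regularPart F := by
    refine ((frequently_pullbackContact_ne_zero hJ hz ht hsurj).and_eventually htarget).mono ?_
    rintro y ⟨⟨a, ha⟩, hy⟩ hs
    exact ha (hsing y hy hs a)
  -- Both sides are continuous in the point, so a strict violation at x would persist at regular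
  -- points arbitrarily close to x.
  have hbound : ∀ a, ‖fderiv ℝ z x a‖ ≤ 9 * ‖fderiv ℝ μ x a‖ := by
    intro a
    by_contra hcon
    have hc1 : ContinuousAt (fun y => ‖fderiv ℝ z y a‖) x :=
      (hz1.continuousAt.clm_apply continuousAt_const).norm
    have hc2 : ContinuousAt (fun y => 9 * ‖fderiv ℝ μ y a‖) x :=
      continuousAt_const.mul ((continuousAt_fderiv hμs).clm_apply continuousAt_const).norm
    have hlt := hc2.eventually_lt hc1 (not_le.1 hcon)
    obtain ⟨y, hreg, h1, h2⟩ := (hfreq.and_eventually (hest.and hlt)).exists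
    exact absurd (h1 hreg a) (not_le.2 h2)
  refine ⟨htsymm.frequently hfreq, ?_⟩
  have hμd : HasFDerivAt μ (fderiv ℝ μ x) x := (hμs.differentiableAt (by simp)).hasFDerivAt
  -- Since dz is bounded below at x, the bound makes dμ bounded below, so μ cannot take the value 0
  -- near x except possibly at x.
  have hne : ∀ᶠ y in nhdsWithin x {x}ᶜ, μ y ≠ 0 := by
    refine hμd.eventually_ne ?_
    obtain ⟨C, hC⟩ : ∃ C : NNReal, AntilipschitzWith C L := ⟨_, L.antilipschitz⟩
    refine ⟨C * 9, AddMonoidHomClass.antilipschitz_of_bound _ fun a => ?_⟩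
    have h1 : ‖a‖ ≤ C * ‖L a‖ := by
      have := hC.le_mul_dist a 0
      simpa using this
    have h2 : L a = fderiv ℝ z x a := by rw [← hL]; rfl
    rw [h2] at h1
    have h3 := mul_le_mul_of_nonneg_left (hbound a) C.coe_nonneg
    push_cast
    linarith
  have htne : Filter.Tendsto φ (nhdsWithin p {p}ᶜ) (nhdsWithin x {x}ᶜ) := by
    refine tendsto_nhdsWithin_iff.2 ⟨htφ.mono_left nhdsWithin_le_nhds, ?_⟩
    filter_upwards [self_mem_nhdsWithin,
      nhdsWithin_le_nhds (φ.open_source.mem_nhds hps)] with q hq hqs h0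
    exact hq (φ.injOn hqs hps h0)
  filter_upwards [htne.eventually hne, nhdsWithin_le_nhds (φ.open_source.mem_nhds hps)]
    with q hq hqs hs
  apply hq
  have hΘ0 : Θ (φ q) = 0 := ContinuousLinearMap.ext fun a => by
    rw [hΘapp, hsing (φ q) (φ.map_source hqs) (by rw [φ.left_inv hqs]; exact hs) a]; rfl
  simp [hμ, hΘ0]

end Singular

/-! ### Recognizing the Pansu sphere -/

section Pansu

variable {n : ℕ}

theorem isClosed_pansuSphere (lam : ℝ) : IsClosed (pansuSphere n lam) := by
  have hc : Continuous fun p : Heis n => 1 / (2 * lam ^ 2) *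
      (lam * ‖p.1‖ * Real.sqrt (1 - lam ^ 2 * ‖p.1‖ ^ 2) + Real.arccos (lam * ‖p.1‖)) := by
    have := Real.continuous_arccos
    fun_prop
  have hn : Continuous fun p : Heis n => ‖p.1‖ := by fun_prop
  exact (isClosed_le hn continuous_const).inter
    ((isClosed_eq continuous_snd hc).union (isClosed_eq continuous_snd hc.neg))

theorem continuous_mul_left (g : Heis n) : Continuous (mul g) := by
  have h : mul g = fun q : Heis n => (g.1 + q.1, g.2 + q.2 - inner ℝ (J g.1) q.1) := by
    funext q; exact mul_eq g q
  rw [h]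
  fun_prop

theorem arccos_cos_arctan (s : ℝ) : Real.arccos (Real.cos (Real.arctan s)) = |Real.arctan s| := by
  rw [← Real.cos_abs, Real.arccos_cos (abs_nonneg _)]
  have h1 := Real.arctan_lt_pi_div_two s
  have h2 := Real.neg_pi_div_two_lt_arctan s
  rw [abs_le]
  constructor <;> linarith [Real.pi_pos]

/-- With s = α/k, the radius condition reads λ|z| = cos(arctan s), so that the defining function of
the sphere becomes the profile at |s|; the sign of s selects the upper or the lower graph. -/
theorem mem_pansuSphere {lam k α : ℝ} (hlam : 0 < lam) (hk : |k| = lam) {p : Heis n}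
    (h1 : ‖p.1‖ ^ 2 = (k ^ 2 + α ^ 2)⁻¹)
    (h2 : p.2 = (2 * k ^ 2)⁻¹ * profile (α * k⁻¹)) : p ∈ pansuSphere n lam := by
  have hk2 : k ^ 2 = lam ^ 2 := by rw [← hk, sq_abs]
  have hk0 : k ≠ 0 := by
    rintro rfl; simp at hk; linarith
  set s := α * k⁻¹ with hs
  have hα : α = s * k := by rw [hs]; field_simp
  have hspos : 0 < 1 + s ^ 2 := by positivity
  have hsum : k ^ 2 + α ^ 2 = lam ^ 2 * (1 + s ^ 2) := by rw [hα, ← hk2]; ring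
  have hcos : lam * ‖p.1‖ = Real.cos (Real.arctan s) := by
    rw [Real.cos_arctan]
    have h3 : (lam * ‖p.1‖) ^ 2 = (1 / Real.sqrt (1 + s ^ 2)) ^ 2 := by
      rw [mul_pow, h1, hsum, div_pow, Real.sq_sqrt hspos.le]
      field_simp
    exact (sq_eq_sq₀ (by positivity) (by positivity)).1 h3
  have hcos2 : lam ^ 2 * ‖p.1‖ ^ 2 = (1 + s ^ 2)⁻¹ := by
    rw [h1, hsum]; field_simp
  have hsqrt : lam * ‖p.1‖ * Real.sqrt (1 - lam ^ 2 * ‖p.1‖ ^ 2) = |s| * (1 + s ^ 2)⁻¹ := by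
    have h4 : 1 - lam ^ 2 * ‖p.1‖ ^ 2 = (s / Real.sqrt (1 + s ^ 2)) ^ 2 := by
      rw [hcos2, div_pow, Real.sq_sqrt hspos.le]; field_simp; ring
    rw [h4, Real.sqrt_sq_eq_abs, abs_div, abs_of_nonneg (Real.sqrt_nonneg _), hcos,
      Real.cos_arctan]
    have h5 := Real.mul_self_sqrt hspos.le
    have h6 : Real.sqrt (1 + s ^ 2) ≠ 0 := (Real.sqrt_pos.2 hspos).ne'
    rw [div_mul_div_comm, h5]
    field_simp
  have hf : 1 / (2 * lam ^ 2) *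
      (lam * ‖p.1‖ * Real.sqrt (1 - lam ^ 2 * ‖p.1‖ ^ 2) + Real.arccos (lam * ‖p.1‖)) =
      (2 * k ^ 2)⁻¹ * (|s| * (1 + s ^ 2)⁻¹ + |Real.arctan s|) := by
    rw [hsqrt, hcos, arccos_cos_arctan, hk2, one_div]
  refine ⟨?_, ?_⟩
  · rw [le_div_iff₀ hlam, mul_comm, hcos]; exact Real.cos_le_one _
  · rw [hf, h2, profile]
    rcases le_total 0 s with h0 | h0
    · left
      rw [abs_of_nonneg h0, abs_of_nonneg (Real.arctan_nonneg.2 h0)]; ring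
    · right
      have h7 : Real.arctan s ≤ 0 := by
        have := Real.arctan_nonneg.2 (neg_nonneg.2 h0)
        rw [Real.arctan_neg] at this
        linarith
      rw [abs_of_nonpos h0, abs_of_nonpos h7]; ring

end Pansu

/-! ### Global conclusions -/

section Global

variable {n : ℕ} {M : Type*} [TopologicalSpace M]
  [ChartedSpace (EuclideanSpace ℝ (Fin (2 * n))) M] [IsManifold (𝓡 (2 * n)) 2 M]
  {F : M → Heis n} {U U' : Set M} {e e' : M → Plane n}

theorem one_lt_rank_euclideanSpace (hn : 2 ≤ n) :
    1 < Module.rank ℝ (EuclideanSpace ℝ (Fin (2 * n))) :=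
  Module.one_lt_rank_of_one_lt_finrank (by simp; omega)

theorem eventually_mem_regularPart (hn : 2 ≤ n) (hF : IsImmersedHypersurface F)
    (humb : IsUmbilic F) (hlk : LEqTwoK F) (p : M) :
    ∀ᶠ q in nhdsWithin p {p}ᶜ, q ∈ regularPart F := by
  by_cases hp : IsSingular F p
  · exact (eventually_regular_of_isSingular hn hF humb hlk hp).2
  · obtain ⟨-, U, e, he, hpU, -⟩ := humb p hp
    exact nhdsWithin_le_nhds (Filter.mem_of_superset (he.isOpen.mem_nhds hpU)
      he.subset_regularPart)

/-- No global field e is assumed here, so the sign of k has no meaning; |k| is a well defined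
function on the regular part and is locally constant there. -/
theorem abs_kCurv_const [T2Space M] (hn : 2 ≤ n) (hF : IsImmersedHypersurface F)
    (humb : IsUmbilic F) (hlk : LEqTwoK F) {A : Set M} (hA : IsPreconnected A) (hAo : IsOpen A) :
    ∃ lam : ℝ, 0 ≤ lam ∧ ∀ (U : Set M) (e : M → Plane n), IsCharacteristicField F U e →
      ∀ p ∈ U ∩ A, |kCurv F e p| = lam := by
  obtain ⟨g, hg⟩ := exists_abs_kCurv hn hF humb
  have hloc : ∀ p ∈ regularPart F ∩ A, ∀ᶠ q in nhds p, g q = g p := by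
    rintro p ⟨hp, -⟩
    obtain ⟨-, U, e, he, hpU, -⟩ := humb p hp
    filter_upwards [he.eventually_kCurv_eq hn hF humb hlk hpU, he.isOpen.mem_nhds hpU] with q hq hqU
    rw [← hg U e he q hqU, ← hg U e he p hpU, hq]
  have hconst := eq_of_locally_constant_off_isolated (one_lt_rank_euclideanSpace hn) hA hAo
    (fun p _ => eventually_mem_regularPart hn hF humb hlk p) hloc
  rcases (regularPart F ∩ A).eq_empty_or_nonempty with h | ⟨p₁, hp₁⟩
  · refine ⟨0, le_rfl, fun U e he p hp => ?_⟩
    have : p ∈ regularPart F ∩ A := ⟨he.subset_regularPart hp.1, hp.2⟩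
    rw [h] at this
    exact absurd this (Set.notMem_empty p)
  · refine ⟨g p₁, ?_, fun U e he p hp => ?_⟩
    · obtain ⟨-, U, e, he, hpU, -⟩ := humb p₁ hp₁.1
      rw [← hg U e he p₁ hpU]; exact abs_nonneg _
    · rw [hg U e he p hp.1]
      exact hconst p ⟨he.subset_regularPart hp.1, hp.2⟩ p₁ hp₁

theorem kCurv_const [T2Space M] (hn : 2 ≤ n) (hF : IsImmersedHypersurface F)
    (humb : IsUmbilic F) (hlk : LEqTwoK F) {A : Set M} (hA : IsPreconnected A) (hAo : IsOpen A)
    (he : IsCharacteristicField F (regularPart F ∩ A) e) :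
    ∃ c : ℝ, ∀ p ∈ regularPart F ∩ A, kCurv F e p = c := by
  have hconst := eq_of_locally_constant_off_isolated (one_lt_rank_euclideanSpace hn) hA hAo
    (fun p _ => eventually_mem_regularPart hn hF humb hlk p)
    (fun p hp => he.eventually_kCurv_eq hn hF humb hlk hp)
  rcases (regularPart F ∩ A).eq_empty_or_nonempty with h | ⟨p₁, hp₁⟩
  · exact ⟨0, fun p hp => absurd (h ▸ hp) (Set.notMem_empty p)⟩
  · exact ⟨kCurv F e p₁, fun p hp => hconst p hp p₁ hp₁⟩

theorem mem_closure_regularPart (hn : 2 ≤ n) (hF : IsImmersedHypersurface F)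
    (humb : IsUmbilic F) (hlk : LEqTwoK F) (p : M) : p ∈ closure (regularPart F) := by
  by_cases hp : IsSingular F p
  · exact mem_closure_iff_frequently.2 (eventually_regular_of_isSingular hn hF humb hlk hp).1
  · exact subset_closure hp

/-- Center and height are the same at all regular points. Translating this common point to the
origin puts the regular part into the sphere. -/
theorem exists_mul_mem_pansuSphere [T2Space M] [ConnectedSpace M] (hn : 2 ≤ n)
    (hF : IsImmersedHypersurface F) (humb : IsUmbilic F) (hlk : LEqTwoK F) {lam : ℝ}
    (hlam : 0 < lam)
    (hk : ∀ (U : Set M) (e : M → Plane n), IsCharacteristicField F U e → ∀ p ∈ U,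
      |kCurv F e p| = lam) :
    ∃ g : Heis n, ∀ p, mul g (F p) ∈ pansuSphere n lam := by
  obtain ⟨g, hg⟩ := exists_center hn hF humb
  have hk0 : ∀ (U : Set M) (e : M → Plane n), IsCharacteristicField F U e → ∀ p ∈ U,
      kCurv F e p ≠ 0 := by
    intro U e he p hp h0
    have := hk U e he p hp
    rw [h0, abs_zero] at this
    exact hlam.ne this
  have hloc : ∀ p ∈ regularPart F ∩ Set.univ, ∀ᶠ q in nhds p, g q = g p := by
    rintro p ⟨hp, -⟩
    obtain ⟨-, U, e, he, hpU, -⟩ := humb p hp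
    filter_upwards [he.eventually_center_eq hn hF humb hlk (hk0 U e he) hpU,
      he.eventually_height_eq hn hF humb hlk (hk0 U e he) hpU, he.isOpen.mem_nhds hpU]
      with q hq1 hq2 hqU
    rw [← hg U e he q hqU, ← hg U e he p hpU, hq1, hq2]
  have hconst := eq_of_locally_constant_off_isolated (one_lt_rank_euclideanSpace hn)
    isPreconnected_univ isOpen_univ
    (fun p _ => eventually_mem_regularPart hn hF humb hlk p) hloc
  obtain ⟨p₀⟩ : Nonempty M := inferInstance
  obtain ⟨p₁, hp₁⟩ := closure_nonempty_iff.1 ⟨p₀, mem_closure_regularPart hn hF humb hlk p₀⟩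
  -- The group inverse of the point (center, height).
  refine ⟨(-(g p₁).1, -(g p₁).2), fun p => ?_⟩
  have hclosed : IsClosed {p | mul (-(g p₁).1, -(g p₁).2) (F p) ∈ pansuSphere n lam} :=
    (isClosed_pansuSphere lam).preimage ((continuous_mul_left _).comp hF.contMDiff.continuous)
  -- The sphere is closed and regular points are dense, so regular points suffice.
  refine closure_minimal (fun q hq => ?_) hclosed (mem_closure_regularPart hn hF humb hlk p)
  obtain ⟨-, U, e, he, hqU, -⟩ := humb q hq
  have h1 := hg U e he q hqU
  rw [hconst q ⟨hq, trivial⟩ p₁ ⟨hp₁, trivial⟩] at h1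
  have hD : kCurv F e q ^ 2 + alpha F e q ^ 2 ≠ 0 := by
    have := hk0 U e he q hqU
    positivity
  have hC : (g p₁).1 = (F q).1 + (kCurv F e q ^ 2 + alpha F e q ^ 2)⁻¹ •
      (kCurv F e q • JL n (e q) + alpha F e q • JL n (JL n (e q))) := by rw [← h1]; rfl
  have hτ : (g p₁).2 = (F q).2 + inner ℝ (JL n (g p₁).1) (F q).1 -
      (2 * kCurv F e q ^ 2)⁻¹ * profile (alpha F e q * (kCurv F e q)⁻¹) := by rw [← h1]; rfl
  refine mem_pansuSphere hlam (hk U e he q hqU) (α := alpha F e q) ?_ ?_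
  · rw [mul_eq, hC]
    have hsimp : -((F q).1 + (kCurv F e q ^ 2 + alpha F e q ^ 2)⁻¹ •
      (kCurv F e q • JL n (e q) + alpha F e q • JL n (JL n (e q)))) + (F q).1 =
      -((kCurv F e q ^ 2 + alpha F e q ^ 2)⁻¹ •
        (kCurv F e q • J (e q) - alpha F e q • e q)) := by
      simp only [JL_apply, J_sq]
      module
    have hee : inner ℝ (e q) (e q) = (1 : ℝ) := by
      rw [real_inner_self_eq_norm_sq, he.norm_eq_one q hqU]; norm_num
    simp only [hsimp]
    rw [norm_neg, norm_smul, mul_pow, Real.norm_eq_abs, sq_abs,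
      ← real_inner_self_eq_norm_sq (kCurv F e q • J (e q) - alpha F e q • e q)]
    simp only [inner_sub_left, inner_sub_right, inner_smul_left, inner_smul_right, inner_J_J,
      inner_J_self, inner_self_J, hee, conj_trivial]
    field_simp
    ring
  · rw [mul_eq, hτ]
    simp only [map_neg, inner_neg_left, JL_apply]
    ring

theorem exists_mul_snd_eq [T2Space M] [ConnectedSpace M] (hn : 2 ≤ n)
    (hF : IsImmersedHypersurface F) (humb : IsUmbilic F) (hlk : LEqTwoK F)
    (hk : ∀ (U : Set M) (e : M → Plane n), IsCharacteristicField F U e → ∀ p ∈ U,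
      kCurv F e p = 0) {p₀ : M} (hp₀ : IsSingular F p₀) :
    ∃ (c : ℝ) (g : Heis n), ∀ p, (mul g (F p)).2 = c := by
  have hloc : ∀ p ∈ regularPart F ∩ Set.univ, ∀ᶠ q in nhds p,
      tangentPlane F q = tangentPlane F p := by
    rintro p ⟨hp, -⟩
    obtain ⟨-, U, e, he, hpU, -⟩ := humb p hp
    exact he.eventually_tangentPlane_eq hn hF humb hlk (hk U e he) hpU
  have hconst := eq_of_locally_constant_off_isolated (one_lt_rank_euclideanSpace hn)
    isPreconnected_univ isOpen_univ
    (fun p _ => eventually_mem_regularPart hn hF humb hlk p) hloc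
  obtain ⟨p₁, hp₁⟩ := closure_nonempty_iff.1 ⟨p₀, mem_closure_regularPart hn hF humb hlk p₀⟩
  have hall : ∀ p, tangentPlane F p = tangentPlane F p₁ := by
    intro p
    by_cases hp : IsSingular F p
    swap
    · exact hconst p ⟨hp, trivial⟩ p₁ ⟨hp₁, trivial⟩
    -- At a singular point, tangent vectors are limits of tangent vectors at regular points, all in
    -- one fixed closed hyperplane; equality follows by dimension.
    refine Submodule.eq_of_le_of_finrank_eq ?_
      ((finrank_tangentPlane hF p).trans (finrank_tangentPlane hF p₁).symm)
    intro w hw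
    set φ := chartAt (EuclideanSpace ℝ (Fin (2 * n))) p
    have hφ : φ ∈ IsManifold.maximalAtlas (𝓡 (2 * n)) 2 M := IsManifold.chart_mem_maximalAtlas p
    have hps : p ∈ φ.source := mem_chart_source _ p
    have hinv : φ.symm (φ p) = p := φ.left_inv hps
    have hx : φ p ∈ φ.target := φ.map_source hps
    rw [← hinv, mem_tangentPlane_iff_fderiv hφ hx hF] at hw
    obtain ⟨a, rfl⟩ := hw
    have hcont : Filter.Tendsto (fun q => fderiv ℝ (F ∘ φ.symm) (φ q) a) (nhds p)
        (nhds (fderiv ℝ (F ∘ φ.symm) (φ p) a)) := by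
      have h1 : ContinuousAt (fun y => fderiv ℝ (F ∘ φ.symm) y a) (φ p) :=
        (continuousAt_fderiv ((contDiffAt_two_comp_symm hφ hx hF).of_le (by norm_num))).clm_apply
          continuousAt_const
      exact h1.tendsto.comp (φ.continuousAt hps)
    refine (Submodule.closed_of_finiteDimensional (tangentPlane F p₁)).mem_of_frequently_of_tendsto
      ?_ hcont
    have hfreq := (eventually_regular_of_isSingular hn hF humb hlk hp).1
    refine (hfreq.and_eventually (φ.open_source.mem_nhds hps)).mono ?_
    rintro q ⟨hq, hqs⟩
    rw [SetLike.mem_coe, ← hconst q ⟨hq, trivial⟩ p₁ ⟨hp₁, trivial⟩]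
    have h2 := (mem_tangentPlane_iff_fderiv hφ (φ.map_source hqs) hF
      (fderiv ℝ (F ∘ φ.symm) (φ q) a)).2 ⟨a, rfl⟩
    rwa [φ.left_inv hqs] at h2
  have hcontact : ∀ p, tangentPlane F p = contactPlane (F p₀) := fun p => by
    rw [hall p, ← hall p₀, hp₀]
  -- Every tangent hyperplane is ker Λ, so the linear function Λ has zero differential along Σ.
  set Λ : Heis n →L[ℝ] ℝ := LinearMap.toContinuousLinearMap (contactForm (F p₀)) with hΛ
  have hΛloc : ∀ p ∈ (Set.univ : Set M), ∀ᶠ q in nhds p, Λ (F q) = Λ (F p) := by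
    intro p hp
    obtain ⟨V, hV, -, h⟩ := exists_nhds_forall_eq (n := n) isOpen_univ hp ℝ
    filter_upwards [hV] with q hq
    refine h (fun q => Λ (F q)) (fun φ hφ x hx _ => ?_) q hq
    have h1 := (differentiableAt_comp_symm hφ hx (hF.mdifferentiableAt _)).1
    refine (Λ.hasFDerivAt.comp x h1.hasFDerivAt).congr_fderiv (ContinuousLinearMap.ext fun a => ?_)
    have h2 := (mem_tangentPlane_iff_fderiv hφ hx hF _).2 ⟨a, rfl⟩
    rw [hcontact, contactPlane, LinearMap.mem_ker] at h2
    exact h2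
  -- Left translation by (-z₀, 0) sends (z, t) to height t + ⟨J z₀, z⟩, which is Λ(z, t).
  refine ⟨Λ (F p₀), (-(F p₀).1, 0), fun p => ?_⟩
  rw [eq_of_isPreconnected (f := fun q => Λ (F q)) isPreconnected_univ hΛloc
    (Set.mem_univ p₀) (Set.mem_univ p)]
  rw [mul_eq, hΛ, LinearMap.coe_toContinuousLinearMap', contactForm_apply]
  simp only [map_neg, inner_neg_left]
  ring

end Global

end Heisenberg

end

theorem theorem1p4 (n : ℕ) (hn : 2 ≤ n) {M : Type*} [TopologicalSpace M] [T2Space M]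
    [ChartedSpace (EuclideanSpace ℝ (Fin (2 * n))) M] [IsManifold (𝓡 (2 * n)) 2 M]
    (F : M → Heisenberg.Heis n) (hF : Heisenberg.IsImmersedHypersurface F)
    (humb : Heisenberg.IsUmbilic F) (hlk : Heisenberg.LEqTwoK F) :
    (∀ p₀ : M,
      -- on the regular part of each component, `k` and `l` are constant up to the sign of `e_n`
      (∃ lam : ℝ, 0 ≤ lam ∧ ∀ (U : Set M) (e : M → Heisenberg.Plane n),
        Heisenberg.IsCharacteristicField F U e → ∀ p ∈ U ∩ connectedComponent p₀,
          |Heisenberg.kCurv F e p| = lam ∧ |Heisenberg.lCurv F e p| = 2 * lam) ∧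
      -- and they are constant for every `e_n` defined on that whole regular part
      (∀ e : M → Heisenberg.Plane n,
        Heisenberg.IsCharacteristicField F (Heisenberg.regularPart F ∩ connectedComponent p₀) e →
        ∃ c : ℝ, ∀ p ∈ Heisenberg.regularPart F ∩ connectedComponent p₀,
          Heisenberg.kCurv F e p = c ∧ Heisenberg.lCurv F e p = 2 * c)) ∧
    (ConnectedSpace M → (∃ p, Heisenberg.IsSingular F p) →
      (∃ lam : ℝ, 0 < lam ∧ ∃ g : Heisenberg.Heis n,
        ∀ p, Heisenberg.mul g (F p) ∈ Heisenberg.pansuSphere n lam) ∨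
      (∃ (c : ℝ) (g : Heisenberg.Heis n), ∀ p, (Heisenberg.mul g (F p)).2 = c)) := by
  refine ⟨fun p₀ => ?_, fun hconn hsing => ?_⟩
  -- Local connectedness makes the component open, as required for local constancy at its points.
  · have : LocallyConnectedSpace M :=
      ChartedSpace.locallyConnectedSpace (EuclideanSpace ℝ (Fin (2 * n))) M
    have hAo : IsOpen (connectedComponent p₀) := isOpen_connectedComponent
    have hA : IsPreconnected (connectedComponent p₀) := isPreconnected_connectedComponent
    refine ⟨?_, fun e he => ?_⟩
    · obtain ⟨lam, h0, h⟩ := Heisenberg.abs_kCurv_const hn hF humb hlk hA hAo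
      refine ⟨lam, h0, fun U e he p hp => ⟨h U e he p hp, ?_⟩⟩
      rw [hlk U e he p hp.1, abs_mul, h U e he p hp, abs_two]
    · obtain ⟨c, hc⟩ := Heisenberg.kCurv_const hn hF humb hlk hA hAo he
      refine ⟨c, fun p hp => ⟨hc p hp, ?_⟩⟩
      rw [hlk _ e he p hp, hc p hp]
  · obtain ⟨p₀, hp₀⟩ := hsing
    obtain ⟨lam, h0, h⟩ := Heisenberg.abs_kCurv_const hn hF humb hlk
      (isPreconnected_univ (α := M)) isOpen_univ
    -- The constant |k| decides: zero gives the hyperplane, a positive value the sphere of that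
    -- parameter.
    rcases h0.eq_or_lt with h0 | h0
    · right
      refine Heisenberg.exists_mul_snd_eq hn hF humb hlk (fun U e he p hp => ?_) hp₀
      rw [← abs_eq_zero, h U e he p ⟨hp, trivial⟩, h0]
    · left
      exact ⟨lam, h0, Heisenberg.exists_mul_mem_pansuSphere hn hF humb hlk h0
        fun U e he p hp => h U e he p ⟨hp, trivial⟩⟩
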